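/- Notation. $\pi(x,\xi)g(t)=e^{2\pi i \xi t}g(t-x)$; $\langle\cdot,\cdot\rangle$ is the duality between $\mathcal S'$ and $\mathcal S$, conjugate-linear in the second entry; $V_gf(x,\xi)=\langle f,\pi(x,\xi)g\rangle$. For $\tau\in(0,1)$ and $\sigma\in\mathcal S'(\mathbb R^{2d})$, $\mathrm{Op}_\tau(\sigma):\mathcal S(\mathbb R^d)\to\mathcal S'(\mathbb R^d)$ is defined by $\langle \mathrm{Op}_\tau(\sigma)f,g\rangle=\langle\sigma,W_\tau(g,f)\rangle$, where $W_\tau(g,f)(x,\omega)=\int_{\mathbb R^d}e^{-2\pi i y\omega}g(x+\tau y)\overline{f(x-(1-\tau)y)}\,dy$. Let $J^{-1}(z_1,z_2)=(-z_2,z_1)$ and $\mathcal B_\tau(z_1,z_2)=\left(\frac{1}{1-\tau}z_1,\frac1\tau z_2\right)$ on $\mathbb R^{2d}$. For positive weights $u,w$ on $\mathbb R^n$ and a window $g\in\mathcal S(\mathbb R^n)\setminus\{0\}$, $W(\mathcal FL^p_u,L^q_w)(\mathbb R^n)$ is the space of $f\in\mathcal S'(\mathbb R^n)$ with $$\|f\|=\left(\int\left(\int|V_gf(x,\xi)|^pu(\xi)^p\,d\xi\right)^{q/p}w(x)^q\,dx\right)^{1/q}<\infty$$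 (usual modifications for $p=\infty$ or $q=\infty$). If $u\otimes w$ is $\nu$-moderate, the window may be any nonzero $g\in\mathcal S(\mathbb R^n)$ with $\iint|V_\varphi g(x,\xi)|\,\nu(\xi,x)\,dx\,d\xi<\infty$, $\varphi(t)=e^{-\pi|t|^2}$. Let $v$ be an admissible weight on $\mathbb R^{2d}$: $v\ge0$ is continuous, $v(0)=1$, $v$ is even in each coordinate, $v(w+z)\le v(w)v(z)$, and $\lim_{n\to\infty}v(nz)^{1/n}=1$ for all $z$. Let $m_1,m_2$ be positive, even (measurable) weights on $\mathbb R^d$ such that $m=m_1\otimes m_2$, $m(x,\xi)=m_1(x)m_2(\xi)$, is $v$-moderate, i.e. $m(z_1+z_2)\le C\,v(z_1)m(z_2)$ for some constant $C$ and all $z_1,z_2$, and satisfies either $m\ge1$ or $m(z)\ge c(1+|z|^2)^{-N/2}$ for some $c>0$, $N\in\mathbb N$. **Theorem.** Let $\tau\in(0,1)$, $1\le p,q\le\infty$ and $\sigma\in W(\mathcal FL^\infty,L^1_{v\circ\mathcal B_\tau\circ J^{-1}})(\mathbb R^{2d})$. Then $\mathrm{Op}_\tau(\sigma)$ is bounded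 from $$W(\mathcal FL^p_{m_1},L^q_{m_2})(\mathbb R^d)\quad\text{to}\quad W\left(\mathcal FL^p_{m_1\circ(\mathcal U_{1-\tau}^{-1})_1},L^q_{m_2\circ(\mathcal U_{1-\tau}^{-1})_2}\right)(\mathbb R^d),$$ where $$(\mathcal U_{1-\tau}^{-1})_1(x)=-\frac{\tau}{1-\tau}x,\qquad(\mathcal U_{1-\tau}^{-1})_2(x)=-\frac{1-\tau}{\tau}x .$$ Here bounded means: the operator $\mathrm{Op}_\tau(\sigma)$, given on the Schwartz functions of the source space, extends to a linear operator on the whole source space which is bounded in norm into the target space and which, on norm-bounded sets, is sequentially continuous for the weak topology of $\mathcal S'(\mathbb R^d)$. (The windows of the symbol space, the source space and the target space may be any windows allowed above, with $\nu(\zeta,X)=v(\mathcal B_\tau J^{-1}X)$, $\nu=v$ and $\nu(\xi,x)=v\left(-\frac{\tau}{1-\tau}\xi,-\frac{1-\tau}{\tau}x\right)$ respectively.) -/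

import Mathlib

open MeasureTheory SchwartzMap Filter Topology FourierTransform
open scoped ENNReal NNReal ContDiff InnerProductSpace

noncomputable section

set_option linter.unusedSectionVars false

namespace TauPseudo

section PartialFourier

variable {E : Type} [NormedAddCommGroup E] [InnerProductSpace ℝ E] [FiniteDimensional ℝ E]
  [MeasurableSpace E] [BorelSpace E]
variable {F : Type} [NormedAddCommGroup F] [NormedSpace ℂ F] [NormedSpace ℝ F]
  [IsScalarTower ℝ ℂ F]

/-- `ψ ↦ ψ ⊗ f`, i.e. `(tensorRight f ψ) (s, t) = ψ s * f t`. -/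
def tensorRight (f : 𝓢(E, ℂ)) : 𝓢(E, ℂ) →L[ℂ] 𝓢(E × E, ℂ) :=
  SchwartzMap.mkCLM (fun ψ z => ψ z.1 * f z.2)
    (fun φ ψ z => by simp [add_mul]) (fun a ψ z => by simp [mul_assoc])
    (fun ψ => ((ψ.smooth ⊤).comp contDiff_fst).mul ((f.smooth ⊤).comp contDiff_snd)) <| by
  rintro ⟨k, n⟩
  let S := Finset.Iic k ×ˢ Finset.Iic n
  refine ⟨S, ∑ i ∈ Finset.range (n + 1), (n.choose i : ℝ) *
    (SchwartzMap.seminorm ℂ 0 (n - i) f + SchwartzMap.seminorm ℂ k (n - i) f), by positivity, ?_⟩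
  intro ψ z
  have hS : ∀ a b, a ≤ k → b ≤ n → SchwartzMap.seminorm ℂ a b ψ ≤
      S.sup (schwartzSeminormFamily ℂ E ℂ) ψ := by
    intro a b ha hb
    have : (a, b) ∈ S := by simp [S, ha, hb]
    exact (Finset.le_sup (f := schwartzSeminormFamily ℂ E ℂ) this) ψ
  have h1 : ∀ i (g : 𝓢(E, ℂ)), ‖iteratedFDeriv ℝ i (fun z : E × E => g z.1) z‖ ≤
      ‖iteratedFDeriv ℝ i g z.1‖ := by
    intro i g
    have := (ContinuousLinearMap.fst ℝ E E).iteratedFDeriv_comp_right (g.smooth ⊤) z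
      (i := i) (mod_cast le_top)
    change ‖iteratedFDeriv ℝ i (g ∘ ContinuousLinearMap.fst ℝ E E) z‖ ≤ _
    rw [this]
    refine (ContinuousMultilinearMap.norm_compContinuousLinearMap_le _ _).trans ?_
    refine mul_le_of_le_one_right (norm_nonneg _) (Finset.prod_le_one (fun _ _ => norm_nonneg _)
      fun _ _ => ContinuousLinearMap.norm_fst_le _ _ _)
  have h2 : ∀ i (g : 𝓢(E, ℂ)), ‖iteratedFDeriv ℝ i (fun z : E × E => g z.2) z‖ ≤
      ‖iteratedFDeriv ℝ i g z.2‖ := by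
    intro i g
    have := (ContinuousLinearMap.snd ℝ E E).iteratedFDeriv_comp_right (g.smooth ⊤) z
      (i := i) (mod_cast le_top)
    change ‖iteratedFDeriv ℝ i (g ∘ ContinuousLinearMap.snd ℝ E E) z‖ ≤ _
    rw [this]
    refine (ContinuousMultilinearMap.norm_compContinuousLinearMap_le _ _).trans ?_
    refine mul_le_of_le_one_right (norm_nonneg _) (Finset.prod_le_one (fun _ _ => norm_nonneg _)
      fun _ _ => ContinuousLinearMap.norm_snd_le _ _ _)
  have hz : ‖z‖ ^ k ≤ ‖z.1‖ ^ k + ‖z.2‖ ^ k := by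
    rw [Prod.norm_def]
    rcases max_choice ‖z.1‖ ‖z.2‖ with h | h <;> rw [h]
    · exact le_add_of_nonneg_right (by positivity)
    · exact le_add_of_nonneg_left (by positivity)
  have c1 : ContDiff ℝ ∞ (fun z : E × E => ψ z.1) := (ψ.smooth ⊤).comp contDiff_fst
  have c2 : ContDiff ℝ ∞ (fun z : E × E => f z.2) := (f.smooth ⊤).comp contDiff_snd
  have hmul := norm_iteratedFDeriv_mul_le c1 c2 z (n := n) (mod_cast le_top)
  calc ‖z‖ ^ k * ‖iteratedFDeriv ℝ n (fun z : E × E => ψ z.1 * f z.2) z‖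
      ≤ (‖z.1‖ ^ k + ‖z.2‖ ^ k) * ∑ i ∈ Finset.range (n + 1), (n.choose i : ℝ) *
          ‖iteratedFDeriv ℝ i (fun z : E × E => ψ z.1) z‖ *
          ‖iteratedFDeriv ℝ (n - i) (fun z : E × E => f z.2) z‖ := by gcongr
    _ ≤ (‖z.1‖ ^ k + ‖z.2‖ ^ k) * ∑ i ∈ Finset.range (n + 1), (n.choose i : ℝ) *
          ‖iteratedFDeriv ℝ i ψ z.1‖ * ‖iteratedFDeriv ℝ (n - i) f z.2‖ := by
        gcongr with i hi
        · exact h1 i ψ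
        · exact h2 _ f
    _ = ∑ i ∈ Finset.range (n + 1), (n.choose i : ℝ) *
          ((‖z.1‖ ^ k * ‖iteratedFDeriv ℝ i ψ z.1‖) * ‖iteratedFDeriv ℝ (n - i) f z.2‖ +
          ‖iteratedFDeriv ℝ i ψ z.1‖ * (‖z.2‖ ^ k * ‖iteratedFDeriv ℝ (n - i) f z.2‖)) := by
        rw [Finset.mul_sum]
        exact Finset.sum_congr rfl fun i _ => by ring
    _ ≤ ∑ i ∈ Finset.range (n + 1), (n.choose i : ℝ) *
          (S.sup (schwartzSeminormFamily ℂ E ℂ) ψ * SchwartzMap.seminorm ℂ 0 (n - i) f +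
          S.sup (schwartzSeminormFamily ℂ E ℂ) ψ * SchwartzMap.seminorm ℂ k (n - i) f) := by
        gcongr with i hi
        · exact (ψ.le_seminorm ℂ k i z.1).trans
            (hS k i le_rfl (Nat.lt_succ_iff.mp (Finset.mem_range.mp hi)))
        · exact f.norm_iteratedFDeriv_le_seminorm ℂ _ _
        · exact (ψ.norm_iteratedFDeriv_le_seminorm ℂ i z.1).trans
            (hS 0 i (Nat.zero_le _) (Nat.lt_succ_iff.mp (Finset.mem_range.mp hi)))
        · exact f.le_seminorm ℂ _ _ _
    _ = _ := by
        rw [Finset.sum_mul]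
        exact Finset.sum_congr rfl fun i _ => by ring

/-- The partial inverse Fourier transform in the second variable,
`(x, ξ) ↦ ∫ exp (2 π i y ξ) Ψ (x, y) dy`. -/
def partialFourierFun (Ψ : 𝓢(E × E, F)) (z : E × E) : F :=
  ∫ y : E, (Real.fourierChar ⟪y, z.2⟫_ℝ : ℂ) • Ψ (z.1, y)

/-- The restriction `y ↦ Ψ (x, y)`. -/
def slice (Ψ : 𝓢(E × E, F)) (x : E) : 𝓢(E, F) :=
  SchwartzMap.compCLM ℝ (g := fun y : E => (x, y))
    (by
      have h : (fun y : E => ((x, y) : E × E)) =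
          fun y => (x, 0) + ContinuousLinearMap.inr ℝ E E y := by ext y <;> simp
      rw [h]
      exact (Function.HasTemperateGrowth.const _).add
        (ContinuousLinearMap.inr ℝ E E).hasTemperateGrowth)
    ⟨1, 1, fun y => by
      have : ‖y‖ ≤ ‖((x, y) : E × E)‖ := norm_snd_le (x, y)
      rw [one_mul, pow_one]; linarith⟩ Ψ

theorem slice_seminorm_le (Ψ : 𝓢(E × E, F)) (x : E) (j a b : ℕ) :
    ‖x‖ ^ j * SchwartzMap.seminorm ℝ a b (slice Ψ x) ≤ SchwartzMap.seminorm ℝ (j + a) b Ψ := by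
  have key : ∀ y : E, ‖iteratedFDeriv ℝ b (slice Ψ x) y‖ ≤ ‖iteratedFDeriv ℝ b Ψ (x, y)‖ := by
    intro y
    have e : (slice Ψ x : E → F) =
        (fun w : E × E => Ψ ((x, 0) + w)) ∘ ContinuousLinearMap.inr ℝ E E := by
      ext y; simp [slice]
    have c : ContDiff ℝ ∞ (fun w : E × E => Ψ ((x, 0) + w)) :=
      (Ψ.smooth ⊤).comp (contDiff_const.add contDiff_id)
    rw [e, (ContinuousLinearMap.inr ℝ E E).iteratedFDeriv_comp_right c y (mod_cast le_top),
      iteratedFDeriv_comp_add_left]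
    refine (ContinuousMultilinearMap.norm_compContinuousLinearMap_le _ _).trans ?_
    have hp : ∏ _i : Fin b, ‖ContinuousLinearMap.inr ℝ E E‖ ≤ 1 :=
      Finset.prod_le_one (fun _ _ => by positivity)
        fun _ _ => ContinuousLinearMap.norm_inr_le_one ℝ E E
    refine (mul_le_of_le_one_right (norm_nonneg _) hp).trans ?_
    simp
  rcases (norm_nonneg x).eq_or_lt with h0 | h0
  · rcases Nat.eq_zero_or_pos j with rfl | hj
    · simp only [pow_zero, one_mul, zero_add]
      refine SchwartzMap.seminorm_le_bound ℝ a b _ (by positivity) fun y => ?_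
      refine le_trans ?_ (Ψ.le_seminorm ℝ a b (x, y))
      gcongr
      · exact norm_snd_le (x, y)
      · exact key y
    · rw [← h0, zero_pow hj.ne', zero_mul]; positivity
  · rw [← le_div_iff₀' (by positivity)]
    refine SchwartzMap.seminorm_le_bound ℝ a b _ (by positivity) fun y => ?_
    rw [le_div_iff₀' (by positivity)]
    refine le_trans ?_ (Ψ.le_seminorm ℝ (j + a) b (x, y))
    rw [pow_add, mul_assoc]
    gcongr
    · exact norm_fst_le (x, y)
    · exact norm_snd_le (x, y)
    · exact key y

theorem partialFourierFun_eq {F : Type} [NormedAddCommGroup F] [NormedSpace ℂ F]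
    (Ψ : 𝓢(E × E, F)) (x ξ : E) :
    partialFourierFun Ψ (x, ξ) = (𝓕⁻ (slice Ψ x)) ξ := by
  rw [SchwartzMap.fourierInv_coe, Real.fourierInv_eq]
  rfl

theorem partialFourierFun_decay (k : ℕ) : ∃ (s : Finset (ℕ × ℕ)) (C : ℝ), 0 ≤ C ∧
    ∀ (Ψ : 𝓢(E × E, F)) (z : E × E),
      ‖z‖ ^ k * ‖partialFourierFun Ψ z‖ ≤ C * s.sup (schwartzSeminormFamily ℝ (E × E) F) Ψ := by
  obtain rfl : ‹NormedSpace ℝ F› = NormedSpace.complexToReal := by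
    ext r x
    change r • x = (r : ℂ) • x
    calc r • x = r • ((1 : ℂ) • x) := by rw [one_smul]
      _ = (r • (1 : ℂ)) • x := (smul_assoc r 1 x).symm
      _ = (r : ℂ) • x := by rw [Complex.real_smul, mul_one]
  let L : 𝓢(E, F) →L[ℝ] 𝓢(E, F) := (FourierTransform.fourierInvCLM ℂ 𝓢(E, F)).restrictScalars ℝ
  have hb : ∀ m : ℕ, ∃ (s : Finset (ℕ × ℕ)) (C : ℝ), 0 ≤ C ∧ ∀ g : 𝓢(E, F),
      SchwartzMap.seminorm ℝ m 0 (𝓕⁻ g) ≤ C * s.sup (schwartzSeminormFamily ℝ E F) g := by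
    intro m
    obtain ⟨s, C, -, h⟩ := Seminorm.bound_of_continuous (schwartz_withSeminorms ℝ E F)
      ((schwartzSeminormFamily ℝ E F (m, 0)).comp L.toLinearMap)
      (((schwartz_withSeminorms ℝ E F).continuous_seminorm (m, 0)).comp L.continuous)
    exact ⟨s, C, C.2, fun g => h g⟩
  have hsup : ∀ (s : Finset (ℕ × ℕ)) (j : ℕ) (Ψ : 𝓢(E × E, F)) (x : E),
      ‖x‖ ^ j * s.sup (schwartzSeminormFamily ℝ E F) (slice Ψ x) ≤
        (s.image fun p => (j + p.1, p.2)).sup (schwartzSeminormFamily ℝ (E × E) F) Ψ := by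
    intro s j Ψ x
    rcases s.eq_empty_or_nonempty with rfl | hs
    · simp
    · obtain ⟨p, hp, hp'⟩ := Seminorm.exists_apply_eq_finset_sup
        (schwartzSeminormFamily ℝ E F) hs (slice Ψ x)
      rw [hp']
      refine (slice_seminorm_le Ψ x j p.1 p.2).trans ?_
      exact (Finset.le_sup (f := schwartzSeminormFamily ℝ (E × E) F)
        (Finset.mem_image_of_mem (fun p : ℕ × ℕ => (j + p.1, p.2)) hp)) Ψ
  obtain ⟨s₁, C₁, hC₁, h₁⟩ := hb k
  obtain ⟨s₂, C₂, hC₂, h₂⟩ := hb 0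
  let t := (s₁.image fun p => (0 + p.1, p.2)) ∪ (s₂.image fun p => (k + p.1, p.2))
  refine ⟨t, C₁ + C₂, by positivity, fun Ψ z => ?_⟩
  obtain ⟨x, ξ⟩ := z
  have hz : ‖((x, ξ) : E × E)‖ ^ k ≤ ‖ξ‖ ^ k + ‖x‖ ^ k := by
    rw [Prod.norm_def]
    rcases max_choice ‖x‖ ‖ξ‖ with h | h <;> simp only [h]
    · exact le_add_of_nonneg_left (by positivity)
    · exact le_add_of_nonneg_right (by positivity)
  have ht₁ : s₁.sup (schwartzSeminormFamily ℝ E F) (slice Ψ x) ≤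
      t.sup (schwartzSeminormFamily ℝ (E × E) F) Ψ := by
    have := hsup s₁ 0 Ψ x
    rw [pow_zero, one_mul] at this
    exact this.trans ((Finset.sup_mono (f := schwartzSeminormFamily ℝ (E × E) F)
      Finset.subset_union_left) Ψ)
  have ht₂ : ‖x‖ ^ k * s₂.sup (schwartzSeminormFamily ℝ E F) (slice Ψ x) ≤
      t.sup (schwartzSeminormFamily ℝ (E × E) F) Ψ :=
    (hsup s₂ k Ψ x).trans ((Finset.sup_mono (f := schwartzSeminormFamily ℝ (E × E) F)
      Finset.subset_union_right) Ψ)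
  rw [partialFourierFun_eq]
  have e₁ : ‖ξ‖ ^ k * ‖(𝓕⁻ (slice Ψ x)) ξ‖ ≤
      C₁ * t.sup (schwartzSeminormFamily ℝ (E × E) F) Ψ :=
    (SchwartzMap.norm_pow_mul_le_seminorm ℝ _ k ξ).trans ((h₁ _).trans (by gcongr))
  have e₂ : ‖x‖ ^ k * ‖(𝓕⁻ (slice Ψ x)) ξ‖ ≤
      C₂ * t.sup (schwartzSeminormFamily ℝ (E × E) F) Ψ := by
    calc ‖x‖ ^ k * ‖(𝓕⁻ (slice Ψ x)) ξ‖
        ≤ ‖x‖ ^ k * (C₂ * s₂.sup (schwartzSeminormFamily ℝ E F) (slice Ψ x)) := by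
          gcongr
          exact (SchwartzMap.norm_le_seminorm ℝ _ ξ).trans (h₂ _)
      _ = C₂ * (‖x‖ ^ k * s₂.sup (schwartzSeminormFamily ℝ E F) (slice Ψ x)) := by ring
      _ ≤ _ := by gcongr
  calc _ ≤ (‖ξ‖ ^ k + ‖x‖ ^ k) * ‖(𝓕⁻ (slice Ψ x)) ξ‖ := by gcongr
    _ ≤ _ := by rw [add_mul, add_mul]; exact add_le_add e₁ e₂

/-- The bilinear form `((x, y), (a, b)) ↦ y · b`. -/
def phaseForm : E × E →L[ℝ] E × E →L[ℝ] ℝ :=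
  ((innerSL ℝ : E →L[ℝ] E →L[ℝ] ℝ).bilinearComp
    (ContinuousLinearMap.snd ℝ E E) (ContinuousLinearMap.snd ℝ E E))

/-- The operator `D` on Schwartz functions for which differentiation under the integral sign reads
`fderiv (partialFourierFun Ψ) = partialFourierFun (D Ψ)`. -/
def partialDeriv : 𝓢(E × E, F) →L[ℝ] 𝓢(E × E, E × E →L[ℝ] F) :=
  (SchwartzMap.postcompCLM (𝕜 := ℝ)
    ((ContinuousLinearMap.compL ℝ (E × E) (E × E) F).flip
      ((ContinuousLinearMap.inl ℝ E E).comp (ContinuousLinearMap.fst ℝ E E)))) ∘L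
    (SchwartzMap.fderivCLM ℝ (E × E) F) +
  (SchwartzMap.smulRightCLM ℝ F (phaseForm (E := E))) ∘L
    (((2 * Real.pi * Complex.I : ℂ) • ContinuousLinearMap.id ℂ (𝓢(E × E, F))).restrictScalars ℝ)

theorem partialDeriv_apply (Ψ : 𝓢(E × E, F)) (x y a b : E) :
    partialDeriv Ψ (x, y) (a, b) =
      fderiv ℝ Ψ (x, y) (a, 0) + ⟪y, b⟫_ℝ • (2 * Real.pi * Complex.I : ℂ) • Ψ (x, y) := by
  simp [partialDeriv, phaseForm]

theorem hasFDerivAt_partialFourierFun (Ψ : 𝓢(E × E, F)) (z : E × E) :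
    HasFDerivAt (partialFourierFun Ψ) (partialFourierFun (partialDeriv Ψ) z) z := by
  let N := Measure.integrablePower (volume : Measure E)
  have hdecay : ∀ {G : Type} [NormedAddCommGroup G] [NormedSpace ℂ G]
      [NormedSpace ℝ G] [IsScalarTower ℝ ℂ G] (Θ : 𝓢(E × E, G)),
      ∃ C : ℝ, ∀ x y : E, ‖Θ (x, y)‖ ≤ C * (1 + ‖y‖) ^ (-(N : ℝ)) := by
    intro G _ _ _ _ Θ
    refine ⟨2 ^ N * (Finset.Iic (N, 0)).sup (schwartzSeminormFamily ℝ (E × E) G) Θ,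
      fun x y => ?_⟩
    have h := SchwartzMap.one_add_le_sup_seminorm_apply (𝕜 := ℝ) (m := (N, 0)) (k := N) (n := 0)
      le_rfl le_rfl Θ (x, y)
    rw [norm_iteratedFDeriv_zero] at h
    rw [Real.rpow_neg (by positivity), Real.rpow_natCast, ← div_eq_mul_inv,
      le_div_iff₀ (by positivity), mul_comm]
    refine le_trans ?_ h
    gcongr
    exact norm_snd_le (x, y)
  have hint : ∀ {G : Type} [NormedAddCommGroup G] [NormedSpace ℂ G]
      [NormedSpace ℝ G] [IsScalarTower ℝ ℂ G] (Θ : 𝓢(E × E, G)) (w : E × E),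
      AEStronglyMeasurable (fun y : E => (Real.fourierChar ⟪y, w.2⟫_ℝ : ℂ) • Θ (w.1, y)) volume := by
    intro G _ _ _ _ Θ w
    apply Continuous.aestronglyMeasurable
    have : Continuous fun y : E => Θ (w.1, y) := Θ.continuous.comp (by fun_prop)
    have h2 : Continuous fun y : E => (Real.fourierChar ⟪y, w.2⟫_ℝ : ℂ) :=
      continuous_subtype_val.comp (Real.continuous_fourierChar.comp (by fun_prop))
    exact h2.smul this
  obtain ⟨C, hC⟩ := hdecay Ψ
  obtain ⟨C', hC'⟩ := hdecay (partialDeriv Ψ)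
  have hI : Integrable (fun y : E => (1 + ‖y‖) ^ (-(N : ℝ))) volume :=
    Measure.integrable_pow_neg_integrablePower volume
  refine hasFDerivAt_integral_of_dominated_of_fderiv_le
    (F := fun (w : E × E) (y : E) => (Real.fourierChar ⟪y, w.2⟫_ℝ : ℂ) • Ψ (w.1, y))
    (F' := fun (w : E × E) (y : E) => (Real.fourierChar ⟪y, w.2⟫_ℝ : ℂ) • partialDeriv Ψ (w.1, y))
    (bound := fun y => C' * (1 + ‖y‖) ^ (-(N : ℝ)))
    Filter.univ_mem (Filter.Eventually.of_forall fun w => hint Ψ w) ?_ (hint (partialDeriv Ψ) z)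
    ?_ (hI.const_mul _) ?_
  · exact (hI.const_mul C).mono' (hint Ψ z)
      (Filter.Eventually.of_forall fun y => by rw [norm_smul, Circle.norm_coe, one_mul]; exact hC _ _)
  · exact Filter.Eventually.of_forall fun y w _ => by rw [norm_smul, Circle.norm_coe, one_mul]; exact hC' _ _
  · refine Filter.Eventually.of_forall fun y w _ => ?_
    have h1 : HasFDerivAt (fun w : E × E => (⟪y, w.2⟫_ℝ : ℝ))
        ((innerSL ℝ y).comp (ContinuousLinearMap.snd ℝ E E)) w :=
      ((innerSL ℝ y).comp (ContinuousLinearMap.snd ℝ E E)).hasFDerivAt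
    have h2 : HasFDerivAt (fun w : E × E => (Real.fourierChar ⟪y, w.2⟫_ℝ : ℂ)) _ w :=
      HasFDerivAt.comp (g := fun t : ℝ => (Real.fourierChar t : ℂ))
        (f := fun w : E × E => (⟪y, w.2⟫_ℝ : ℝ)) w
        (Real.hasDerivAt_fourierChar ⟪y, w.2⟫_ℝ).hasFDerivAt h1
    have h3 : HasFDerivAt (fun w : E × E => Ψ (w.1, y))
        ((fderiv ℝ Ψ (w.1, y)).comp
          ((ContinuousLinearMap.inl ℝ E E).comp (ContinuousLinearMap.fst ℝ E E))) w := by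
      have h4 : HasFDerivAt (fun w : E × E => (w.1, y))
          ((ContinuousLinearMap.inl ℝ E E).comp (ContinuousLinearMap.fst ℝ E E)) w := by
        have e : (fun w : E × E => (w.1, y)) = fun w => ((ContinuousLinearMap.inl ℝ E E).comp
            (ContinuousLinearMap.fst ℝ E E)) w + ((0, y) : E × E) := by
          ext w <;> simp
        rw [e]
        exact (ContinuousLinearMap.hasFDerivAt _).add_const _
      exact (Ψ.hasFDerivAt (w.1, y)).comp w h4
    have h5 : HasFDerivAt
        (fun w : E × E => (Real.fourierChar ⟪y, w.2⟫_ℝ : ℂ) • Ψ (w.1, y)) _ w := h2.smul h3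
    refine h5.congr_fderiv (ContinuousLinearMap.ext fun v => ?_)
    obtain ⟨a, b⟩ := v
    rw [_root_.smul_apply, partialDeriv_apply]
    simp only [smul_add]
    have gen : ∀ (c : ℂ) (r : ℝ) (u : F), (r • (2 * Real.pi * Complex.I * c)) • u =
        c • r • (2 * Real.pi * Complex.I : ℂ) • u := by
      intro c r u
      rw [smul_assoc, smul_comm c r, smul_smul c, mul_comm c]
    simpa using gen _ _ _

theorem contDiff_partialFourierFun (n : ℕ) : ∀ {F : Type} [NormedAddCommGroup F]
    [NormedSpace ℂ F] [NormedSpace ℝ F] [IsScalarTower ℝ ℂ F] (Ψ : 𝓢(E × E, F)),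
    ContDiff ℝ n (partialFourierFun Ψ) := by
  induction n with
  | zero =>
    intro F _ _ _ _ Ψ
    exact contDiff_zero.2 (continuous_iff_continuousAt.2 fun z =>
      (hasFDerivAt_partialFourierFun Ψ z).continuousAt)
  | succ n ih =>
    intro F _ _ _ _ Ψ
    refine contDiff_succ_iff_hasFDerivAt.2
      ⟨partialFourierFun (partialDeriv Ψ), ih _, hasFDerivAt_partialFourierFun Ψ⟩

theorem partialFourierFun_bound (k n : ℕ) : ∀ {F : Type} [NormedAddCommGroup F]
    [NormedSpace ℂ F] [NormedSpace ℝ F] [IsScalarTower ℝ ℂ F],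
    ∃ (s : Finset (ℕ × ℕ)) (C : ℝ), 0 ≤ C ∧ ∀ (Ψ : 𝓢(E × E, F)) (z : E × E),
      ‖z‖ ^ k * ‖iteratedFDeriv ℝ n (partialFourierFun Ψ) z‖ ≤
        C * s.sup (schwartzSeminormFamily ℝ (E × E) F) Ψ := by
  induction n with
  | zero =>
    intro F _ _ _ _
    obtain ⟨s, C, hC, h⟩ := partialFourierFun_decay (E := E) (F := F) k
    exact ⟨s, C, hC, fun Ψ z => by rw [norm_iteratedFDeriv_zero]; exact h Ψ z⟩
  | succ n ih =>
    intro F _ _ _ _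
    obtain ⟨s, C, hC, h⟩ := ih (F := E × E →L[ℝ] F)
    obtain ⟨t, C', -, h'⟩ := Seminorm.bound_of_continuous (schwartz_withSeminorms ℝ (E × E) F)
      ((s.sup (schwartzSeminormFamily ℝ (E × E) (E × E →L[ℝ] F))).comp
        (partialDeriv (E := E) (F := F)).toLinearMap)
      ((Seminorm.continuous_finsetSup fun i _ =>
        (schwartz_withSeminorms ℝ (E × E) (E × E →L[ℝ] F)).continuous_seminorm i).comp
          (partialDeriv (E := E) (F := F)).continuous)
    refine ⟨t, C * C', by positivity, fun Ψ z => ?_⟩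
    have e : fderiv ℝ (partialFourierFun Ψ) = partialFourierFun (partialDeriv Ψ) :=
      funext fun w => (hasFDerivAt_partialFourierFun Ψ w).fderiv
    rw [← norm_iteratedFDeriv_fderiv, e, mul_assoc]
    exact (h _ z).trans (mul_le_mul_of_nonneg_left (h' Ψ) hC)

/-- The partial inverse Fourier transform as a continuous operator on Schwartz functions. -/
def partialFourierInv : 𝓢(E × E, ℂ) →L[ℂ] 𝓢(E × E, ℂ) :=
  SchwartzMap.mkCLM partialFourierFun
    (fun Φ Ψ z => by
      obtain ⟨x, ξ⟩ := z
      have : slice (Φ + Ψ) x = slice Φ x + slice Ψ x := by ext y; rfl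
      rw [partialFourierFun_eq, partialFourierFun_eq, partialFourierFun_eq, this,
        FourierTransform.fourierInv_add]
      rfl)
    (fun a Ψ z => by
      simp only [partialFourierFun, smul_apply, RingHom.id_apply]
      rw [← integral_smul]
      congr 1; ext y
      exact smul_comm _ _ _)
    (fun Ψ => contDiff_infty.2 fun n => contDiff_partialFourierFun n Ψ)
    (fun p => by
      obtain ⟨s, C, hC, h⟩ := partialFourierFun_bound (E := E) p.1 p.2 (F := ℂ)
      refine ⟨s, C, hC, fun Ψ z => (h Ψ z).trans (mul_le_mul_of_nonneg_left (le_of_eq ?_) hC)⟩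
      simp only [Seminorm.finset_sup_apply]
      rfl)

end PartialFourier
section TimeFrequency

variable {V : Type} [NormedAddCommGroup V] [InnerProductSpace ℝ V] [FiniteDimensional ℝ V]
  [MeasurableSpace V] [BorelSpace V]

theorem hasTemperateGrowth_character (ξ : V) :
    (fun t : V => (Real.fourierChar ⟪t, ξ⟫_ℝ : ℂ)).HasTemperateGrowth := by
  have h : (fun t : ℝ => (Real.fourierChar t : ℂ)).HasTemperateGrowth := by
    have hd : ∀ n : ℕ, iteratedDeriv n (fun t : ℝ => (Real.fourierChar t : ℂ)) =
        fun t => (2 * Real.pi * Complex.I) ^ n * (Real.fourierChar t : ℂ) := by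
      intro n
      induction n with
      | zero => simp
      | succ n ih =>
        rw [iteratedDeriv_succ, ih]
        ext t
        rw [deriv_const_mul _ (Real.hasDerivAt_fourierChar t).differentiableAt,
          (Real.hasDerivAt_fourierChar t).deriv]
        ring
    refine ⟨?_, fun n => ⟨0, (2 * Real.pi) ^ n, fun t => ?_⟩⟩
    · have : (fun t : ℝ => (Real.fourierChar t : ℂ)) =
          fun t : ℝ => Complex.exp (↑(2 * Real.pi * t) * Complex.I) := by
        ext t; exact Real.fourierChar_apply t
      rw [this]
      have h0 : ContDiff ℝ ∞ (fun t : ℝ => ((2 * Real.pi * t : ℝ) : ℂ)) :=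
        Complex.ofRealCLM.contDiff.comp (contDiff_const.mul contDiff_id)
      exact (h0.mul contDiff_const).cexp
    · rw [norm_iteratedFDeriv_eq_norm_iteratedDeriv, hd, norm_mul, Circle.norm_coe, norm_pow]
      simp [abs_of_pos Real.pi_pos]
  exact h.comp (Function.hasTemperateGrowth_inner_left ξ)

/-- The complex conjugate of a Schwartz function. -/
def conjS (g : 𝓢(V, ℂ)) : 𝓢(V, ℂ) :=
  SchwartzMap.postcompCLM (𝕜 := ℝ) (Complex.conjCLE : ℂ →L[ℝ] ℂ) g

theorem conjS_apply (g : 𝓢(V, ℂ)) (t : V) : conjS g t = starRingEnd ℂ (g t) := rfl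

/-- The time-frequency shift `π(x, ξ) g (t) = exp (2 π i ξ t) g (t - x)`. -/
def tfShift (x ξ : V) (g : 𝓢(V, ℂ)) : 𝓢(V, ℂ) :=
  SchwartzMap.smulLeftCLM ℂ (fun t : V => (Real.fourierChar ⟪t, ξ⟫_ℝ : ℂ))
    (SchwartzMap.compSubConstCLM ℂ x g)

theorem tfShift_apply (x ξ : V) (g : 𝓢(V, ℂ)) (t : V) :
    tfShift x ξ g t = Complex.exp (2 * Real.pi * Complex.I * ⟪t, ξ⟫_ℝ) * g (t - x) := by
  rw [tfShift, SchwartzMap.smulLeftCLM_apply_apply (hasTemperateGrowth_character ξ),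
    SchwartzMap.compSubConstCLM_apply, smul_eq_mul, Real.fourierChar_apply]
  congr 2
  push_cast
  ring

/-- The duality bracket `⟨u, g⟩` between tempered distributions and Schwartz functions which is
conjugate-linear in `g` and extends the inner product `∫ u(t) conj (g(t)) dt`. -/
def bracket (u : 𝓢'(V, ℂ)) (g : 𝓢(V, ℂ)) : ℂ := u (conjS g)

/-- The short-time Fourier transform `V_g u (x, ξ) = ⟨u, π(x, ξ) g⟩`. -/
def stft (g : 𝓢(V, ℂ)) (u : 𝓢'(V, ℂ)) (x ξ : V) : ℂ := bracket u (tfShift x ξ g)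

/-- The norm of the Wiener amalgam space `W(ℱL^p_u, L^q_w)` computed with the window `g`:
the `L^q(w)`-norm in `x` of the `L^p(u)`-norm in `ξ` of `V_g f (x, ξ)`.
A tempered distribution belongs to the space iff this is finite. -/
def amalgamNorm (p q : ℝ≥0∞) (u w : V → ℝ) (g : 𝓢(V, ℂ)) (f : 𝓢'(V, ℂ)) : ℝ≥0∞ :=
  eLpNorm (fun x : V =>
    ENNReal.ofReal (w x) * eLpNorm (fun ξ : V => (u ξ : ℂ) * stft g f x ξ) p volume) q volume

/-- The short-time Fourier transform of `g` with respect to the Gaussian `exp (-π |t|²)`. -/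
def gaussStft (g : 𝓢(V, ℂ)) (x ξ : V) : ℂ :=
  ∫ t : V, g t * Complex.exp (-Real.pi * ‖t - x‖ ^ 2) *
    Complex.exp (-2 * Real.pi * Complex.I * ⟪t, ξ⟫_ℝ)

/-- Windows for a Wiener amalgam space `W(ℱL^p_u, L^q_w)` whose weight `u ⊗ w` is moderate with
respect to `ν` (first argument of `ν`: frequency, second argument: time): nonzero Schwartz functions
in the modulation space `M^1` with weight `(x, ξ) ↦ ν ξ x`. -/
def IsWindow (ν : V → V → ℝ) (g : 𝓢(V, ℂ)) : Prop :=
  g ≠ 0 ∧ Integrable (fun z : V × V => ‖gaussStft g z.1 z.2‖ * ν z.2 z.1) volume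

/-- Boundedness, between the spaces of tempered distributions of finite `N₁`- and `N₂`-norm, of an
operator `A` that is initially defined on Schwartz functions. It means that `A` has an extension `T`
to the whole source space which is linear, norm bounded, and sequentially continuous for the
topology of `𝓢'` on norm-bounded sets. (The last clause makes the extension canonical when Schwartz
functions are not norm dense. The values of `T` outside of the source space are irrelevant.) -/
def BoundedBetween (A : 𝓢(V, ℂ) → 𝓢'(V, ℂ)) (N₁ N₂ : 𝓢'(V, ℂ) → ℝ≥0∞) : Prop :=
  ∃ T : 𝓢'(V, ℂ) → 𝓢'(V, ℂ),
    (∀ f : 𝓢(V, ℂ), N₁ (f : 𝓢'(V, ℂ)) < ⊤ → T (f : 𝓢'(V, ℂ)) = A f) ∧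
    (∀ (c : ℂ) (f₁ f₂ : 𝓢'(V, ℂ)), N₁ f₁ < ⊤ → N₁ f₂ < ⊤ → T (c • f₁ + f₂) = c • T f₁ + T f₂) ∧
    (∃ C : ℝ≥0, ∀ f : 𝓢'(V, ℂ), N₁ f < ⊤ → N₂ (T f) ≤ C * N₁ f) ∧
    (∀ (R : ℝ≥0) (f : ℕ → 𝓢'(V, ℂ)) (f₀ : 𝓢'(V, ℂ)), (∀ n, N₁ (f n) ≤ R) → N₁ f₀ < ⊤ →
      Tendsto f atTop (𝓝 f₀) → Tendsto (fun n => T (f n)) atTop (𝓝 (T f₀)))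

end TimeFrequency

section PhaseSpace

/-- `ℝ^d` -/
abbrev Euc (d : ℕ) : Type := EuclideanSpace ℝ (Fin d)

/-- `ℝ^{2d}`, with points `z = (z₁, z₂)`. -/
abbrev Phase (d : ℕ) : Type := WithLp 2 (Euc d × Euc d)

variable {d : ℕ}

/-- The inverse of the symplectic matrix `J`: `J⁻¹ (z₁, z₂) = (-z₂, z₁)`. -/
def Jinv (z : Phase d) : Phase d := WithLp.toLp 2 (-z.snd, z.fst)

/-- `𝓑_τ (z₁, z₂) = (z₁ / (1 - τ), z₂ / τ)`. -/
def Bmat (τ : ℝ) (z : Phase d) : Phase d :=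
  WithLp.toLp 2 ((1 / (1 - τ)) • z.fst, (1 / τ) • z.snd)

/-- `(𝓤_{1-τ}⁻¹)₁ x = -(τ / (1 - τ)) x`. -/
def dil₁ (τ : ℝ) (x : Euc d) : Euc d := -((τ / (1 - τ)) • x)

/-- `(𝓤_{1-τ}⁻¹)₂ x = -((1 - τ) / τ) x`. -/
def dil₂ (τ : ℝ) (x : Euc d) : Euc d := -(((1 - τ) / τ) • x)

/-- Admissible weight functions on `ℝ^{2d}`. -/
structure IsAdmissibleWeight (v : Phase d → ℝ) : Prop where
  nonneg : ∀ z, 0 ≤ v z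
  continuous : Continuous v
  map_zero' : v 0 = 1
  even : ∀ z z' : Phase d, (∀ i, |z'.fst i| = |z.fst i|) → (∀ i, |z'.snd i| = |z.snd i|) → v z' = v z
  submultiplicative : ∀ w z, v (w + z) ≤ v w * v z
  grs : ∀ z, Tendsto (fun n : ℕ => v (n • z) ^ (1 / (n : ℝ))) atTop (𝓝 1)

/-- `v`-moderate weights. -/
def IsModerate (v m : Phase d → ℝ) : Prop :=
  (∀ z, 0 < m z) ∧ ∃ C : ℝ, 0 ≤ C ∧ ∀ z₁ z₂, m (z₁ + z₂) ≤ C * v z₁ * m z₂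

/-- `m ≥ 1`, or `m ≥ c ⟨·⟩^{-N}` for some `c > 0` and `N ∈ ℕ`, where `⟨z⟩ = (1 + |z|²)^{1/2}`. -/
def IsTemperedWeight (m : Phase d → ℝ) : Prop :=
  (∀ z, 1 ≤ m z) ∨
    ∃ (N : ℕ) (c : ℝ), 0 < c ∧ ∀ z, c * (Real.sqrt (1 + ‖z‖ ^ 2) ^ N)⁻¹ ≤ m z

/-- `(m₁ ⊗ m₂) (x, ξ) = m₁ x * m₂ ξ`. -/
def tensorWeight (m₁ m₂ : Euc d → ℝ) (z : Phase d) : ℝ := m₁ z.fst * m₂ z.snd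

/-- The linear change of variables `(x, y) ↦ (x + τ y, x - (1 - τ) y)`. -/
def shear (τ : ℝ) : (Euc d × Euc d) ≃L[ℝ] (Euc d × Euc d) :=
  ContinuousLinearEquiv.equivOfInverse
    (((ContinuousLinearMap.fst ℝ (Euc d) (Euc d)) + τ • ContinuousLinearMap.snd ℝ _ _).prod
      ((ContinuousLinearMap.fst ℝ (Euc d) (Euc d)) - (1 - τ) • ContinuousLinearMap.snd ℝ _ _))
    ((((1 - τ) • ContinuousLinearMap.fst ℝ (Euc d) (Euc d)) + τ • ContinuousLinearMap.snd ℝ _ _).prod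
      ((ContinuousLinearMap.fst ℝ (Euc d) (Euc d)) - ContinuousLinearMap.snd ℝ _ _))
    (fun z => by
      obtain ⟨x, y⟩ := z
      ext i <;> simp
      ring)
    (fun z => by
      obtain ⟨x, y⟩ := z
      ext i
      · simp; ring
      · simp; ring)

/-- The continuous linear map `ψ ↦ conj (W_τ (conj ψ, f))` on Schwartz functions. -/
def wignerDual (τ : ℝ) (f : 𝓢(Euc d, ℂ)) : 𝓢(Euc d, ℂ) →L[ℂ] 𝓢(Phase d, ℂ) :=
  (SchwartzMap.compCLMOfContinuousLinearEquiv ℂ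
      (WithLp.prodContinuousLinearEquiv 2 ℝ (Euc d) (Euc d))) ∘L
    partialFourierInv ∘L
    (SchwartzMap.compCLMOfContinuousLinearEquiv ℂ (shear τ)) ∘L tensorRight f

/-- The cross-`τ`-Wigner distribution `W_τ (f, g)` of Schwartz functions, as a Schwartz function;
see `tauWigner_apply` for the integral formula. -/
def tauWigner (τ : ℝ) (f g : 𝓢(Euc d, ℂ)) : 𝓢(Phase d, ℂ) :=
  conjS (wignerDual τ g (conjS f))

theorem tauWigner_apply (τ : ℝ) (f g : 𝓢(Euc d, ℂ)) (z : Phase d) :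
    tauWigner τ f g z = ∫ y : Euc d, Complex.exp (-2 * Real.pi * Complex.I * ⟪y, z.snd⟫_ℝ) *
      f (z.fst + τ • y) * starRingEnd ℂ (g (z.fst - (1 - τ) • y)) := by
  change starRingEnd ℂ (∫ y : Euc d, (Real.fourierChar ⟪y, z.snd⟫_ℝ : ℂ) •
    (starRingEnd ℂ (f (z.fst + τ • y)) * g (z.fst - (1 - τ) • y))) = _
  rw [← integral_conj]
  congr 1
  ext y
  simp only [smul_eq_mul, map_mul, Complex.conj_conj, Real.fourierChar_apply, ← Complex.exp_conj,
    Complex.conj_ofReal, Complex.conj_I, mul_assoc]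
  congr 2
  push_cast
  ring

/-- The `τ`-pseudodifferential operator with symbol `σ`, as an operator `𝓢 → 𝓢'`; by definition
`⟨Op_τ(σ) f, g⟩ = ⟨σ, W_τ (g, f)⟩`, see `bracket_Op`. -/
def Op (τ : ℝ) (σ : 𝓢'(Phase d, ℂ)) (f : 𝓢(Euc d, ℂ)) : 𝓢'(Euc d, ℂ) :=
  PointwiseConvergenceCLM.precomp ℂ (wignerDual τ f) σ

theorem bracket_Op (τ : ℝ) (σ : 𝓢'(Phase d, ℂ)) (f g : 𝓢(Euc d, ℂ)) :
    bracket (Op τ σ f) g = bracket σ (tauWigner τ g f) := by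
  change σ (wignerDual τ f (conjS g)) = σ (conjS (conjS (wignerDual τ f (conjS g))))
  congr 1
  ext z
  simp [conjS_apply]

end PhaseSpace

end TauPseudo

end

noncomputable section

set_option linter.unusedSectionVars false

namespace TauPseudo

/-! ### Mixed Lebesgue norms and Minkowski's inequality -/

section MixedNorms

variable {α β : Type*} [MeasurableSpace α] [MeasurableSpace β]

/-! The operator is studied through its matrix with respect to time-frequency shifted Gaussians,
$M(w,z)=\langle \mathrm{Op}_\tau(\sigma)\pi(z)\varphi,\pi(w)\psi\rangle$ with $w,z\in\mathbb
R^{2d}$. By the definition of $\mathrm{Op}_\tau$ and the covariance of the $\tau$-Wigner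
distribution (`tauWigner_tfShift`, `Op_tfShift`), $M(w,z)$ is, up to a phase, the value of
$V_\Phi\sigma$, $\Phi=W_\tau(\psi,\varphi)$, at the point with time component $((1-\tau)w_1+\tau
z_1,\ \tau w_2+(1-\tau)z_2)$. This component equals $S(z-Dw)$ with $S(s)=(\tau s_1,(1-\tau)s_2)$ and
$D(w)=(-\frac{1-\tau}{\tau}w_1,-\frac{\tau}{1-\tau}w_2)$. Hence $|M(w,z)|\le k(z-Dw)$, where $k(s)$
is the supremum over all frequencies of $|V_\Phi\sigma(S s,\cdot)|$.

The widths of $\varphi$ and $\psi$ are chosen so that $\Phi$ is a multiple of an isotropic Gaussian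
(`tauWigner_gaussS`). Since $\mathcal B_\tau J^{-1}S(s)=(-s_2,s_1)$, the hypothesis on $\sigma$
says, after a change of window and of variables, that $\int k(s)\,v(s_2,s_1)\,ds<\infty$.

Expanding $f$ in shifts of $\varphi$ gives $|V_\psi(\mathrm{Op}_\tau(\sigma)f)(w)|\lesssim\int
k(s)\,|V_\varphi f(Dw+s)|\,ds$, a convolution followed by the dilation $D$. As $D$ is a scalar on
times and a scalar on frequencies, it respects mixed norms up to a Jacobian and only changes the
weights, which produces the dilated weights of the target space. The estimate itself is a weighted
Young inequality for mixed norms (`mixedNorm_young`, `weightedNorm_young`), which rests on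
Minkowski's integral inequality.

For distributions $f$ in the source space the same integral defines the extension: apply $M$ to
$V_\varphi f$ and synthesize with a Gaussian $\gamma$ (`extendOp`). It converges because the source
space embeds in a weighted $M^\infty$, that is $|V_\varphi f|\le B/m$
(`exists_weight_mul_stft_le_amalgamNorm`); the result grows polynomially because $1/m$ does, so it
pairs with Schwartz functions. Dominated convergence gives sequential weak continuity on bounded
sets, and the reconstruction formula (`extendOp_coe`) shows that the extension agrees with
$\mathrm{Op}_\tau(\sigma)$ on Schwartz functions. `boundedBetween_of_kernel` collects these facts
for abstract kernels.

The windows enter asymmetrically. The norm for any nonzero window dominates the norm for a Gaussian,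
because a Gaussian kernel beats the at most exponential growth of $v$; the integrability condition
on a window is needed only for the target, where the norm for that window has to be dominated. -/

theorem measurable_eLpNorm_of_uncurry {ν : Measure β} [SFinite ν] {F : α → β → ℝ≥0∞}
    (hF : Measurable (Function.uncurry F)) (p : ℝ≥0∞) :
    Measurable fun x => eLpNorm (F x) p ν := by
  rcases eq_or_ne p 0 with rfl | h0
  · simp
  rcases eq_or_ne p ⊤ with rfl | ht
  · simp only [eLpNorm_exponent_top]
    refine measurable_of_Ioi fun c => ?_
    -- The essential supremum exceeds $c$ exactly when the section of $\{F>c\}$ has positive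
    -- measure, and measures of sections are measurable in $x$.
    have : (fun x => eLpNormEssSup (F x) ν) ⁻¹' Set.Ioi c =
        {x | ν (Prod.mk x ⁻¹' {z : α × β | c < Function.uncurry F z}) ≠ 0} := by
      ext x
      simp only [Set.mem_preimage, Set.mem_Ioi, Set.mem_ofPred_eq]
      rw [← not_iff_not, not_lt, not_not]
      have e : ν (Prod.mk x ⁻¹' {z : α × β | c < Function.uncurry F z}) = 0 ↔
          ∀ᵐ y ∂ν, F x y ≤ c := by
        rw [ae_iff]; simp [Set.preimage, Function.uncurry]
      rw [e]
      constructor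
      · intro h
        filter_upwards [enorm_ae_le_eLpNormEssSup (F x) ν] with y hy
        exact (by simpa using hy : F x y ≤ _).trans h
      · intro h
        exact eLpNormEssSup_le_of_ae_enorm_bound (by simpa using h)
    rw [this]
    exact (measurable_measure_prodMk_left (measurableSet_lt measurable_const hF))
      (measurableSet_singleton 0).compl
  · simp only [eLpNorm_eq_lintegral_rpow_enorm_toReal h0 ht, enorm_eq_self]
    exact (Measurable.lintegral_prod_right (hF.pow_const _)).pow_const _

/-- Minkowski's integral inequality. -/
theorem eLpNorm_lintegral_le {μ : Measure α} {ν : Measure β} [SigmaFinite μ] [SFinite ν]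
    {F : α → β → ℝ≥0∞} (hF : Measurable (Function.uncurry F)) {p : ℝ≥0∞} (hp : 1 ≤ p) :
    eLpNorm (fun x => ∫⁻ y, F x y ∂ν) p μ ≤ ∫⁻ y, eLpNorm (fun x => F x y) p μ ∂ν := by
  have hswap : Measurable (Function.uncurry fun y x => F x y) := hF.comp measurable_swap
  rcases eq_or_ne p ⊤ with rfl | ht
  · rw [eLpNorm_exponent_top]
    have hm := measurable_eLpNorm_of_uncurry (ν := μ) hswap ⊤
    -- The bound holds for a.e. $x$ at each $y$; what is needed is a.e. $y$ for a.e. $x$. Passing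
    -- through the product measure exchanges the quantifiers.
    have h1 : ∀ᵐ z ∂(ν.prod μ), F z.2 z.1 ≤ eLpNorm (fun x => F x z.1) ⊤ μ := by
      refine (Measure.ae_prod_iff_ae_ae
        (measurableSet_le hswap (hm.comp measurable_fst))).2 ?_
      refine Eventually.of_forall fun y => ?_
      simpa using! enorm_ae_le_eLpNormEssSup (fun x => F x y) μ
    have h2 : ∀ᵐ x ∂μ, ∀ᵐ y ∂ν, F x y ≤ eLpNorm (fun x => F x y) ⊤ μ :=
      Measure.ae_ae_of_ae_prod (Measure.measurePreserving_swap.quasiMeasurePreserving.ae h1)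
    refine eLpNormEssSup_le_of_ae_enorm_bound ?_
    filter_upwards [h2] with x hx
    exact lintegral_mono_ae hx
  have h0 : p ≠ 0 := (zero_lt_one.trans_le hp).ne'
  rcases eq_or_ne p 1 with rfl | h1
  · simp only [eLpNorm_one_eq_lintegral_enorm, enorm_eq_self]
    exact (lintegral_lintegral_swap hF.aemeasurable).le
  set q := p.toReal with hq
  have hq1 : 1 < q := by
    rw [hq, ← ENNReal.toReal_one]
    exact (ENNReal.toReal_lt_toReal ENNReal.one_ne_top ht).2 (lt_of_le_of_ne hp h1.symm)
  have hq0 : 0 < q := zero_lt_one.trans hq1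
  have hconj : q.HolderConjugate q.conjExponent := Real.HolderConjugate.conjExponent hq1
  set S : α → ℝ≥0∞ := fun x => ∫⁻ y, F x y ∂ν with hS
  have hSm : Measurable S := hF.lintegral_prod_right
  set A := ∫⁻ y, eLpNorm (fun x => F x y) p μ ∂ν with hA
  -- Truncation in height and in support makes $\int T_n^q$ finite, so that the duality argument may
  -- divide by one of its powers.
  let T : ℕ → α → ℝ≥0∞ := fun n => (spanningSets μ n).indicator fun x => min (S x) n
  have hTm : ∀ n, Measurable (T n) := fun n =>
    (hSm.min measurable_const).indicator (measurableSet_spanningSets μ n)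
  have hTS : ∀ n x, T n x ≤ S x := fun n x => by
    simp only [T, Set.indicator]; split_ifs <;> simp
  have hTq : ∀ n, ∫⁻ x, T n x ^ q ∂μ ≤ A ^ q := by
    intro n
    set I := ∫⁻ x, T n x ^ q ∂μ with hI
    have hfin : I ≠ ⊤ := by
      have : I ≤ ∫⁻ x in spanningSets μ n, (n : ℝ≥0∞) ^ q ∂μ := by
        rw [← lintegral_indicator (measurableSet_spanningSets μ n)]
        refine lintegral_mono fun x => ?_
        simp only [T, Set.indicator]
        split_ifs
        · gcongr; exact min_le_right _ _
        · simp [hq0]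
      refine (this.trans_lt ?_).ne
      rw [setLIntegral_const]
      exact ENNReal.mul_lt_top
        (ENNReal.rpow_lt_top_of_nonneg hq0.le (ENNReal.natCast_ne_top n)) (measure_spanningSets_lt_top μ n)
    -- Duality: write $T_n^q=T_n\cdot T_n^{q-1}\le S\,T_n^{q-1}$, exchange the integrals, and apply
    -- Hölder for each $y$, using $(q-1)q'=q$.
    have hle : I ≤ A * I ^ (1 / q.conjExponent) := by
      calc I = ∫⁻ x, T n x * T n x ^ (q - 1) ∂μ := by
            refine lintegral_congr fun x => ?_
            conv_rhs => rw [← ENNReal.rpow_one (T n x), ← ENNReal.rpow_mul, one_mul]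
            rw [← ENNReal.rpow_add_of_nonneg _ _ zero_le_one (by linarith)]
            congr 1; ring
        _ ≤ ∫⁻ x, S x * T n x ^ (q - 1) ∂μ :=
            lintegral_mono fun x => mul_le_mul_left (hTS n x) _
        _ = ∫⁻ x, ∫⁻ y, F x y * T n x ^ (q - 1) ∂ν ∂μ := by
            refine lintegral_congr fun x => ?_
            rw [lintegral_mul_const _ hF.of_uncurry_left]
        _ = ∫⁻ y, ∫⁻ x, F x y * T n x ^ (q - 1) ∂μ ∂ν :=
            lintegral_lintegral_swap
              (hF.mul (((hTm n).pow_const _).comp measurable_fst)).aemeasurable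
        _ ≤ ∫⁻ y, eLpNorm (fun x => F x y) p μ * I ^ (1 / q.conjExponent) ∂ν := by
            refine lintegral_mono fun y => ?_
            have := ENNReal.lintegral_mul_le_Lp_mul_Lq μ hconj
              (hF.of_uncurry_right (y := y)).aemeasurable ((hTm n).pow_const (q - 1)).aemeasurable
            refine this.trans (le_of_eq ?_)
            rw [eLpNorm_eq_lintegral_rpow_enorm_toReal h0 ht]
            simp only [enorm_eq_self, ← ENNReal.rpow_mul, hconj.sub_one_mul_conj]
            rfl
        _ = A * I ^ (1 / q.conjExponent) := by
            rw [lintegral_mul_const _ (measurable_eLpNorm_of_uncurry hswap p)]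
    rcases eq_or_ne I 0 with h | h
    · rw [h]; simp
    have hsplit : I = I ^ (1 / q) * I ^ (1 / q.conjExponent) := by
      rw [← ENNReal.rpow_add _ _ h hfin, one_div, one_div, hconj.inv_add_inv_eq_one,
        ENNReal.rpow_one]
    have hpos : I ^ (1 / q.conjExponent) ≠ 0 := by
      simp [ENNReal.rpow_eq_zero_iff, h, hconj.symm.pos.le]
    have hne : I ^ (1 / q.conjExponent) ≠ ⊤ := by
      refine ENNReal.rpow_ne_top_of_nonneg (one_div_nonneg.2 hconj.symm.pos.le) hfin
    have : I ^ (1 / q) ≤ A := by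
      rw [hsplit] at hle
      rw [← hsplit] at hle
      refine (ENNReal.mul_le_mul_iff_left hpos hne).1 ?_
      rwa [← hsplit]
    calc I = (I ^ (1 / q)) ^ q := by
          rw [← ENNReal.rpow_mul, one_div, inv_mul_cancel₀ hq0.ne', ENNReal.rpow_one]
      _ ≤ A ^ q := by gcongr
  have hlim : ∫⁻ x, S x ^ q ∂μ ≤ A ^ q := by
    have hsup : ∀ x, S x ^ q ≤ ⨆ n, T n x ^ q := by
      intro x
      have hx : ∀ᶠ n in atTop, T n x = min (S x) n := by
        filter_upwards [eventually_ge_atTop (spanningSetsIndex μ x)] with n hn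
        simp only [T]
        rw [Set.indicator_of_mem (mem_spanningSets_of_index_le μ x hn)]
      have ht : Tendsto (fun n : ℕ => T n x ^ q) atTop (𝓝 (S x ^ q)) := by
        have : Tendsto (fun n : ℕ => min (S x) (n : ℝ≥0∞)) atTop (𝓝 (min (S x) ⊤)) :=
          tendsto_const_nhds.min ENNReal.tendsto_nat_nhds_top
        rw [min_top_right] at this
        exact ((ENNReal.continuous_rpow_const).tendsto _).comp
          (this.congr' (hx.mono fun n h => h.symm))
      exact le_of_tendsto' ht fun n => le_iSup (fun n => T n x ^ q) n
    refine (lintegral_mono hsup).trans ?_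
    rw [lintegral_iSup (fun n => (hTm n).pow_const q)]
    · exact iSup_le hTq
    · intro n m hnm x
      show T n x ^ q ≤ T m x ^ q
      gcongr
      simp only [T]
      refine (Set.indicator_le_indicator_of_subset (monotone_spanningSets μ hnm)
        (fun _ => zero_le) x).trans (Set.indicator_le_indicator ?_)
      gcongr
  rw [eLpNorm_eq_lintegral_rpow_enorm_toReal h0 ht]
  simp only [enorm_eq_self]
  calc (∫⁻ x, S x ^ q ∂μ) ^ (1 / q) ≤ (A ^ q) ^ (1 / q) := by gcongr
    _ = A := by rw [← ENNReal.rpow_mul, one_div, mul_inv_cancel₀ hq0.ne', ENNReal.rpow_one]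

/-- Integration of an `L^p` function against a bounded integrable kernel. -/
theorem lintegral_mul_le_const_mul_eLpNorm {μ : Measure α} {k : α → ℝ≥0∞} (hk : Measurable k)
    {K : ℝ≥0∞} (hK : K ≠ ⊤) (hkK : ∀ x, k x ≤ K) (hki : ∫⁻ x, k x ∂μ ≠ ⊤) {p : ℝ≥0∞}
    (hp : 1 ≤ p) :
    ∃ C : ℝ≥0∞, C ≠ ⊤ ∧ ∀ f : α → ℝ≥0∞, Measurable f → ∫⁻ x, f x * k x ∂μ ≤ C * eLpNorm f p μ := by
  refine ⟨K ^ (1 / p).toReal * (∫⁻ x, k x ∂μ) ^ (1 / (1 : ℝ≥0∞).toReal - 1 / p.toReal), ?_, ?_⟩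
  · refine ENNReal.mul_ne_top (ENNReal.rpow_ne_top_of_nonneg ENNReal.toReal_nonneg hK)
      (ENNReal.rpow_ne_top_of_nonneg ?_ hki)
    rcases eq_or_ne p ⊤ with rfl | ht
    · simp
    · have : 1 ≤ p.toReal := by
        rw [← ENNReal.toReal_one]; exact (ENNReal.toReal_le_toReal ENNReal.one_ne_top ht).2 hp
      rw [ENNReal.toReal_one, one_div_one, sub_nonneg, div_le_one (by linarith)]
      exact this
  · intro f hf
    have h1 := eLpNorm_le_eLpNorm_mul_rpow_measure_univ (μ := μ.withDensity k) hp
      hf.aestronglyMeasurable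
    rw [eLpNorm_one_eq_lintegral_enorm] at h1
    simp only [enorm_eq_self] at h1
    rw [lintegral_withDensity_eq_lintegral_mul _ hk hf] at h1
    have h2 : μ.withDensity k ≤ K • μ := by
      rw [← withDensity_const]
      exact withDensity_mono (Eventually.of_forall hkK)
    have h3 : eLpNorm f p (μ.withDensity k) ≤ K ^ (1 / p).toReal * eLpNorm f p μ :=
      (eLpNorm_mono_measure f h2).trans (eLpNorm_smul_measure_le K f p μ)
    calc ∫⁻ x, f x * k x ∂μ = ∫⁻ x, (k * f) x ∂μ :=
          lintegral_congr fun x => mul_comm _ _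
      _ ≤ _ := h1
      _ ≤ (K ^ (1 / p).toReal * eLpNorm f p μ) * _ := by gcongr
      _ = _ := by
        rw [withDensity_apply _ MeasurableSet.univ, Measure.restrict_univ]
        ring

/-- The mixed norm: `L^p` in the second variable, then `L^q` in the first variable. -/
def mixedNorm (p q : ℝ≥0∞) (μ : Measure α) (ν : Measure β) (F : α → β → ℝ≥0∞) : ℝ≥0∞ :=
  eLpNorm (fun x => eLpNorm (F x) p ν) q μ

theorem mixedNorm_mono {p q : ℝ≥0∞} {μ : Measure α} {ν : Measure β} {F G : α → β → ℝ≥0∞}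
    (h : ∀ x y, F x y ≤ G x y) : mixedNorm p q μ ν F ≤ mixedNorm p q μ ν G :=
  eLpNorm_mono_enorm fun x => by
    simpa using eLpNorm_mono_enorm fun y => by simpa using h x y

theorem eLpNorm_ennreal_const_mul {p : ℝ≥0∞} {μ : Measure α} {f : α → ℝ≥0∞} (hf : Measurable f)
    (c : ℝ≥0∞) : eLpNorm (fun x => c * f x) p μ = c * eLpNorm f p μ := by
  rcases eq_or_ne p 0 with rfl | h0
  · simp
  rcases eq_or_ne p ⊤ with rfl | ht
  · simp only [eLpNorm_exponent_top, eLpNormEssSup, enorm_eq_self]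
    exact ENNReal.essSup_const_mul
  · have hp := ENNReal.toReal_pos h0 ht
    simp only [eLpNorm_eq_lintegral_rpow_enorm_toReal h0 ht, enorm_eq_self]
    simp only [ENNReal.mul_rpow_of_nonneg _ _ hp.le]
    rw [lintegral_const_mul _ (hf.pow_const _), ENNReal.mul_rpow_of_nonneg _ _ (by positivity),
      ← ENNReal.rpow_mul, mul_one_div_cancel hp.ne', ENNReal.rpow_one]

theorem mixedNorm_const_mul {p q : ℝ≥0∞} {μ : Measure α} {ν : Measure β} [SFinite ν]
    {F : α → β → ℝ≥0∞} (hF : Measurable (Function.uncurry F)) (c : ℝ≥0∞) :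
    mixedNorm p q μ ν (fun x y => c * F x y) = c * mixedNorm p q μ ν F := by
  unfold mixedNorm
  simp only [eLpNorm_ennreal_const_mul hF.of_uncurry_left]
  exact eLpNorm_ennreal_const_mul (measurable_eLpNorm_of_uncurry hF p) c

/-- Minkowski's inequality is used twice: for the inner $L^p$ norm at fixed $x$, then for the outer
$L^q$ norm of the inner norms. -/
theorem mixedNorm_lintegral_le {γ : Type*} [MeasurableSpace γ] {p q : ℝ≥0∞} (hp : 1 ≤ p)
    (hq : 1 ≤ q) {μ : Measure α} {ν : Measure β} {ρ : Measure γ} [SigmaFinite μ] [SigmaFinite ν]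
    [SFinite ρ] {F : γ → α → β → ℝ≥0∞}
    (hF : Measurable fun z : γ × α × β => F z.1 z.2.1 z.2.2) :
    mixedNorm p q μ ν (fun x y => ∫⁻ s, F s x y ∂ρ) ≤ ∫⁻ s, mixedNorm p q μ ν (F s) ∂ρ := by
  unfold mixedNorm
  have h1 : ∀ x, eLpNorm (fun y => ∫⁻ s, F s x y ∂ρ) p ν ≤ ∫⁻ s, eLpNorm (F s x) p ν ∂ρ := by
    intro x
    refine eLpNorm_lintegral_le (F := fun y s => F s x y) ?_ hp
    exact hF.comp (measurable_snd.prodMk (measurable_const.prodMk measurable_fst))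
  refine (eLpNorm_mono_enorm (g := fun x => ∫⁻ s, eLpNorm (F s x) p ν ∂ρ)
    fun x => by simpa only [enorm_eq_self] using h1 x).trans ?_
  refine eLpNorm_lintegral_le (F := fun x s => eLpNorm (F s x) p ν) ?_ hq
  exact measurable_eLpNorm_of_uncurry (F := fun (z : α × γ) y => F z.2 z.1 y)
    (hF.comp ((measurable_snd.comp measurable_fst).prodMk
      ((measurable_fst.comp measurable_fst).prodMk measurable_snd))) p

end MixedNorms

/-! ### Dilations, translations and Young's inequality -/

section Dilations

variable {V : Type*} [NormedAddCommGroup V] [NormedSpace ℝ V] [FiniteDimensional ℝ V]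
  [MeasurableSpace V] [BorelSpace V] {μ : Measure V} [μ.IsAddHaarMeasure]

theorem map_affine_measure (a : ℝ) (ha : a ≠ 0) (η : V) :
    μ.map (fun ξ => a • ξ + η) = ENNReal.ofReal |(a ^ Module.finrank ℝ V)⁻¹| • μ := by
  have : (fun ξ : V => a • ξ + η) = (fun x => x + η) ∘ fun ξ => a • ξ := rfl
  rw [this, ← Measure.map_map (by fun_prop) (by fun_prop), Measure.map_addHaar_smul μ ha,
    Measure.map_smul, map_add_right_eq_self]

/-- The affine map sends Haar measure to a multiple of itself that depends on $a$ only. The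
uniformity in the translation $\eta$ is what Young's inequality needs, where $\eta$ becomes the
variable of integration. -/
theorem eLpNorm_comp_affine (a : ℝ) (ha : a ≠ 0) (p : ℝ≥0∞) : ∃ C : ℝ≥0∞, C ≠ ⊤ ∧
    ∀ (f : V → ℝ≥0∞) (η : V), Measurable f →
      eLpNorm (fun ξ => f (a • ξ + η)) p μ ≤ C * eLpNorm f p μ := by
  refine ⟨ENNReal.ofReal |(a ^ Module.finrank ℝ V)⁻¹| ^ (1 / p).toReal,
    ENNReal.rpow_ne_top_of_nonneg ENNReal.toReal_nonneg ENNReal.ofReal_ne_top, fun f η hf => ?_⟩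
  have := eLpNorm_map_measure (p := p) (μ := μ) (f := fun ξ : V => a • ξ + η) (g := f)
    hf.aestronglyMeasurable (by fun_prop)
  rw [map_affine_measure a ha η] at this
  change eLpNorm (f ∘ fun ξ => a • ξ + η) p μ ≤ _
  rw [← this]
  exact eLpNorm_smul_measure_le _ f p μ

theorem mixedNorm_comp_affine (a b : ℝ) (ha : a ≠ 0) (hb : b ≠ 0) (p q : ℝ≥0∞) :
    ∃ C : ℝ≥0∞, C ≠ ⊤ ∧ ∀ (F : V → V → ℝ≥0∞) (y η : V), Measurable (Function.uncurry F) →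
      mixedNorm p q μ μ (fun x ξ => F (a • x + y) (b • ξ + η)) ≤ C * mixedNorm p q μ μ F := by
  obtain ⟨C₁, hC₁, h₁⟩ := eLpNorm_comp_affine (μ := μ) a ha q
  obtain ⟨C₂, hC₂, h₂⟩ := eLpNorm_comp_affine (μ := μ) b hb p
  refine ⟨C₂ * C₁, ENNReal.mul_ne_top hC₂ hC₁, fun F y η hF => ?_⟩
  have hm := measurable_eLpNorm_of_uncurry (ν := μ) hF p
  unfold mixedNorm
  calc eLpNorm (fun x => eLpNorm (fun ξ => F (a • x + y) (b • ξ + η)) p μ) q μ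
      ≤ eLpNorm (fun x => C₂ * eLpNorm (F (a • x + y)) p μ) q μ :=
        eLpNorm_mono_enorm fun x => by simpa using h₂ (F (a • x + y)) η hF.of_uncurry_left
    _ = C₂ * eLpNorm (fun x => eLpNorm (F (a • x + y)) p μ) q μ :=
        eLpNorm_ennreal_const_mul (hm.comp (by fun_prop)) _
    _ ≤ C₂ * (C₁ * eLpNorm (fun x => eLpNorm (F x) p μ) q μ) := by
        gcongr; exact h₁ (fun x => eLpNorm (F x) p μ) y hm
    _ = _ := by rw [mul_assoc]

/-- Young's inequality for mixed norms and kernels that mix the two variables. -/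
theorem mixedNorm_young {a b : ℝ} (ha : a ≠ 0) (hb : b ≠ 0) {p q : ℝ≥0∞} (hp : 1 ≤ p)
    (hq : 1 ≤ q) : ∃ C : ℝ≥0∞, C ≠ ⊤ ∧ ∀ (k : V × V → ℝ≥0∞) (F R : V → V → ℝ≥0∞),
      Measurable k → Measurable (Function.uncurry F) →
      (∀ x ξ, R x ξ ≤ ∫⁻ s, k s * F (a • x + s.1) (b • ξ + s.2) ∂(μ.prod μ)) →
      mixedNorm p q μ μ R ≤ C * (∫⁻ s, k s ∂(μ.prod μ)) * mixedNorm p q μ μ F := by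
  obtain ⟨C, hC, h⟩ := mixedNorm_comp_affine (μ := μ) a b ha hb p q
  refine ⟨C, hC, fun k F R hk hF hR => ?_⟩
  have hFm : ∀ s : V × V, Measurable
      (Function.uncurry fun x ξ => F (a • x + s.1) (b • ξ + s.2)) := fun s =>
    hF.comp (f := fun z : V × V => (a • z.1 + s.1, b • z.2 + s.2)) (by fun_prop)
  calc mixedNorm p q μ μ R
      ≤ mixedNorm p q μ μ
        (fun x ξ => ∫⁻ s, k s * F (a • x + s.1) (b • ξ + s.2) ∂(μ.prod μ)) := mixedNorm_mono hR
    _ ≤ ∫⁻ s, mixedNorm p q μ μ (fun x ξ => k s * F (a • x + s.1) (b • ξ + s.2)) ∂(μ.prod μ) := by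
        refine mixedNorm_lintegral_le hp hq
          (F := fun (s : V × V) x ξ => k s * F (a • x + s.1) (b • ξ + s.2)) ?_
        exact (hk.comp measurable_fst).mul (hF.comp (f := fun z : (V × V) × V × V =>
          (a • z.2.1 + z.1.1, b • z.2.2 + z.1.2)) (by fun_prop))
    _ ≤ ∫⁻ s, k s * (C * mixedNorm p q μ μ F) ∂(μ.prod μ) := by
        refine lintegral_mono fun s => ?_
        rw [mixedNorm_const_mul (hFm s)]
        gcongr
        exact h F s.1 s.2 hF
    _ = _ := by rw [lintegral_mul_const _ hk]; ring

end Dilations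

/-! ### Integrals of Schwartz functions depending on a parameter -/

section ParametricSchwartz

variable {W V : Type} [NormedAddCommGroup W] [NormedSpace ℝ W] [NormedAddCommGroup V]
  [NormedSpace ℝ V]

/-- The tensor product `(z, t) ↦ a z * g t` of two Schwartz functions. -/
def tensorS (a : 𝓢(W, ℂ)) (g : 𝓢(V, ℂ)) : 𝓢(W × V, ℂ) where
  toFun z := a z.1 * g z.2
  smooth' := ((a.smooth ⊤).comp contDiff_fst).mul ((g.smooth ⊤).comp contDiff_snd)
  decay' k n := by
    refine ⟨∑ i ∈ Finset.range (n + 1), (n.choose i : ℝ) *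
      (SchwartzMap.seminorm ℝ k i a * SchwartzMap.seminorm ℝ 0 (n - i) g +
        SchwartzMap.seminorm ℝ 0 i a * SchwartzMap.seminorm ℝ k (n - i) g), fun z => ?_⟩
    have h1 : ∀ i, ‖iteratedFDeriv ℝ i (fun z : W × V => a z.1) z‖ ≤
        ‖iteratedFDeriv ℝ i a z.1‖ := by
      intro i
      have := (ContinuousLinearMap.fst ℝ W V).iteratedFDeriv_comp_right (a.smooth ⊤) z
        (i := i) (mod_cast le_top)
      change ‖iteratedFDeriv ℝ i (a ∘ ContinuousLinearMap.fst ℝ W V) z‖ ≤ _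
      rw [this]
      refine (ContinuousMultilinearMap.norm_compContinuousLinearMap_le _ _).trans ?_
      exact mul_le_of_le_one_right (norm_nonneg _) (Finset.prod_le_one (fun _ _ => norm_nonneg _)
        fun _ _ => ContinuousLinearMap.norm_fst_le _ _ _)
    have h2 : ∀ i, ‖iteratedFDeriv ℝ i (fun z : W × V => g z.2) z‖ ≤
        ‖iteratedFDeriv ℝ i g z.2‖ := by
      intro i
      have := (ContinuousLinearMap.snd ℝ W V).iteratedFDeriv_comp_right (g.smooth ⊤) z
        (i := i) (mod_cast le_top)
      change ‖iteratedFDeriv ℝ i (g ∘ ContinuousLinearMap.snd ℝ W V) z‖ ≤ _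
      rw [this]
      refine (ContinuousMultilinearMap.norm_compContinuousLinearMap_le _ _).trans ?_
      exact mul_le_of_le_one_right (norm_nonneg _) (Finset.prod_le_one (fun _ _ => norm_nonneg _)
        fun _ _ => ContinuousLinearMap.norm_snd_le _ _ _)
    have hz : ‖z‖ ^ k ≤ ‖z.1‖ ^ k + ‖z.2‖ ^ k := by
      rw [Prod.norm_def]
      rcases max_choice ‖z.1‖ ‖z.2‖ with h | h <;> rw [h]
      · exact le_add_of_nonneg_right (by positivity)
      · exact le_add_of_nonneg_left (by positivity)
    have c1 : ContDiff ℝ ∞ (fun z : W × V => a z.1) := (a.smooth ⊤).comp contDiff_fst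
    have c2 : ContDiff ℝ ∞ (fun z : W × V => g z.2) := (g.smooth ⊤).comp contDiff_snd
    have hmul := norm_iteratedFDeriv_mul_le c1 c2 z (n := n) (mod_cast le_top)
    calc ‖z‖ ^ k * ‖iteratedFDeriv ℝ n (fun z : W × V => a z.1 * g z.2) z‖
        ≤ (‖z.1‖ ^ k + ‖z.2‖ ^ k) * ∑ i ∈ Finset.range (n + 1), (n.choose i : ℝ) *
            ‖iteratedFDeriv ℝ i (fun z : W × V => a z.1) z‖ *
            ‖iteratedFDeriv ℝ (n - i) (fun z : W × V => g z.2) z‖ := by gcongr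
      _ ≤ (‖z.1‖ ^ k + ‖z.2‖ ^ k) * ∑ i ∈ Finset.range (n + 1), (n.choose i : ℝ) *
            ‖iteratedFDeriv ℝ i a z.1‖ * ‖iteratedFDeriv ℝ (n - i) g z.2‖ := by
          gcongr with i hi
          · exact h1 i
          · exact h2 _
      _ = ∑ i ∈ Finset.range (n + 1), (n.choose i : ℝ) *
            ((‖z.1‖ ^ k * ‖iteratedFDeriv ℝ i a z.1‖) * ‖iteratedFDeriv ℝ (n - i) g z.2‖ +
            ‖iteratedFDeriv ℝ i a z.1‖ * (‖z.2‖ ^ k * ‖iteratedFDeriv ℝ (n - i) g z.2‖)) := by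
          rw [Finset.mul_sum]
          exact Finset.sum_congr rfl fun i _ => by ring
      _ ≤ _ := by
          gcongr with i hi
          · exact a.le_seminorm ℝ _ _ _
          · exact g.norm_iteratedFDeriv_le_seminorm ℝ _ _
          · exact a.norm_iteratedFDeriv_le_seminorm ℝ _ _
          · exact g.le_seminorm ℝ _ _ _

variable {F : Type} [NormedAddCommGroup F] [NormedSpace ℝ F]

/-- The restriction `t ↦ Θ (z, t)`. -/
def sliceAt (Θ : 𝓢(W × V, F)) (z : W) : 𝓢(V, F) :=
  SchwartzMap.compCLM ℝ (g := fun t : V => (z, t))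
    (by
      have h : (fun t : V => ((z, t) : W × V)) =
          fun t => (z, 0) + ContinuousLinearMap.inr ℝ W V t := by ext t <;> simp
      rw [h]
      exact (Function.HasTemperateGrowth.const _).add
        (ContinuousLinearMap.inr ℝ W V).hasTemperateGrowth)
    ⟨1, 1, fun t => by
      have : ‖t‖ ≤ ‖((z, t) : W × V)‖ := norm_snd_le (z, t)
      rw [one_mul, pow_one]; linarith⟩ Θ

theorem sliceAt_apply (Θ : 𝓢(W × V, F)) (z : W) (t : V) : sliceAt Θ z t = Θ (z, t) := rfl

theorem iteratedFDeriv_sliceAt (Θ : 𝓢(W × V, F)) (z : W) (n : ℕ) (t : V) :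
    iteratedFDeriv ℝ n (sliceAt Θ z) t = (iteratedFDeriv ℝ n Θ (z, t)).compContinuousLinearMap
      fun _ => ContinuousLinearMap.inr ℝ W V := by
  have e : (sliceAt Θ z : V → F) =
      (fun w : W × V => Θ ((z, 0) + w)) ∘ ContinuousLinearMap.inr ℝ W V := by
    ext y; simp [sliceAt_apply]
  have c : ContDiff ℝ ∞ (fun w : W × V => Θ ((z, 0) + w)) :=
    (Θ.smooth ⊤).comp (contDiff_const.add contDiff_id)
  rw [e, (ContinuousLinearMap.inr ℝ W V).iteratedFDeriv_comp_right c t (mod_cast le_top),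
    iteratedFDeriv_comp_add_left]
  simp

theorem norm_compContinuousLinearMap_inr_le {n : ℕ}
    (A : ContinuousMultilinearMap ℝ (fun _ : Fin n => W × V) F) :
    ‖A.compContinuousLinearMap fun _ => ContinuousLinearMap.inr ℝ W V‖ ≤ ‖A‖ := by
  refine (ContinuousMultilinearMap.norm_compContinuousLinearMap_le _ _).trans ?_
  exact mul_le_of_le_one_right (norm_nonneg _) (Finset.prod_le_one (fun _ _ => by positivity)
    fun _ _ => ContinuousLinearMap.norm_inr_le_one ℝ W V)

theorem sliceAt_seminorm_le (Θ : 𝓢(W × V, F)) (z : W) (j a b : ℕ) :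
    ‖z‖ ^ j * SchwartzMap.seminorm ℝ a b (sliceAt Θ z) ≤ SchwartzMap.seminorm ℝ (j + a) b Θ := by
  have key : ∀ y : V, ‖iteratedFDeriv ℝ b (sliceAt Θ z) y‖ ≤ ‖iteratedFDeriv ℝ b Θ (z, y)‖ := by
    intro y
    rw [iteratedFDeriv_sliceAt]
    exact norm_compContinuousLinearMap_inr_le _
  have main : ∀ y : V, ‖z‖ ^ j * (‖y‖ ^ a * ‖iteratedFDeriv ℝ b (sliceAt Θ z) y‖) ≤
      SchwartzMap.seminorm ℝ (j + a) b Θ := by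
    intro y
    refine le_trans ?_ (Θ.le_seminorm ℝ (j + a) b (z, y))
    rw [pow_add, mul_assoc]
    gcongr
    · exact norm_fst_le (z, y)
    · exact norm_snd_le (z, y)
    · exact key y
  rcases (pow_nonneg (norm_nonneg z) j).eq_or_lt with h0 | h0
  · rw [← h0, zero_mul]; positivity
  · rw [← le_div_iff₀' h0]
    refine SchwartzMap.seminorm_le_bound ℝ a b _ (by positivity) fun y => ?_
    rw [le_div_iff₀' h0]
    exact main y

/-- Decay of $\Theta$ in both variables jointly makes every seminorm of the slice decay rapidly in
$z$. With `N` the integrable power of the measure, the slices become an integrable family. -/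
theorem sliceAt_seminorm_decay (Θ : 𝓢(W × V, F)) (N a b : ℕ) :
    ∃ C : ℝ, 0 ≤ C ∧ ∀ z : W,
      SchwartzMap.seminorm ℝ a b (sliceAt Θ z) ≤ C * (1 + ‖z‖) ^ (-(N : ℝ)) := by
  refine ⟨2 ^ (N - 1) * (SchwartzMap.seminorm ℝ (0 + a) b Θ + SchwartzMap.seminorm ℝ (N + a) b Θ),
    by positivity, fun z => ?_⟩
  have h0 := sliceAt_seminorm_le Θ z 0 a b
  have h1 := sliceAt_seminorm_le Θ z N a b
  rw [pow_zero, one_mul] at h0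
  rw [Real.rpow_neg (by positivity), Real.rpow_natCast, ← div_eq_mul_inv,
    le_div_iff₀ (by positivity)]
  calc SchwartzMap.seminorm ℝ a b (sliceAt Θ z) * (1 + ‖z‖) ^ N
      ≤ SchwartzMap.seminorm ℝ a b (sliceAt Θ z) * (2 ^ (N - 1) * (1 ^ N + ‖z‖ ^ N)) := by
        gcongr
        exact add_pow_le zero_le_one (norm_nonneg z) N
    _ = 2 ^ (N - 1) * (SchwartzMap.seminorm ℝ a b (sliceAt Θ z) +
          ‖z‖ ^ N * SchwartzMap.seminorm ℝ a b (sliceAt Θ z)) := by rw [one_pow]; ring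
    _ ≤ _ := by gcongr

/-- The mean value inequality in $z$, applied to the $b$-th derivative, costs one more derivative of
$\Theta$. It yields continuity of $z\mapsto\Theta(z,\cdot)$ into Schwartz space. -/
theorem sliceAt_sub_seminorm_le (Θ : 𝓢(W × V, F)) (z z' : W) (a b : ℕ) :
    SchwartzMap.seminorm ℝ a b (sliceAt Θ z - sliceAt Θ z') ≤
      SchwartzMap.seminorm ℝ a (b + 1) Θ * ‖z - z'‖ := by
  refine SchwartzMap.seminorm_le_bound ℝ a b _ (by positivity) fun t => ?_
  have e : iteratedFDeriv ℝ b (sliceAt Θ z - sliceAt Θ z') t =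
      (iteratedFDeriv ℝ b Θ (z, t) - iteratedFDeriv ℝ b Θ (z', t)).compContinuousLinearMap
        fun _ => ContinuousLinearMap.inr ℝ W V := by
    have : (⇑(sliceAt Θ z - sliceAt Θ z') : V → F) = ⇑(sliceAt Θ z) - ⇑(sliceAt Θ z') := rfl
    rw [this, iteratedFDeriv_sub_apply ((sliceAt Θ z).smooth b).contDiffAt
      ((sliceAt Θ z').smooth b).contDiffAt, iteratedFDeriv_sliceAt, iteratedFDeriv_sliceAt]
    rfl
  rw [e]
  have hd : Differentiable ℝ (iteratedFDeriv ℝ b Θ) :=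
    (Θ.smooth ⊤).differentiable_iteratedFDeriv (mod_cast WithTop.coe_lt_top _)
  have hder : ∀ w ∈ (Set.univ : Set W), HasFDerivWithinAt
      (fun w : W => iteratedFDeriv ℝ b Θ (w, t))
      ((fderiv ℝ (iteratedFDeriv ℝ b Θ) (w, t)).comp (ContinuousLinearMap.inl ℝ W V))
      Set.univ w := by
    intro w _
    have h1 : HasFDerivAt (fun w : W => iteratedFDeriv ℝ b Θ (w, t))
        ((fderiv ℝ (iteratedFDeriv ℝ b Θ) (w, t)).comp (ContinuousLinearMap.inl ℝ W V)) w :=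
      (hd (w, t)).hasFDerivAt.comp w (hasFDerivAt_prodMk_left w t)
    exact h1.hasFDerivWithinAt
  rcases (pow_nonneg (norm_nonneg t) a).eq_or_lt with h0 | h0
  · rw [← h0, zero_mul]; positivity
  have hbd : ∀ w ∈ (Set.univ : Set W), ‖(fderiv ℝ (iteratedFDeriv ℝ b Θ) (w, t)).comp
      (ContinuousLinearMap.inl ℝ W V)‖ ≤ SchwartzMap.seminorm ℝ a (b + 1) Θ / ‖t‖ ^ a := by
    intro w _
    rw [le_div_iff₀' h0]
    refine le_trans ?_ (Θ.le_seminorm ℝ a (b + 1) (w, t))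
    rw [← norm_fderiv_iteratedFDeriv]
    gcongr
    · exact norm_snd_le (w, t)
    · refine (ContinuousLinearMap.opNorm_comp_le _ _).trans ?_
      exact mul_le_of_le_one_right (norm_nonneg _) (ContinuousLinearMap.norm_inl_le_one ℝ W V)
  have := convex_univ.norm_image_sub_le_of_norm_hasFDerivWithin_le hder hbd
    (Set.mem_univ z') (Set.mem_univ z)
  rw [div_mul_eq_mul_div, le_div_iff₀' h0] at this
  refine le_trans ?_ this
  gcongr
  exact norm_compContinuousLinearMap_inr_le _

theorem continuous_sliceAt (Θ : 𝓢(W × V, F)) : Continuous (sliceAt Θ) := by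
  rw [continuous_iff_continuousAt]
  intro z
  refine ((schwartz_withSeminorms ℝ V F).tendsto_nhds _ _).2 fun i ε hε => ?_
  have h : Tendsto (fun w => SchwartzMap.seminorm ℝ i.1 (i.2 + 1) Θ * ‖w - z‖) (𝓝 z) (𝓝 0) := by
    have : Continuous fun w => SchwartzMap.seminorm ℝ i.1 (i.2 + 1) Θ * ‖w - z‖ := by fun_prop
    simpa using this.tendsto z
  filter_upwards [h.eventually (gt_mem_nhds hε)] with w hw
  exact (sliceAt_sub_seminorm_le Θ w z i.1 i.2).trans_lt hw

/-- The derivative in the second variable. -/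
def fderivSnd (Θ : 𝓢(W × V, F)) : 𝓢(W × V, V →L[ℝ] F) :=
  SchwartzMap.postcompCLM (𝕜 := ℝ)
    ((ContinuousLinearMap.compL ℝ V (W × V) F).flip (ContinuousLinearMap.inr ℝ W V))
    (SchwartzMap.fderivCLM ℝ (W × V) F Θ)

theorem hasFDerivAt_fderivSnd (Θ : 𝓢(W × V, F)) (z : W) (t : V) :
    HasFDerivAt (fun t => Θ (z, t)) (fderivSnd Θ (z, t)) t :=
  (Θ.hasFDerivAt (z, t)).comp t (hasFDerivAt_prodMk_right z t)

variable [MeasurableSpace W] [BorelSpace W] {μ : Measure W} [hμ : μ.HasTemperateGrowth]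

theorem exists_norm_apply_le_integrable (Θ : 𝓢(W × V, F)) :
    ∃ B : W → ℝ, Integrable B μ ∧ ∀ z t, ‖Θ (z, t)‖ ≤ B z := by
  obtain ⟨C, -, h⟩ := sliceAt_seminorm_decay Θ μ.integrablePower 0 0
  exact ⟨_, (Measure.integrable_pow_neg_integrablePower μ).const_mul C,
    fun z t => (SchwartzMap.norm_le_seminorm ℝ (sliceAt Θ z) t).trans (h z)⟩

variable [SecondCountableTopology W]

theorem integrable_apply_left (Θ : 𝓢(W × V, F)) (t : V) : Integrable (fun z => Θ (z, t)) μ := by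
  obtain ⟨B, hB, h⟩ := exists_norm_apply_le_integrable (μ := μ) Θ
  refine hB.mono' ?_ (Eventually.of_forall fun z => h z t)
  exact (Θ.continuous.comp (by fun_prop : Continuous fun z : W => (z, t))).aestronglyMeasurable

theorem hasFDerivAt_integral_left (Θ : 𝓢(W × V, F)) (t : V) :
    HasFDerivAt (fun t => ∫ z, Θ (z, t) ∂μ) (∫ z, fderivSnd Θ (z, t) ∂μ) t := by
  obtain ⟨B, hB, h⟩ := exists_norm_apply_le_integrable (μ := μ) (fderivSnd Θ)
  exact hasFDerivAt_integral_of_dominated_of_fderiv_le (F := fun t z => Θ (z, t))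
    (F' := fun t z => fderivSnd Θ (z, t)) (bound := B) Filter.univ_mem
    (Eventually.of_forall fun x => (integrable_apply_left Θ x).aestronglyMeasurable)
    (integrable_apply_left Θ t) (integrable_apply_left _ t).aestronglyMeasurable
    (Eventually.of_forall fun z x _ => h z x) hB
    (Eventually.of_forall fun z x _ => hasFDerivAt_fderivSnd Θ z x)

/-- Differentiation under the integral sign, iterated. The target space is quantified inside the
induction because the derivative in $t$ is again a Schwartz function, with values in `V →L[ℝ] F`. -/
theorem iteratedFDeriv_integral_left (n : ℕ) : ∀ {F : Type} [NormedAddCommGroup F]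
    [NormedSpace ℝ F] (Θ : 𝓢(W × V, F)) (t : V),
    iteratedFDeriv ℝ n (fun t => ∫ z, Θ (z, t) ∂μ) t =
      ∫ z, iteratedFDeriv ℝ n (fun t => Θ (z, t)) t ∂μ := by
  induction n with
  | zero =>
    intro F _ _ Θ t
    simp only [iteratedFDeriv_zero_eq_comp, Function.comp_apply]
    exact ((continuousMultilinearCurryFin0 ℝ V F).symm.toContinuousLinearEquiv.integral_comp_comm
      _).symm
  | succ n ih =>
    intro F _ _ Θ t
    simp only [iteratedFDeriv_succ_eq_comp_right, Function.comp_apply]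
    have e : ∀ z, fderiv ℝ (fun t => Θ (z, t)) = fun t => fderivSnd Θ (z, t) := fun z =>
      funext fun t => (hasFDerivAt_fderivSnd Θ z t).fderiv
    have e' : fderiv ℝ (fun t => ∫ z, Θ (z, t) ∂μ) = fun t => ∫ z, fderivSnd Θ (z, t) ∂μ :=
      funext fun t => (hasFDerivAt_integral_left Θ t).fderiv
    simp only [e, e', ih]
    exact (ContinuousLinearEquiv.integral_comp_comm (𝕜 := ℝ) (E := V [×n]→L[ℝ] V →L[ℝ] F)
      (F := V [×n.succ]→L[ℝ] F) (μ := μ)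
      (continuousMultilinearCurryRightEquiv' ℝ n V F).symm.toContinuousLinearEquiv
      fun z => iteratedFDeriv ℝ n (fun t => fderivSnd Θ (z, t)) t).symm

/-- The space of `n`-th derivatives of functions `V → ℂ`. -/
def JetSpace (V : Type) [NormedAddCommGroup V] [NormedSpace ℝ V] (n : ℕ) : Type :=
  V [×n]→L[ℝ] ℂ

instance (n : ℕ) : NormedAddCommGroup (JetSpace V n) :=
  inferInstanceAs (NormedAddCommGroup (V [×n]→L[ℝ] ℂ))

instance (n : ℕ) : NormedSpace ℂ (JetSpace V n) :=
  inferInstanceAs (NormedSpace ℂ (V [×n]→L[ℝ] ℂ))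

instance (n : ℕ) : CompleteSpace (JetSpace V n) :=
  inferInstanceAs (CompleteSpace (V [×n]→L[ℝ] ℂ))

/-- The `n`-th derivative with values in `JetSpace V n`. -/
def jet (n : ℕ) (ψ : V → ℂ) (t : V) : JetSpace V n := iteratedFDeriv ℝ n ψ t

theorem norm_jet (n : ℕ) (ψ : V → ℂ) (t : V) : ‖jet n ψ t‖ = ‖iteratedFDeriv ℝ n ψ t‖ := rfl

theorem continuous_jet (n : ℕ) (ψ : 𝓢(V, ℂ)) : Continuous (jet n ψ) :=
  (ψ.smooth ⊤).continuous_iteratedFDeriv (m := n) (mod_cast le_top)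

theorem jet_add (n : ℕ) (φ ψ : 𝓢(V, ℂ)) (t : V) :
    jet n (⇑(φ + ψ)) t = jet n φ t + jet n ψ t :=
  iteratedFDeriv_add_apply (φ.smooth n).contDiffAt (ψ.smooth n).contDiffAt

theorem jet_smul (n : ℕ) (c : ℂ) (ψ : 𝓢(V, ℂ)) (t : V) :
    jet n (⇑(c • ψ)) t = c • jet n ψ t :=
  iteratedFDeriv_const_smul_apply (ψ.smooth n).contDiffAt

theorem jet_integral_left (n : ℕ) (Θ : 𝓢(W × V, ℂ)) (t : V) :
    jet n (fun t => ∫ z, Θ (z, t) ∂μ) t = ∫ z, jet n (fun t => Θ (z, t)) t ∂μ :=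
  iteratedFDeriv_integral_left n Θ t

/-- The weighted jet `ψ ↦ ‖t‖ ^ k • D^n ψ (t)` as a bounded continuous function. -/
def jetCLM (V : Type) [NormedAddCommGroup V] [NormedSpace ℝ V] (i : ℕ × ℕ) :
    𝓢(V, ℂ) →L[ℂ] BoundedContinuousFunction V (JetSpace V i.2) :=
  SchwartzMap.mkCLMtoNormedSpace (𝕜 := ℂ) (σ := RingHom.id ℂ)
    (fun ψ => BoundedContinuousFunction.ofNormedAddCommGroup
      (fun t => ((‖t‖ ^ i.1 : ℝ) : ℂ) • jet i.2 ψ t)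
      ((Complex.continuous_ofReal.comp (by fun_prop)).smul (continuous_jet i.2 ψ))
      (SchwartzMap.seminorm ℂ i.1 i.2 ψ)
      (fun t => by
        rw [norm_smul, Complex.norm_real, norm_pow, norm_norm, norm_jet]
        exact ψ.le_seminorm ℂ i.1 i.2 t))
    (fun φ ψ => by
      ext1 t
      exact (congrArg _ (jet_add i.2 φ ψ t)).trans (smul_add _ _ _))
    (fun c ψ => by
      ext1 t
      exact (congrArg _ (jet_smul i.2 c ψ t)).trans (smul_comm _ _ _))
    ⟨{i}, 1, zero_le_one, fun ψ => by
      simp only [Finset.sup_singleton, one_mul]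
      exact BoundedContinuousFunction.norm_ofNormedAddCommGroup_le _ (apply_nonneg _ _) _⟩

theorem jetCLM_apply (i : ℕ × ℕ) (ψ : 𝓢(V, ℂ)) (t : V) :
    jetCLM V i ψ t = ((‖t‖ ^ i.1 : ℝ) : ℂ) • jet i.2 ψ t := rfl

theorem norm_jetCLM_le (i : ℕ × ℕ) (ψ : 𝓢(V, ℂ)) :
    ‖jetCLM V i ψ‖ ≤ SchwartzMap.seminorm ℝ i.1 i.2 ψ :=
  (BoundedContinuousFunction.norm_le (apply_nonneg _ _)).2 fun t => by
    rw [jetCLM_apply, norm_smul, Complex.norm_real, norm_pow, norm_norm, norm_jet]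
    exact ψ.le_seminorm ℝ i.1 i.2 t

theorem seminorm_le_norm_jetCLM (i : ℕ × ℕ) (ψ : 𝓢(V, ℂ)) :
    SchwartzMap.seminorm ℂ i.1 i.2 ψ ≤ ‖jetCLM V i ψ‖ :=
  SchwartzMap.seminorm_le_bound ℂ _ _ _ (norm_nonneg _) fun t => by
    have := (jetCLM V i ψ).norm_coe_le_norm t
    rwa [jetCLM_apply, norm_smul, Complex.norm_real, norm_pow, norm_norm, norm_jet] at this

/-- A continuous linear functional on Schwartz space factors through finitely many jets. -/
theorem exists_factor_jetCLM (Λ : 𝓢(V, ℂ) →L[ℂ] ℂ) :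
    ∃ (s : Finset (ℕ × ℕ))
      (L : (∀ i : s, BoundedContinuousFunction V (JetSpace V i.1.2)) →L[ℂ] ℂ),
      ∀ ψ, Λ ψ = L fun i => jetCLM V i.1 ψ := by
  obtain ⟨s₀, C, -, h⟩ := Seminorm.bound_of_continuous (schwartz_withSeminorms ℂ V ℂ)
    ((normSeminorm ℂ ℂ).comp Λ.toLinearMap) (continuous_norm.comp Λ.continuous)
  -- The index $(0,0)$ records the function itself; it makes the jet map injective, so $\Lambda$ can
  -- be transported to its range.
  let s := insert ((0, 0) : ℕ × ℕ) s₀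
  let J : 𝓢(V, ℂ) →ₗ[ℂ] (∀ i : s, BoundedContinuousFunction V (JetSpace V i.1.2)) :=
    LinearMap.pi fun i => (jetCLM V i.1).toLinearMap
  have hJ : ∀ ψ, ‖Λ ψ‖ ≤ C * ‖J ψ‖ := by
    intro ψ
    refine (h ψ).trans ?_
    change (C : ℝ) * (s₀.sup (schwartzSeminormFamily ℂ V ℂ)) ψ ≤ _
    gcongr
    refine Seminorm.finset_sup_apply_le (norm_nonneg _) fun i hi => ?_
    exact (seminorm_le_norm_jetCLM i ψ).trans
      (norm_le_pi_norm (J ψ) ⟨i, Finset.mem_insert_of_mem hi⟩)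
  have hinj : Function.Injective J := by
    rw [injective_iff_map_eq_zero]
    intro ψ hψ
    ext t
    have h0 := (SchwartzMap.norm_le_seminorm ℂ ψ t).trans ((seminorm_le_norm_jetCLM (0, 0) ψ).trans
      (norm_le_pi_norm (J ψ) ⟨(0, 0), Finset.mem_insert_self _ _⟩))
    rw [hψ, norm_zero] at h0
    simpa using h0
  let e := LinearEquiv.ofInjective J hinj
  let f₀ : LinearMap.range J →L[ℂ] ℂ :=
    LinearMap.mkContinuous (Λ.toLinearMap ∘ₗ e.symm.toLinearMap) C fun x => by
      obtain ⟨ψ, rfl⟩ := e.surjective x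
      have h1 : ‖(e ψ : LinearMap.range J)‖ = ‖J ψ‖ := rfl
      rw [h1]
      simpa using hJ ψ
  -- Hahn–Banach extends the transported functional from the range to the whole product of Banach
  -- spaces.
  obtain ⟨L, hL, -⟩ := exists_extension_norm_eq (LinearMap.range J) f₀
  refine ⟨s, L, fun ψ => ?_⟩
  have := hL (e ψ)
  have e1 : f₀ (e ψ) = Λ ψ := by simp [f₀]
  rw [e1] at this
  exact this.symm

/-- Continuous functionals commute with integrals of Schwartz families of Schwartz functions. -/
theorem apply_eq_integral_sliceAt (Λ : 𝓢(V, ℂ) →L[ℂ] ℂ) (Θ : 𝓢(W × V, ℂ)) (ψ : 𝓢(V, ℂ))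
    (hψ : ∀ t, ψ t = ∫ z, Θ (z, t) ∂μ) : Λ ψ = ∫ z, Λ (sliceAt Θ z) ∂μ := by
  -- Only finitely many Banach-space valued jets matter for $\Lambda$, and in those spaces Bochner
  -- integrals commute with bounded functionals; no integration in the Fréchet space itself is
  -- required.
  obtain ⟨s, L, hL⟩ := exists_factor_jetCLM Λ
  have hcont : ∀ i : ℕ × ℕ, Continuous fun z => jetCLM V i (sliceAt Θ z) := fun i =>
    (jetCLM V i).continuous.comp (continuous_sliceAt Θ)
  have hint : ∀ i : ℕ × ℕ, Integrable (fun z => jetCLM V i (sliceAt Θ z)) μ := by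
    intro i
    obtain ⟨C, -, h⟩ := sliceAt_seminorm_decay Θ μ.integrablePower i.1 i.2
    exact ((Measure.integrable_pow_neg_integrablePower μ).const_mul C).mono'
      (hcont i).aestronglyMeasurable
      (Eventually.of_forall fun z => (norm_jetCLM_le i _).trans (h z))
  -- Equality of bounded continuous functions is checked by evaluation at each $t$, where it is
  -- differentiation under the integral sign.
  have hjet : ∀ i : ℕ × ℕ, jetCLM V i ψ = ∫ z, jetCLM V i (sliceAt Θ z) ∂μ := by
    intro i
    ext1 t
    have h1 := (BoundedContinuousFunction.evalCLM ℂ t).integral_comp_comm (hint i)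
    simp only [BoundedContinuousFunction.evalCLM_apply] at h1
    rw [← h1]
    simp only [jetCLM_apply]
    rw [integral_smul]
    congr 1
    have : (ψ : V → ℂ) = fun t => ∫ z, Θ (z, t) ∂μ := funext hψ
    rw [this, jet_integral_left]
    rfl
  have hpi : Integrable (fun z (i : s) => jetCLM V i.1 (sliceAt Θ z)) μ :=
    Integrable.of_eval fun i => hint i.1
  have h2 := L.integral_comp_comm hpi
  simp only [← hL] at h2
  rw [h2, hL]
  congr 1
  ext1 i
  rw [eval_integral fun i => hint i.1]
  exact hjet i.1

theorem continuous_apply_sliceAt (Λ : 𝓢(V, ℂ) →L[ℂ] ℂ) (Θ : 𝓢(W × V, ℂ)) :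
    Continuous fun z => Λ (sliceAt Θ z) :=
  Λ.continuous.comp (continuous_sliceAt Θ)

end ParametricSchwartz

/-! ### Gaussians as Schwartz functions -/

section Gaussian

theorem exists_one_add_pow_mul_exp_le (M : ℕ) {c : ℝ} (hc : 0 < c) :
    ∃ C : ℝ, ∀ r : ℝ, 0 ≤ r → (1 + r) ^ M * Real.exp (-(c * r ^ 2)) ≤ C := by
  refine ⟨Real.exp (1 + 1 / (4 * c)) * M.factorial, fun r hr => ?_⟩
  -- Completing the square gives $r-cr^2\le 1/(4c)$; the factor $e^{1+r}$ then absorbs $(1+r)^M$ up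
  -- to $M!$.
  have h1 : -(c * r ^ 2) ≤ (1 + 1 / (4 * c)) - (1 + r) := by
    have : 0 ≤ c * (r - 1 / (2 * c)) ^ 2 := by positivity
    have e : c * (r - 1 / (2 * c)) ^ 2 = c * r ^ 2 - r + 1 / (4 * c) := by field_simp; ring
    linarith
  have h2 := Real.pow_div_factorial_le_exp (x := 1 + r) (by linarith) M
  rw [div_le_iff₀ (by positivity)] at h2
  calc (1 + r) ^ M * Real.exp (-(c * r ^ 2))
      ≤ (Real.exp (1 + r) * M.factorial) * Real.exp ((1 + 1 / (4 * c)) - (1 + r)) := by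
        gcongr
    _ = _ := by rw [Real.exp_sub]; field_simp

variable {V : Type} [NormedAddCommGroup V] [InnerProductSpace ℝ V]

theorem hasTemperateGrowth_fderiv {F : Type} [NormedAddCommGroup F] [NormedSpace ℝ F] {P : V → F}
    (hP : P.HasTemperateGrowth) : (fderiv ℝ P).HasTemperateGrowth := by
  refine ⟨hP.1.fderiv_right (mod_cast le_top), fun n => ?_⟩
  obtain ⟨k, C, h⟩ := hP.2 (n + 1)
  exact ⟨k, C, fun x => by rw [norm_iteratedFDeriv_fderiv]; exact h x⟩

/-- The derivative of $e^{-c|t|^2}P(t)$ is $e^{-c|t|^2}$ times another function of temperate growth.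
Allowing an arbitrary factor $P$, in an arbitrary space, makes the induction on the order of the
derivative close. -/
theorem exists_norm_iteratedFDeriv_exp_smul_le {c : ℝ} (hc : 0 < c) (k n : ℕ) :
    ∀ {F : Type} [NormedAddCommGroup F] [NormedSpace ℝ F] {P : V → F}, P.HasTemperateGrowth →
      ∃ C : ℝ, ∀ t, ‖t‖ ^ k * ‖iteratedFDeriv ℝ n
        (fun t => Real.exp (-(c * ‖t‖ ^ 2)) • P t) t‖ ≤ C := by
  induction n with
  | zero =>
    intro F _ _ P hP
    obtain ⟨m, C, h⟩ := hP.2 0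
    obtain ⟨K, hK⟩ := exists_one_add_pow_mul_exp_le (k + m) hc
    refine ⟨|C| * K, fun t => ?_⟩
    have h0 := h t
    rw [norm_iteratedFDeriv_zero] at h0 ⊢
    rw [norm_smul, Real.norm_eq_abs, Real.abs_exp]
    calc ‖t‖ ^ k * (Real.exp (-(c * ‖t‖ ^ 2)) * ‖P t‖)
        ≤ (1 + ‖t‖) ^ k * (Real.exp (-(c * ‖t‖ ^ 2)) * (|C| * (1 + ‖t‖) ^ m)) := by
          gcongr
          · linarith
          · exact h0.trans (by gcongr; exact le_abs_self C)
      _ = |C| * ((1 + ‖t‖) ^ (k + m) * Real.exp (-(c * ‖t‖ ^ 2))) := by rw [pow_add]; ring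
      _ ≤ _ := by gcongr; exact hK _ (norm_nonneg t)
  | succ n ih =>
    intro F _ _ P hP
    have hd : ∀ t, HasFDerivAt (fun t => Real.exp (-(c * ‖t‖ ^ 2)) • P t)
        (Real.exp (-(c * ‖t‖ ^ 2)) • (fderiv ℝ P t +
          ((-(c * 2)) • innerSL ℝ t).smulRight (P t))) t := by
      intro t
      have h1 : HasFDerivAt (fun t : V => ‖t‖ ^ 2) (2 • innerSL ℝ t) t :=
        (hasStrictFDerivAt_norm_sq t).hasFDerivAt
      have h2 := ((h1.const_mul c).neg).exp
      have h3 : HasFDerivAt P (fderiv ℝ P t) t :=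
        ((hP.1.differentiable (by simp)) t).hasFDerivAt
      refine (h2.smul h3).congr_fderiv (ContinuousLinearMap.ext fun v => ?_)
      simp only [_root_.add_apply, _root_.smul_apply, ContinuousLinearMap.smulRight_apply,
        _root_.neg_apply, innerSL_apply_apply, smul_eq_mul, smul_add, smul_smul, nsmul_eq_mul,
        Nat.cast_ofNat]
      congr 2
      simp only [Pi.neg_apply]
      ring
    have hP' : (fun t => fderiv ℝ P t + ((-(c * 2)) • innerSL ℝ t).smulRight (P t)
        ).HasTemperateGrowth := by
      refine (hasTemperateGrowth_fderiv hP).add ?_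
      have h1 : (fun t : V => (-(c * 2)) • innerSL ℝ t).HasTemperateGrowth :=
        ((-(c * 2)) • (innerSL ℝ : V →L[ℝ] V →L[ℝ] ℝ)).hasTemperateGrowth
      exact (ContinuousLinearMap.smulRightL ℝ V F).bilinear_hasTemperateGrowth h1 hP
    obtain ⟨C, hC⟩ := ih hP'
    refine ⟨C, fun t => ?_⟩
    rw [← norm_iteratedFDeriv_fderiv, show fderiv ℝ (fun t => Real.exp (-(c * ‖t‖ ^ 2)) • P t) = _
      from funext fun t => (hd t).fderiv]
    exact hC t

/-- The Gaussian `t ↦ exp (-π a |t|²)` as a Schwartz function. -/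
def gaussS (V : Type) [NormedAddCommGroup V] [InnerProductSpace ℝ V] (a : ℝ) (ha : 0 < a) :
    𝓢(V, ℂ) where
  toFun t := ((Real.exp (-(Real.pi * a * ‖t‖ ^ 2)) : ℝ) : ℂ)
  smooth' := Complex.ofRealCLM.contDiff.comp
    ((contDiff_const.mul (contDiff_norm_sq ℝ)).neg.exp)
  decay' k n := by
    obtain ⟨C, h⟩ := exists_norm_iteratedFDeriv_exp_smul_le (V := V)
      (mul_pos Real.pi_pos ha) k n (Function.HasTemperateGrowth.const (1 : ℂ))
    exact ⟨C, fun t => by simpa using h t⟩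

theorem gaussS_apply (a : ℝ) (ha : 0 < a) (t : V) :
    gaussS V a ha t = ((Real.exp (-(Real.pi * a * ‖t‖ ^ 2)) : ℝ) : ℂ) := rfl

theorem gaussS_ne_zero (a : ℝ) (ha : 0 < a) (t : V) : gaussS V a ha t ≠ 0 := by
  rw [gaussS_apply]; exact_mod_cast (Real.exp_pos _).ne'

variable [FiniteDimensional ℝ V] [MeasurableSpace V] [BorelSpace V]

theorem conjS_gaussS (a : ℝ) (ha : 0 < a) : conjS (gaussS V a ha) = gaussS V a ha := by
  ext t
  rw [conjS_apply, gaussS_apply, Complex.conj_ofReal]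

theorem integral_gaussS_mul_gaussS_ne_zero (a b : ℝ) (ha : 0 < a) (hb : 0 < b) :
    ∫ t, gaussS V a ha t * starRingEnd ℂ (gaussS V b hb t) ≠ 0 := by
  have e : ∀ t : V, gaussS V a ha t * starRingEnd ℂ (gaussS V b hb t) =
      ((Real.exp (-(Real.pi * (a + b) * ‖t‖ ^ 2)) : ℝ) : ℂ) := by
    intro t
    rw [gaussS_apply, gaussS_apply, Complex.conj_ofReal, ← Complex.ofReal_mul, ← Real.exp_add]
    congr 2; ring
  simp only [e]
  rw [integral_complex_ofReal]
  have hi : Integrable (fun t : V => Real.exp (-(Real.pi * (a + b) * ‖t‖ ^ 2))) := by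
    refine ((gaussS V (a + b) (by positivity)).integrable (μ := volume)).re.congr
      (Eventually.of_forall fun t => ?_)
    simp only [gaussS_apply, RCLike.re_to_complex, Complex.ofReal_re]
  exact_mod_cast (integral_exp_pos hi).ne'

end Gaussian

/-! ### Short-time Fourier transform, reconstruction and change of window -/

section ShortTimeFourier

variable {V : Type} [NormedAddCommGroup V] [InnerProductSpace ℝ V] [FiniteDimensional ℝ V]
  [MeasurableSpace V] [BorelSpace V]

instance isAddHaarMeasure_volume_prod : (volume : Measure (V × V)).IsAddHaarMeasure := by
  rw [Measure.volume_eq_prod]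
  infer_instance

theorem tfShift_apply' (x ξ : V) (g : 𝓢(V, ℂ)) (t : V) :
    tfShift x ξ g t = (Real.fourierChar ⟪t, ξ⟫_ℝ : ℂ) * g (t - x) := by
  rw [tfShift, SchwartzMap.smulLeftCLM_apply_apply (hasTemperateGrowth_character ξ),
    SchwartzMap.compSubConstCLM_apply, smul_eq_mul]

theorem conjS_tfShift (x ξ : V) (g : 𝓢(V, ℂ)) :
    conjS (tfShift x ξ g) = tfShift x (-ξ) (conjS g) := by
  ext t
  rw [conjS_apply, tfShift_apply', tfShift_apply', conjS_apply, map_mul, inner_neg_right,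
    AddChar.map_neg_eq_inv, Circle.coe_inv_eq_conj]

theorem hasTemperateGrowth_phase (s : ℝ) :
    (fun w : (V × V) × V => (Real.fourierChar ⟪w.2, s • w.1.2⟫_ℝ : ℂ)).HasTemperateGrowth := by
  have h1 : (fun t : ℝ => (Real.fourierChar t : ℂ)).HasTemperateGrowth := by
    simpa using hasTemperateGrowth_character (1 : ℝ)
  have h2 : (fun w : (V × V) × V => (⟪w.2, s • w.1.2⟫_ℝ : ℝ)).HasTemperateGrowth := by
    refine (innerSL ℝ : V →L[ℝ] V →L[ℝ] ℝ).bilinear_hasTemperateGrowth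
      (f := fun w : (V × V) × V => w.2) (g := fun w : (V × V) × V => s • w.1.2) ?_ ?_
    · exact (ContinuousLinearMap.snd ℝ (V × V) V).hasTemperateGrowth
    · exact (s • (ContinuousLinearMap.snd ℝ V V).comp
        (ContinuousLinearMap.fst ℝ (V × V) V)).hasTemperateGrowth
  exact h1.comp h2

/-- The change of variables `((x, ξ), t) ↦ ((x, ξ), t - x)`. -/
def translateEquiv (V : Type) [NormedAddCommGroup V] [NormedSpace ℝ V] :
    ((V × V) × V) ≃L[ℝ] ((V × V) × V) :=
  ContinuousLinearEquiv.equivOfInverse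
    ((ContinuousLinearMap.fst ℝ (V × V) V).prod (ContinuousLinearMap.snd ℝ (V × V) V -
      (ContinuousLinearMap.fst ℝ V V).comp (ContinuousLinearMap.fst ℝ (V × V) V)))
    ((ContinuousLinearMap.fst ℝ (V × V) V).prod (ContinuousLinearMap.snd ℝ (V × V) V +
      (ContinuousLinearMap.fst ℝ V V).comp (ContinuousLinearMap.fst ℝ (V × V) V)))
    (fun z => by ext <;> simp) (fun z => by ext <;> simp)

/-- The Schwartz function `((x, ξ), t) ↦ a (x, ξ) * (π (x, s ξ) g) (t)`. -/
def tfFamily (s : ℝ) (a : 𝓢(V × V, ℂ)) (g : 𝓢(V, ℂ)) : 𝓢((V × V) × V, ℂ) :=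
  SchwartzMap.smulLeftCLM ℂ (fun w : (V × V) × V => (Real.fourierChar ⟪w.2, s • w.1.2⟫_ℝ : ℂ))
    (SchwartzMap.compCLMOfContinuousLinearEquiv ℂ (translateEquiv V) (tensorS a g))

theorem tfFamily_apply (s : ℝ) (a : 𝓢(V × V, ℂ)) (g : 𝓢(V, ℂ)) (z : V × V) (t : V) :
    tfFamily s a g (z, t) = a z * tfShift z.1 (s • z.2) g t := by
  rw [tfFamily, SchwartzMap.smulLeftCLM_apply_apply (hasTemperateGrowth_phase s), tfShift_apply',
    smul_eq_mul]
  change _ * (a z * g (t - z.1)) = _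
  ring

theorem sliceAt_tfFamily (s : ℝ) (a : 𝓢(V × V, ℂ)) (g : 𝓢(V, ℂ)) (z : V × V) :
    sliceAt (tfFamily s a g) z = a z • tfShift z.1 (s • z.2) g := by
  ext t
  rw [sliceAt_apply, tfFamily_apply]
  rfl

/-- The shifts $\pi(z)g$ do not decay in $z$, but $a(z)\pi(z)g(t)$ is Schwartz in $(z,t)$ for
Schwartz $a$, and its slices depend continuously on $z$. With $a$ a nowhere vanishing Gaussian one
divides by $a(z)$ at the end. -/
theorem continuous_apply_tfShift (Λ : 𝓢(V, ℂ) →L[ℂ] ℂ) (g : 𝓢(V, ℂ)) :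
    Continuous fun z : V × V => Λ (tfShift z.1 z.2 g) := by
  let φ := gaussS V 1 one_pos
  have h := continuous_apply_sliceAt Λ (tfFamily 1 (tensorS φ φ) g)
  have hne : ∀ z : V × V, tensorS φ φ z ≠ 0 := fun z =>
    mul_ne_zero (gaussS_ne_zero _ _ _) (gaussS_ne_zero _ _ _)
  refine (h.div (tensorS φ φ).continuous hne).congr fun z => ?_
  rw [Pi.div_apply, sliceAt_tfFamily, map_smul, smul_eq_mul, one_smul, mul_div_cancel_left₀ _ (hne z)]

/-- A tempered distribution as a continuous linear functional on Schwartz space. -/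
def toCLM (u : 𝓢'(V, ℂ)) : 𝓢(V, ℂ) →L[ℂ] ℂ := u

theorem stft_eq (g : 𝓢(V, ℂ)) (u : 𝓢'(V, ℂ)) (x ξ : V) :
    stft g u x ξ = u (tfShift x (-ξ) (conjS g)) := by
  rw [stft, bracket, conjS_tfShift]

theorem continuous_stft (g : 𝓢(V, ℂ)) (u : 𝓢'(V, ℂ)) :
    Continuous fun z : V × V => stft g u z.1 z.2 := by
  simp only [stft_eq]
  exact (continuous_apply_tfShift (toCLM u) (conjS g)).comp
    (f := fun z : V × V => (z.1, -z.2)) (by fun_prop)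

/-- The change of variables `(x, y) ↦ (y, y - x)`. -/
def pairEquiv (V : Type) [NormedAddCommGroup V] [NormedSpace ℝ V] : (V × V) ≃L[ℝ] (V × V) :=
  ContinuousLinearEquiv.equivOfInverse
    ((ContinuousLinearMap.snd ℝ V V).prod
      (ContinuousLinearMap.snd ℝ V V - ContinuousLinearMap.fst ℝ V V))
    ((ContinuousLinearMap.fst ℝ V V - ContinuousLinearMap.snd ℝ V V).prod
      (ContinuousLinearMap.fst ℝ V V))
    (fun z => by ext <;> simp) (fun z => by ext <;> simp)

/-- The bilinear pairing `(x, ξ) ↦ ∫ χ (t) (π (x, ξ) γ) (t) dt`. -/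
def tfPair (γ : 𝓢(V, ℂ)) : 𝓢(V, ℂ) →L[ℂ] 𝓢(V × V, ℂ) :=
  partialFourierInv ∘L SchwartzMap.compCLMOfContinuousLinearEquiv ℂ (pairEquiv V) ∘L tensorRight γ

theorem tfPair_eq_fourierInv (γ χ : 𝓢(V, ℂ)) (x ξ : V) :
    tfPair γ χ (x, ξ) = (𝓕⁻ (slice (SchwartzMap.compCLMOfContinuousLinearEquiv ℂ (pairEquiv V)
      (tensorRight γ χ)) x)) ξ :=
  partialFourierFun_eq _ x ξ

theorem tfPair_apply (γ χ : 𝓢(V, ℂ)) (z : V × V) :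
    tfPair γ χ z = ∫ t, χ t * tfShift z.1 z.2 γ t := by
  change ∫ y : V, (Real.fourierChar ⟪y, z.2⟫_ℝ : ℂ) • (χ y * γ (y - z.1)) = _
  refine integral_congr_ae (Eventually.of_forall fun t => ?_)
  simp only [tfShift_apply', smul_eq_mul]
  ring

/-- `tfPair` is bilinear, without conjugation, so that tempered distributions can be paired with it;
the sign of the frequency is the price. -/
theorem stft_coe (g f : 𝓢(V, ℂ)) (x ξ : V) :
    stft g (f : 𝓢'(V, ℂ)) x ξ = tfPair (conjS g) f (x, -ξ) := by
  rw [stft_eq, SchwartzMap.coe_apply, tfPair_apply]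
  exact integral_congr_ae (Eventually.of_forall fun t => mul_comm _ _)

/-- The inversion formula for the short-time Fourier transform. -/
theorem integral_tfPair_mul_tfShift (γ χ g : 𝓢(V, ℂ)) (t : V) :
    ∫ z : V × V, tfPair γ χ z * tfShift z.1 (-z.2) g t = (∫ s, γ s * g s) * χ t := by
  have hint : Integrable (fun z : V × V => tfPair γ χ z * tfShift z.1 (-z.2) g t) := by
    have := integrable_apply_left (μ := volume) (tfFamily (-1) (tfPair γ χ) g) t
    simpa only [tfFamily_apply, neg_one_smul] using this
  rw [Measure.volume_eq_prod] at hint ⊢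
  rw [integral_prod _ hint]
  -- At fixed $x$ the frequency integral is Fourier inversion for $t\mapsto\chi(t)\gamma(t-x)$; the
  -- remaining integral over $x$ is a translation of $\int\gamma g$.
  have inner : ∀ x : V, ∫ ξ, tfPair γ χ (x, ξ) * tfShift x (-ξ) g t =
      (χ t * γ (t - x)) * g (t - x) := by
    intro x
    let h := slice (SchwartzMap.compCLMOfContinuousLinearEquiv ℂ (pairEquiv V)
      (tensorRight γ χ)) x
    have h1 : 𝓕 (𝓕⁻ h) = h := FourierTransform.fourier_fourierInv_eq h
    have h2 : (𝓕 (𝓕⁻ h)) t = χ t * γ (t - x) := by rw [h1]; rfl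
    rw [SchwartzMap.fourier_coe, Real.fourier_eq] at h2
    rw [← h2, ← integral_mul_const]
    refine integral_congr_ae (Eventually.of_forall fun ξ => ?_)
    simp only [tfPair_eq_fourierInv, tfShift_apply', inner_neg_right, Circle.smul_def, smul_eq_mul,
      real_inner_comm t ξ]
    ring
  simp only [inner]
  have : ∀ x, χ t * γ (t - x) * g (t - x) = χ t * (γ (t - x) * g (t - x)) := fun x => mul_assoc _ _ _
  simp only [this]
  rw [integral_const_mul, integral_sub_left_eq_self (fun s => γ s * g s) volume t, mul_comm]

/-- The reconstruction formula for tempered distributions. -/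
theorem integral_tfPair_mul_apply (Λ : 𝓢(V, ℂ) →L[ℂ] ℂ) (γ χ g : 𝓢(V, ℂ)) :
    ∫ z : V × V, tfPair γ χ z * Λ (tfShift z.1 (-z.2) g) = (∫ s, γ s * g s) * Λ χ := by
  have := apply_eq_integral_sliceAt (μ := (volume : Measure (V × V))) Λ
    (tfFamily (-1) (tfPair γ χ) g) ((∫ s, γ s * g s) • χ) (fun t => by
      simp only [tfFamily_apply, neg_one_smul]
      exact (integral_tfPair_mul_tfShift γ χ g t).symm)
  simp only [sliceAt_tfFamily, map_smul, smul_eq_mul, neg_one_smul] at this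
  exact this.symm

theorem integral_tfPair_mul_stft (u : 𝓢'(V, ℂ)) (γ χ g : 𝓢(V, ℂ)) :
    ∫ z : V × V, tfPair γ χ z * stft g u z.1 z.2 = (∫ s, γ s * conjS g s) * u χ := by
  simp only [stft_eq]
  exact integral_tfPair_mul_apply (toCLM u) γ χ (conjS g)

theorem integral_comp_neg_snd (f : V × V → ℂ) :
    ∫ z : V × V, f (z.1, -z.2) = ∫ z, f z := by
  have h : MeasurePreserving ((MeasurableEquiv.refl V).prodCongr (MeasurableEquiv.neg V))
      (volume : Measure (V × V)) volume := by
    rw [Measure.volume_eq_prod]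
    exact (MeasurePreserving.id volume).prod (Measure.measurePreserving_neg volume)
  exact h.integral_comp (MeasurableEquiv.measurableEmbedding _) f

/-- The reconstruction formula for Schwartz functions, tested with a functional. -/
theorem integral_stft_mul_apply (Λ : 𝓢(V, ℂ) →L[ℂ] ℂ) (γ f g : 𝓢(V, ℂ)) :
    ∫ z : V × V, stft g (f : 𝓢'(V, ℂ)) z.1 z.2 * Λ (tfShift z.1 z.2 γ) =
      (∫ s, conjS g s * γ s) * Λ f := by
  rw [← integral_tfPair_mul_apply, ← integral_comp_neg_snd]
  simp only [stft_coe, neg_neg]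

/-- If all these pairings vanished, the inversion formula would give $\|\gamma\|_2^2\,\overline
G=0$, with $\gamma$ the Gaussian. The point $z$ provides a shifted Gaussian not orthogonal to $G$,
hence a synthesis window matching any nonzero analysis window. -/
theorem exists_tfPair_ne_zero (G : 𝓢(V, ℂ)) (hG : G ≠ 0) (a : ℝ) (ha : 0 < a) :
    ∃ z : V × V, tfPair (gaussS V a ha) (conjS G) z ≠ 0 := by
  by_contra! h
  refine hG ?_
  ext t
  have := integral_tfPair_mul_tfShift (gaussS V a ha) (conjS G) (conjS (gaussS V a ha)) t
  simp only [h, zero_mul, integral_zero] at this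
  rcases mul_eq_zero.1 this.symm with h0 | h0
  · exact absurd h0 (integral_gaussS_mul_gaussS_ne_zero a a ha ha)
  · simpa [conjS_apply] using h0

/-- Covariance: shifting the argument by $w$ multiplies by a phase and translates by $w$ in phase
space. This is what turns changes of window into convolutions. -/
theorem norm_tfPair_tfShift (γ h : 𝓢(V, ℂ)) (w z : V × V) :
    ‖tfPair γ (conjS (tfShift w.1 w.2 h)) z‖ = ‖tfPair γ (conjS h) (z - w)‖ := by
  have e : tfPair γ (conjS (tfShift w.1 w.2 h)) z =
      (Real.fourierChar ⟪w.1, z.2 - w.2⟫_ℝ : ℂ) * tfPair γ (conjS h) (z - w) := by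
    rw [tfPair_apply, tfPair_apply, ← integral_add_right_eq_self _ w.1, ← integral_const_mul]
    refine integral_congr_ae (Eventually.of_forall fun t => ?_)
    simp only [conjS_tfShift, tfShift_apply', add_sub_cancel_right, Prod.fst_sub, Prod.snd_sub]
    rw [show t + w.1 - z.1 = t - (z.1 - w.1) by abel]
    have : (Real.fourierChar ⟪t + w.1, -w.2⟫_ℝ : ℂ) * (Real.fourierChar ⟪t + w.1, z.2⟫_ℝ : ℂ) =
        (Real.fourierChar ⟪w.1, z.2 - w.2⟫_ℝ : ℂ) * (Real.fourierChar ⟪t, z.2 - w.2⟫_ℝ : ℂ) := by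
      rw [← Circle.coe_mul, ← Circle.coe_mul, ← AddChar.map_add_eq_mul, ← AddChar.map_add_eq_mul]
      congr 2
      simp only [inner_add_left, inner_sub_right, inner_neg_right]
      ring
    linear_combination (conjS h t * γ (t - (z.1 - w.1))) * this
  rw [e, norm_mul, Circle.norm_coe, one_mul]

theorem norm_tfPair_window_tfShift (γ χ : 𝓢(V, ℂ)) (w z : V × V) :
    ‖tfPair (tfShift w.1 w.2 γ) χ z‖ = ‖tfPair γ χ (z + w)‖ := by
  have e : tfPair (tfShift w.1 w.2 γ) χ z =
      (Real.fourierChar (-⟪z.1, w.2⟫_ℝ) : ℂ) * tfPair γ χ (z + w) := by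
    rw [tfPair_apply, tfPair_apply, ← integral_const_mul]
    refine integral_congr_ae (Eventually.of_forall fun t => ?_)
    simp only [tfShift_apply', Prod.fst_add, Prod.snd_add, sub_sub]
    have : (Real.fourierChar ⟪t, z.2⟫_ℝ : ℂ) * (Real.fourierChar ⟪t - z.1, w.2⟫_ℝ : ℂ) =
        (Real.fourierChar (-⟪z.1, w.2⟫_ℝ) : ℂ) * (Real.fourierChar ⟪t, z.2 + w.2⟫_ℝ : ℂ) := by
      rw [← Circle.coe_mul, ← Circle.coe_mul, ← AddChar.map_add_eq_mul, ← AddChar.map_add_eq_mul]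
      congr 2
      simp only [inner_add_right, inner_sub_left]
      ring
    linear_combination (χ t * γ (t - (z.1 + w.1))) * this
  rw [e, norm_mul, Circle.norm_coe, one_mul]

/-- Change of window: the pointwise estimate. -/
theorem enorm_stft_le_lintegral (u : 𝓢'(V, ℂ)) (γ g h : 𝓢(V, ℂ)) (x ξ : V) :
    ‖∫ s, γ s * conjS g s‖ₑ * ‖stft h u x ξ‖ₑ ≤
      ∫⁻ s : V × V, ‖tfPair γ (conjS h) s‖ₑ * ‖stft g u (x + s.1) (ξ + s.2)‖ₑ := by
  have h1 := integral_tfPair_mul_stft u γ (conjS (tfShift x ξ h)) g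
  rw [← enorm_mul]
  change ‖_ * u (conjS (tfShift x ξ h))‖ₑ ≤ _
  rw [← h1]
  refine (enorm_integral_le_lintegral_enorm _).trans (le_of_eq ?_)
  rw [← lintegral_add_right_eq_self _ ((x, ξ) : V × V)]
  refine lintegral_congr fun z => ?_
  rw [enorm_mul]
  congr 1
  · rw [← ofReal_norm, ← ofReal_norm, norm_tfPair_tfShift γ h (x, ξ), add_sub_cancel_right]
  · simp [add_comm]

theorem norm_tfPair_gaussS_le (a b : ℝ) (ha : 0 < a) (hb : 0 < b) :
    ∃ C : ℝ, 0 ≤ C ∧ ∀ z : V × V, ‖tfPair (gaussS V a ha) (gaussS V b hb) z‖ ≤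
      C * (Real.exp (-(Real.pi * (a * b / (a + b)) * ‖z.1‖ ^ 2)) *
        Real.exp (-(Real.pi * (1 / (a + b)) * ‖z.2‖ ^ 2))) := by
  have hab : 0 < a + b := by positivity
  refine ⟨‖((Real.pi : ℂ) / ((Real.pi * (a + b) : ℝ) : ℂ)) ^ (Module.finrank ℝ V / 2 : ℂ)‖,
    norm_nonneg _, fun z => ?_⟩
  -- Centre of the square: $b|t|^2+a|t-x|^2=(a+b)|t-cx|^2+\frac{ab}{a+b}|x|^2$. After translation by
  -- $cx$ only the Fourier integral of a centred Gaussian is left.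
  let c := a / (a + b)
  have e : tfPair (gaussS V a ha) (gaussS V b hb) z =
      (Real.exp (-(Real.pi * (a * b / (a + b)) * ‖z.1‖ ^ 2)) : ℂ) *
      (Real.fourierChar ⟪c • z.1, z.2⟫_ℝ : ℂ) *
      ∫ t : V, Complex.exp (-((Real.pi * (a + b) : ℝ) : ℂ) * ‖t‖ ^ 2 +
        (2 * Real.pi * Complex.I) * ⟪z.2, t⟫_ℝ) := by
    rw [tfPair_apply, ← integral_add_right_eq_self _ (c • z.1), ← integral_const_mul]
    refine integral_congr_ae (Eventually.of_forall fun t => ?_)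
    simp only [tfShift_apply', gaussS_apply, Real.fourierChar_apply, Complex.ofReal_exp,
      ← Complex.exp_add]
    congr 1
    have hn : b * ‖t + c • z.1‖ ^ 2 + a * ‖t + c • z.1 - z.1‖ ^ 2 =
        (a + b) * ‖t‖ ^ 2 + a * b / (a + b) * ‖z.1‖ ^ 2 := by
      have e1 : t + c • z.1 - z.1 = t - (1 - c) • z.1 := by rw [sub_smul, one_smul]; abel
      rw [e1, norm_add_sq_real, norm_sub_sq_real, inner_smul_right, inner_smul_right, norm_smul,
        norm_smul, mul_pow, mul_pow, Real.norm_eq_abs, Real.norm_eq_abs, sq_abs, sq_abs]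
      simp only [c]
      field_simp
      ring
    have hn' : (b : ℂ) * ((‖t + c • z.1‖ : ℝ) : ℂ) ^ 2 + a * ((‖t + c • z.1 - z.1‖ : ℝ) : ℂ) ^ 2 =
        (a + b) * ((‖t‖ : ℝ) : ℂ) ^ 2 + a * b / (a + b) * ((‖z.1‖ : ℝ) : ℂ) ^ 2 := by
      exact_mod_cast hn
    have hi : ⟪t + c • z.1, z.2⟫_ℝ = ⟪z.2, t⟫_ℝ + ⟪c • z.1, z.2⟫_ℝ := by
      rw [inner_add_left, real_inner_comm]
    rw [hi]
    push_cast
    linear_combination (-(Real.pi : ℂ)) * hn'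
  rw [e, GaussianFourier.integral_cexp_neg_mul_sq_norm_add (by
    rw [Complex.ofReal_re]; positivity), norm_mul, norm_mul, Circle.norm_coe, mul_one, norm_mul]
  have h1 : Complex.exp ((2 * Real.pi * Complex.I) ^ 2 * ‖z.2‖ ^ 2 /
      (4 * ((Real.pi * (a + b) : ℝ) : ℂ))) =
      ((Real.exp (-(Real.pi * (1 / (a + b)) * ‖z.2‖ ^ 2)) : ℝ) : ℂ) := by
    rw [Complex.ofReal_exp]
    congr 1
    have : ((a : ℂ) + b) ≠ 0 := by exact_mod_cast hab.ne'
    have hp : (Real.pi : ℂ) ≠ 0 := by exact_mod_cast Real.pi_ne_zero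
    push_cast
    field_simp
    rw [Complex.I_sq]
    ring
  rw [h1, Complex.norm_real, Complex.norm_real, Real.norm_eq_abs, Real.norm_eq_abs, Real.abs_exp,
    Real.abs_exp]
  exact le_of_eq (by ring)

/-- The two transforms are complex conjugates. This identifies the $M^1$ condition in `IsWindow`
with weighted integrability of the kernel for synthesis with the Gaussian and analysis with $h$. -/
theorem norm_gaussStft (h : 𝓢(V, ℂ)) (x ξ : V) :
    ‖gaussStft h x ξ‖ = ‖tfPair (gaussS V 1 one_pos) (conjS h) (x, ξ)‖ := by
  have : starRingEnd ℂ (gaussStft h x ξ) = tfPair (gaussS V 1 one_pos) (conjS h) (x, ξ) := by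
    rw [gaussStft, tfPair_apply, ← integral_conj]
    refine integral_congr_ae (Eventually.of_forall fun t => ?_)
    simp only [tfShift_apply, gaussS_apply, conjS_apply, map_mul, ← Complex.exp_conj,
      Complex.ofReal_exp, map_neg, map_pow, map_ofNat, Complex.conj_ofReal, Complex.conj_I]
    rw [mul_assoc]
    congr 1
    rw [mul_comm]
    congr 2
    · ring
    · push_cast; ring
  rw [← this, RCLike.norm_conj]

end ShortTimeFourier

/-! ### Growth of submultiplicative weights -/

section SubmultiplicativeWeights

/-- With $v\le M$ on the unit ball and $n=\lceil\|z\|\rceil$, writing $z$ as $n$ times a vector of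
the ball gives $v(z)\le M^n\le M\,e^{\|z\|\log M}$. -/
theorem exists_le_exp_of_submultiplicative {E : Type*} [NormedAddCommGroup E] [NormedSpace ℝ E]
    [FiniteDimensional ℝ E] {v : E → ℝ} (hv0 : ∀ z, 0 ≤ v z) (hc : Continuous v)
    (h0 : v 0 = 1) (hmul : ∀ w z, v (w + z) ≤ v w * v z) :
    ∃ K A : ℝ, 0 ≤ K ∧ 0 ≤ A ∧ ∀ z, v z ≤ K * Real.exp (A * ‖z‖) := by
  have : ProperSpace E := FiniteDimensional.proper ℝ E
  obtain ⟨M, hM⟩ := (isCompact_closedBall (0 : E) 1).bddAbove_image hc.continuousOn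
  have hM' : ∀ z, ‖z‖ ≤ 1 → v z ≤ M := fun z hz =>
    hM (Set.mem_image_of_mem v (by simpa using hz))
  have hM1 : 1 ≤ M := by rw [← h0]; exact hM' 0 (by simp)
  have hM0 : 0 < M := by linarith
  have hpow : ∀ (n : ℕ) y, v (n • y) ≤ v y ^ n := by
    intro n y
    induction n with
    | zero => simp [h0]
    | succ n ih =>
      rw [succ_nsmul, pow_succ]
      exact (hmul _ _).trans (mul_le_mul_of_nonneg_right ih (hv0 y))
  refine ⟨M, Real.log M, hM0.le, Real.log_nonneg hM1, fun z => ?_⟩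
  set n := ⌈‖z‖⌉₊ with hn
  have hzn : ‖z‖ ≤ n := Nat.le_ceil _
  have hn1 : (n : ℝ) ≤ ‖z‖ + 1 := (Nat.ceil_lt_add_one (norm_nonneg z)).le
  have h1 : v z ≤ M ^ n := by
    rcases Nat.eq_zero_or_pos n with h | h
    · have : z = 0 := by
        rw [h] at hzn
        simpa using hzn
      rw [h, this, h0, pow_zero]
    · have hnr : (0 : ℝ) < n := by exact_mod_cast h
      have e : z = n • ((n : ℝ)⁻¹ • z) := by
        rw [← Nat.cast_smul_eq_nsmul ℝ, smul_smul, mul_inv_cancel₀ hnr.ne', one_smul]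
      rw [e]
      refine (hpow n _).trans (pow_le_pow_left₀ (hv0 _) (hM' _ ?_) n)
      rw [norm_smul, norm_inv, Real.norm_of_nonneg hnr.le, inv_mul_le_iff₀ hnr, mul_one]
      exact hzn
  calc v z ≤ M ^ n := h1
    _ = Real.exp (Real.log M * n) := by rw [mul_comm, Real.exp_nat_mul, Real.exp_log hM0]
    _ ≤ Real.exp (Real.log M * (‖z‖ + 1)) := by
        gcongr
        exact Real.log_nonneg hM1
    _ = _ := by rw [mul_add, mul_one, Real.exp_add, Real.exp_log hM0, mul_comm]

end SubmultiplicativeWeights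

/-! ### Weighted Wiener amalgam norms -/

section WeightedAmalgam

variable {V : Type} [NormedAddCommGroup V] [InnerProductSpace ℝ V] [FiniteDimensional ℝ V]
  [MeasurableSpace V] [BorelSpace V]

/-- The mixed norm of `F` with the product weight `(x, ξ) ↦ w x * u ξ`. -/
def weightedNorm (p q : ℝ≥0∞) (u w : V → ℝ) (F : V → V → ℝ≥0∞) : ℝ≥0∞ :=
  mixedNorm p q volume volume fun x ξ => ENNReal.ofReal (w x * u ξ) * F x ξ

theorem measurable_weight_mul {u w : V → ℝ} (hu : Measurable u) (hw : Measurable w)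
    {F : V → V → ℝ≥0∞} (hF : Measurable (Function.uncurry F)) :
    Measurable (Function.uncurry fun x ξ => ENNReal.ofReal (w x * u ξ) * F x ξ) :=
  (ENNReal.measurable_ofReal.comp
    ((hw.comp measurable_fst).mul (hu.comp measurable_snd))).mul hF

theorem measurable_enorm_stft (g : 𝓢(V, ℂ)) (f : 𝓢'(V, ℂ)) :
    Measurable (Function.uncurry fun x ξ => ‖stft g f x ξ‖ₑ) :=
  (continuous_stft g f).measurable.enorm

theorem amalgamNorm_eq_weightedNorm (p q : ℝ≥0∞) {u w : V → ℝ} (hu : Measurable u)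
    (hu0 : ∀ ξ, 0 ≤ u ξ) (hw0 : ∀ x, 0 ≤ w x) (g : 𝓢(V, ℂ)) (f : 𝓢'(V, ℂ)) :
    amalgamNorm p q u w g f = weightedNorm p q u w fun x ξ => ‖stft g f x ξ‖ₑ := by
  have key : ∀ x, ENNReal.ofReal (w x) * eLpNorm (fun ξ => (u ξ : ℂ) * stft g f x ξ) p volume =
      eLpNorm (fun ξ => ENNReal.ofReal (w x * u ξ) * ‖stft g f x ξ‖ₑ) p volume := by
    intro x
    have hm : Measurable fun ξ => ENNReal.ofReal (u ξ) * ‖stft g f x ξ‖ₑ :=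
      (ENNReal.measurable_ofReal.comp hu).mul (measurable_enorm_stft g f).of_uncurry_left
    have e : (fun ξ => ‖(u ξ : ℂ) * stft g f x ξ‖ₑ) =
        fun ξ => ENNReal.ofReal (u ξ) * ‖stft g f x ξ‖ₑ := by
      ext1 ξ
      rw [enorm_mul, ← ofReal_norm, Complex.norm_real, Real.norm_of_nonneg (hu0 ξ)]
    have e' : (fun ξ => ENNReal.ofReal (w x * u ξ) * ‖stft g f x ξ‖ₑ) =
        fun ξ => ENNReal.ofReal (w x) * (ENNReal.ofReal (u ξ) * ‖stft g f x ξ‖ₑ) := by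
      ext1 ξ
      rw [ENNReal.ofReal_mul (hw0 x), mul_assoc]
    rw [← eLpNorm_enorm fun ξ => (u ξ : ℂ) * stft g f x ξ, e, e', eLpNorm_ennreal_const_mul hm]
  exact congrArg (fun F : V → ℝ≥0∞ => eLpNorm F q volume) (funext key)

/-- Weighted Young inequality for mixed norms. -/
theorem weightedNorm_young {a b : ℝ} (ha : a ≠ 0) (hb : b ≠ 0) {p q : ℝ≥0∞} (hp : 1 ≤ p)
    (hq : 1 ≤ q) {u w u' w' : V → ℝ} (hu : Measurable u) (hw : Measurable w)
    {ν : V × V → ℝ} (hν : Measurable ν) (hν0 : ∀ s, 0 ≤ ν s) {C₀ : ℝ} (hC₀ : 0 ≤ C₀)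
    (hmod : ∀ x ξ s, w' x * u' ξ ≤ C₀ * ν s * (w (a • x + s.1) * u (b • ξ + s.2)))
    {k : V × V → ℝ≥0∞} (hk : Measurable k) (hki : ∫⁻ s, k s * ENNReal.ofReal (ν s) ≠ ⊤) :
    ∃ C : ℝ≥0∞, C ≠ ⊤ ∧ ∀ F R : V → V → ℝ≥0∞, Measurable (Function.uncurry F) →
      (∀ x ξ, R x ξ ≤ ∫⁻ s, k s * F (a • x + s.1) (b • ξ + s.2)) →
      weightedNorm p q u' w' R ≤ C * weightedNorm p q u w F := by
  obtain ⟨C, hC, h⟩ := mixedNorm_young (μ := (volume : Measure V)) ha hb hp hq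
  have hνm : Measurable fun s => ENNReal.ofReal (ν s) := ENNReal.measurable_ofReal.comp hν
  refine ⟨C * (ENNReal.ofReal C₀ * ∫⁻ s, k s * ENNReal.ofReal (ν s)),
    ENNReal.mul_ne_top hC (ENNReal.mul_ne_top ENNReal.ofReal_ne_top hki), fun F R hF hR => ?_⟩
  -- The moderateness constant and $\nu$ are absorbed into the kernel, so that the unweighted
  -- inequality applies to the functions multiplied by their weights.
  have := h (fun s => ENNReal.ofReal C₀ * (k s * ENNReal.ofReal (ν s)))
    (fun x ξ => ENNReal.ofReal (w x * u ξ) * F x ξ)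
    (fun x ξ => ENNReal.ofReal (w' x * u' ξ) * R x ξ)
    ((hk.mul hνm).const_mul _) (measurable_weight_mul hu hw hF) ?_
  · have e : ∫⁻ s, ENNReal.ofReal C₀ * (k s * ENNReal.ofReal (ν s)) =
        ENNReal.ofReal C₀ * ∫⁻ s, k s * ENNReal.ofReal (ν s) := lintegral_const_mul _ (hk.mul hνm)
    rw [← Measure.volume_eq_prod, e] at this
    exact this
  · intro x ξ
    have hFm : Measurable fun s : V × V => F (a • x + s.1) (b • ξ + s.2) :=
      hF.comp (f := fun s : V × V => (a • x + s.1, b • ξ + s.2)) (by fun_prop)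
    calc ENNReal.ofReal (w' x * u' ξ) * R x ξ
        ≤ ENNReal.ofReal (w' x * u' ξ) * ∫⁻ s, k s * F (a • x + s.1) (b • ξ + s.2) := by
          gcongr; exact hR x ξ
      _ = ∫⁻ s, ENNReal.ofReal (w' x * u' ξ) * (k s * F (a • x + s.1) (b • ξ + s.2)) :=
          (lintegral_const_mul _ (hk.mul hFm)).symm
      _ ≤ _ := by
          rw [← Measure.volume_eq_prod]
          refine lintegral_mono fun s => ?_
          calc ENNReal.ofReal (w' x * u' ξ) * (k s * F (a • x + s.1) (b • ξ + s.2))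
              ≤ ENNReal.ofReal (C₀ * ν s * (w (a • x + s.1) * u (b • ξ + s.2))) *
                (k s * F (a • x + s.1) (b • ξ + s.2)) :=
                mul_le_mul_left (ENNReal.ofReal_le_ofReal (hmod x ξ s)) _
            _ = _ := by
                rw [ENNReal.ofReal_mul (mul_nonneg hC₀ (hν0 s)), ENNReal.ofReal_mul hC₀]
                ring

/-- Change of window in Wiener amalgam norms. -/
theorem exists_amalgamNorm_le_of_window {p q : ℝ≥0∞} (hp : 1 ≤ p) (hq : 1 ≤ q) {u w : V → ℝ}
    (hu : Measurable u) (hw : Measurable w) (hu0 : ∀ ξ, 0 ≤ u ξ) (hw0 : ∀ x, 0 ≤ w x)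
    {ν : V × V → ℝ} (hν : Measurable ν) (hν0 : ∀ s, 0 ≤ ν s) {C₀ : ℝ} (hC₀ : 0 ≤ C₀)
    (hmod : ∀ x ξ s, w x * u ξ ≤ C₀ * ν s * (w (x + s.1) * u (ξ + s.2))) (γ g h : 𝓢(V, ℂ))
    (hγ : ∫ s, γ s * conjS g s ≠ 0)
    (hh : ∫⁻ s : V × V, ‖tfPair γ (conjS h) s‖ₑ * ENNReal.ofReal (ν s) ≠ ⊤) :
    ∃ C : ℝ≥0∞, C ≠ ⊤ ∧ ∀ f : 𝓢'(V, ℂ),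
      amalgamNorm p q u w h f ≤ C * amalgamNorm p q u w g f := by
  set c := ‖∫ s, γ s * conjS g s‖ₑ with hc
  have hc0 : c ≠ 0 := by simpa [hc] using hγ
  have hct : c ≠ ⊤ := by simp [hc]
  obtain ⟨C, hC, H⟩ := weightedNorm_young (a := 1) (b := 1) one_ne_zero one_ne_zero hp hq hu hw
    hν hν0 hC₀ (u' := u) (w' := w) (by simpa using hmod)
    (k := fun s => ‖tfPair γ (conjS h) s‖ₑ) (tfPair γ (conjS h)).continuous.measurable.enorm hh
  refine ⟨c⁻¹ * C, ENNReal.mul_ne_top (ENNReal.inv_ne_top.2 hc0) hC, fun f => ?_⟩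
  rw [amalgamNorm_eq_weightedNorm p q hu hu0 hw0, amalgamNorm_eq_weightedNorm p q hu hu0 hw0]
  have h1 := H (fun x ξ => ‖stft g f x ξ‖ₑ) (fun x ξ => c * ‖stft h f x ξ‖ₑ)
    (measurable_enorm_stft g f) (fun x ξ => by
      simpa only [one_smul] using enorm_stft_le_lintegral f γ g h x ξ)
  have h2 : weightedNorm p q u w (fun x ξ => c * ‖stft h f x ξ‖ₑ) =
      c * weightedNorm p q u w fun x ξ => ‖stft h f x ξ‖ₑ := by
    unfold weightedNorm
    rw [← mixedNorm_const_mul (measurable_weight_mul hu hw (measurable_enorm_stft h f))]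
    congr 1
    ext x ξ
    ring
  rw [h2] at h1
  calc weightedNorm p q u w (fun x ξ => ‖stft h f x ξ‖ₑ)
      = c⁻¹ * (c * weightedNorm p q u w fun x ξ => ‖stft h f x ξ‖ₑ) := by
        rw [← mul_assoc, ENNReal.inv_mul_cancel hc0 hct, one_mul]
    _ ≤ c⁻¹ * (C * weightedNorm p q u w fun x ξ => ‖stft g f x ξ‖ₑ) := by gcongr
    _ = _ := by rw [mul_assoc]

/-- Half of the Gaussian exponent absorbs the exponential, by completing the square at $r=A/c$. -/
theorem exp_neg_sq_mul_exp_le {c A r : ℝ} (hc : 0 < c) :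
    Real.exp (-(c * r ^ 2)) * Real.exp (A * r) ≤
      Real.exp (A ^ 2 / (2 * c)) * Real.exp (-(c / 2 * r ^ 2)) := by
  rw [← Real.exp_add, ← Real.exp_add, Real.exp_le_exp]
  have : 0 ≤ c / 2 * (r - A / c) ^ 2 := by positivity
  have e : c / 2 * (r - A / c) ^ 2 = c / 2 * r ^ 2 - A * r + A ^ 2 / (2 * c) := by
    field_simp; ring
  linarith

theorem exists_norm_tfPair_gaussS_mul_exp_le (a b : ℝ) (ha : 0 < a) (hb : 0 < b) (A : ℝ) :
    ∃ C c : ℝ, 0 ≤ C ∧ 0 < c ∧ ∀ z : V × V,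
      ‖tfPair (gaussS V a ha) (gaussS V b hb) z‖ * Real.exp (A * (‖z.1‖ + ‖z.2‖)) ≤
        C * (Real.exp (-(c * ‖z.1‖ ^ 2)) * Real.exp (-(c * ‖z.2‖ ^ 2))) := by
  obtain ⟨C, hC, h⟩ := norm_tfPair_gaussS_le (V := V) a b ha hb
  let c₁ := Real.pi * (a * b / (a + b))
  let c₂ := Real.pi * (1 / (a + b))
  have hc₁ : 0 < c₁ := by positivity [Real.pi_pos]
  have hc₂ : 0 < c₂ := by positivity [Real.pi_pos]
  refine ⟨C * (Real.exp (A ^ 2 / (2 * c₁)) * Real.exp (A ^ 2 / (2 * c₂))), min c₁ c₂ / 2,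
    by positivity, by positivity, fun z => ?_⟩
  calc ‖tfPair (gaussS V a ha) (gaussS V b hb) z‖ * Real.exp (A * (‖z.1‖ + ‖z.2‖))
      ≤ C * (Real.exp (-(c₁ * ‖z.1‖ ^ 2)) * Real.exp (-(c₂ * ‖z.2‖ ^ 2))) *
        (Real.exp (A * ‖z.1‖) * Real.exp (A * ‖z.2‖)) := by
        rw [← Real.exp_add (A * ‖z.1‖), ← mul_add]
        gcongr
        exact h z
    _ = C * ((Real.exp (-(c₁ * ‖z.1‖ ^ 2)) * Real.exp (A * ‖z.1‖)) *
        (Real.exp (-(c₂ * ‖z.2‖ ^ 2)) * Real.exp (A * ‖z.2‖))) := by ring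
    _ ≤ C * ((Real.exp (A ^ 2 / (2 * c₁)) * Real.exp (-(c₁ / 2 * ‖z.1‖ ^ 2))) *
        (Real.exp (A ^ 2 / (2 * c₂)) * Real.exp (-(c₂ / 2 * ‖z.2‖ ^ 2)))) := by
        gcongr C * (?_ * ?_)
        · exact exp_neg_sq_mul_exp_le hc₁
        · exact exp_neg_sq_mul_exp_le hc₂
    _ = C * (Real.exp (A ^ 2 / (2 * c₁)) * Real.exp (A ^ 2 / (2 * c₂))) *
        (Real.exp (-(c₁ / 2 * ‖z.1‖ ^ 2)) * Real.exp (-(c₂ / 2 * ‖z.2‖ ^ 2))) := by ring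
    _ ≤ _ := by
        gcongr
        · exact min_le_left _ _
        · exact min_le_right _ _

theorem integrable_exp_neg_sq {c : ℝ} (hc : 0 < c) :
    Integrable (fun x : V => Real.exp (-(c * ‖x‖ ^ 2))) := by
  refine ((gaussS V (c / Real.pi) (div_pos hc Real.pi_pos)).integrable (μ := volume)).re.congr
    (Eventually.of_forall fun t => ?_)
  simp only [gaussS_apply, RCLike.re_to_complex, Complex.ofReal_re]
  rw [mul_div_cancel₀ _ Real.pi_ne_zero]

/-- The kernel of a change of window between time-frequency shifted Gaussians is integrable against
weights of at most exponential growth. -/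
theorem lintegral_tfPair_gaussS_ne_top (a b : ℝ) (ha : 0 < a) (hb : 0 < b) {ν : V × V → ℝ}
    {K A : ℝ} (hK : 0 ≤ K) (hA : 0 ≤ A) (hν : ∀ s, ν s ≤ K * Real.exp (A * (‖s.1‖ + ‖s.2‖)))
    (w : V × V) :
    ∫⁻ s : V × V, ‖tfPair (tfShift w.1 w.2 (gaussS V a ha)) (conjS (gaussS V b hb)) s‖ₑ *
      ENNReal.ofReal (ν s) ≠ ⊤ := by
  obtain ⟨C, c, hC, hc, h⟩ := exists_norm_tfPair_gaussS_mul_exp_le (V := V) a b ha hb A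
  have hI : Integrable (fun z : V × V => (K * Real.exp (A * (‖w.1‖ + ‖w.2‖)) * C) *
      (Real.exp (-(c * ‖z.1‖ ^ 2)) * Real.exp (-(c * ‖z.2‖ ^ 2)))) := by
    rw [Measure.volume_eq_prod]
    exact ((integrable_exp_neg_sq hc).mul_prod (integrable_exp_neg_sq hc)).const_mul _
  rw [← lintegral_sub_right_eq_self _ w]
  refine ((lintegral_mono fun z => ?_).trans_lt hI.lintegral_lt_top).ne
  rw [← ofReal_norm, ← ENNReal.ofReal_mul (norm_nonneg _), norm_tfPair_window_tfShift,
    sub_add_cancel, conjS_gaussS]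
  refine ENNReal.ofReal_le_ofReal ?_
  have h1 : ν (z - w) ≤ K * Real.exp (A * (‖w.1‖ + ‖w.2‖)) * Real.exp (A * (‖z.1‖ + ‖z.2‖)) := by
    refine (hν _).trans ?_
    rw [mul_assoc, ← Real.exp_add, ← mul_add]
    have e1 := norm_sub_le z.1 w.1
    have e2 := norm_sub_le z.2 w.2
    refine mul_le_mul_of_nonneg_left (Real.exp_le_exp.2 (mul_le_mul_of_nonneg_left ?_ hA)) hK
    rw [Prod.fst_sub, Prod.snd_sub]
    linarith
  calc ‖tfPair (gaussS V a ha) (gaussS V b hb) z‖ * ν (z - w)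
      ≤ ‖tfPair (gaussS V a ha) (gaussS V b hb) z‖ *
        (K * Real.exp (A * (‖w.1‖ + ‖w.2‖)) * Real.exp (A * (‖z.1‖ + ‖z.2‖))) := by gcongr
    _ = K * Real.exp (A * (‖w.1‖ + ‖w.2‖)) * (‖tfPair (gaussS V a ha) (gaussS V b hb) z‖ *
        Real.exp (A * (‖z.1‖ + ‖z.2‖))) := by ring
    _ ≤ K * Real.exp (A * (‖w.1‖ + ‖w.2‖)) * (C *
        (Real.exp (-(c * ‖z.1‖ ^ 2)) * Real.exp (-(c * ‖z.2‖ ^ 2)))) :=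
        mul_le_mul_of_nonneg_left (h z) (by positivity)
    _ = _ := by ring

/-- The norm with respect to an arbitrary window dominates the norm with respect to a Gaussian. -/
theorem exists_amalgamNorm_gaussS_le {p q : ℝ≥0∞} (hp : 1 ≤ p) (hq : 1 ≤ q) {u w : V → ℝ}
    (hu : Measurable u) (hw : Measurable w) (hu0 : ∀ ξ, 0 ≤ u ξ) (hw0 : ∀ x, 0 ≤ w x)
    {ν : V × V → ℝ} (hν : Measurable ν) (hν0 : ∀ s, 0 ≤ ν s) {C₀ : ℝ} (hC₀ : 0 ≤ C₀)
    (hmod : ∀ x ξ s, w x * u ξ ≤ C₀ * ν s * (w (x + s.1) * u (ξ + s.2)))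
    {K A : ℝ} (hK : 0 ≤ K) (hA : 0 ≤ A) (hνK : ∀ s, ν s ≤ K * Real.exp (A * (‖s.1‖ + ‖s.2‖)))
    {g : 𝓢(V, ℂ)} (hg : g ≠ 0) (b : ℝ) (hb : 0 < b) :
    ∃ C : ℝ≥0∞, C ≠ ⊤ ∧ ∀ f : 𝓢'(V, ℂ),
      amalgamNorm p q u w (gaussS V b hb) f ≤ C * amalgamNorm p q u w g f := by
  -- The centred Gaussian may be orthogonal to $g$, so a suitable shift of it serves for the
  -- synthesis; the shift only moves the Gaussian kernel.
  obtain ⟨z, hz⟩ := exists_tfPair_ne_zero g hg 1 one_pos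
  refine exists_amalgamNorm_le_of_window hp hq hu hw hu0 hw0 hν hν0 hC₀ hmod
    (tfShift z.1 z.2 (gaussS V 1 one_pos)) g (gaussS V b hb) ?_
    (lintegral_tfPair_gaussS_ne_top 1 b one_pos hb hK hA hνK z)
  rw [tfPair_apply] at hz
  simpa only [mul_comm] using hz

/-- Wiener amalgam spaces embed into weighted `M^∞`. -/
theorem exists_weight_mul_stft_le_amalgamNorm {p q : ℝ≥0∞} (hp : 1 ≤ p) (hq : 1 ≤ q)
    {u w : V → ℝ} (hu : Measurable u) (hw : Measurable w) (hu0 : ∀ ξ, 0 ≤ u ξ)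
    (hw0 : ∀ x, 0 ≤ w x) {ν : V × V → ℝ} {C₀ : ℝ} (hC₀ : 0 ≤ C₀)
    (hmod : ∀ x ξ s, w x * u ξ ≤ C₀ * ν s * (w (x + s.1) * u (ξ + s.2)))
    {K A : ℝ} (hK : 0 ≤ K) (hνK : ∀ s, ν s ≤ K * Real.exp (A * (‖s.1‖ + ‖s.2‖)))
    (b : ℝ) (hb : 0 < b) :
    ∃ C : ℝ≥0∞, C ≠ ⊤ ∧ ∀ (f : 𝓢'(V, ℂ)) (x ξ : V),
      ENNReal.ofReal (w x * u ξ) * ‖stft (gaussS V b hb) f x ξ‖ₑ ≤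
        C * amalgamNorm p q u w (gaussS V b hb) f := by
  set g := gaussS V b hb with hg
  obtain ⟨C, c, hC, hc, h⟩ := exists_norm_tfPair_gaussS_mul_exp_le (V := V) b b hb hb A
  set k : V → ℝ≥0∞ := fun x => ENNReal.ofReal (Real.exp (-(c * ‖x‖ ^ 2))) with hk
  have hkm : Measurable k := by
    refine ENNReal.measurable_ofReal.comp (Continuous.measurable ?_)
    fun_prop
  have hk1 : ∀ x, k x ≤ 1 := fun x => by
    rw [hk, ENNReal.ofReal_le_one, Real.exp_le_one_iff]
    have : 0 ≤ c * ‖x‖ ^ 2 := by positivity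
    linarith
  have hki : ∫⁻ x : V, k x ≠ ⊤ := (integrable_exp_neg_sq hc).lintegral_lt_top.ne
  obtain ⟨Cp, hCp, Hp⟩ := lintegral_mul_le_const_mul_eLpNorm hkm ENNReal.one_ne_top hk1 hki hp
  obtain ⟨Cq, hCq, Hq⟩ := lintegral_mul_le_const_mul_eLpNorm hkm ENNReal.one_ne_top hk1 hki hq
  set c₀ := ‖∫ s, g s * conjS g s‖ₑ with hc₀
  have hc0 : c₀ ≠ 0 := enorm_ne_zero.2 (integral_gaussS_mul_gaussS_ne_zero b b hb hb)
  have hct : c₀ ≠ ⊤ := by simp [hc₀]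
  refine ⟨c₀⁻¹ * (ENNReal.ofReal (C₀ * K * C) * (Cp * Cq)), ?_, fun f x ξ => ?_⟩
  · exact ENNReal.mul_ne_top (ENNReal.inv_ne_top.2 hc0)
      (ENNReal.mul_ne_top ENNReal.ofReal_ne_top (ENNReal.mul_ne_top hCp hCq))
  set F : V → V → ℝ≥0∞ := fun x ξ => ENNReal.ofReal (w x * u ξ) * ‖stft g f x ξ‖ₑ with hF
  have hFm : Measurable (Function.uncurry F) :=
    measurable_weight_mul hu hw (measurable_enorm_stft g f)
  have hN : amalgamNorm p q u w g f = mixedNorm p q volume volume F :=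
    amalgamNorm_eq_weightedNorm p q hu hu0 hw0 g f
  -- Moderateness trades the weight at $(x,\xi)$ for the weight at the shifted point at the cost of
  -- $\nu(s)$. The Gaussian kernel pays for it, and what remains is bounded by a product of a
  -- function of time and a function of frequency.
  have hpt : ∀ s : V × V, ENNReal.ofReal (w x * u ξ) * ‖tfPair g (conjS g) s‖ₑ ≤
      ENNReal.ofReal (C₀ * K * C) * (k s.1 * k s.2) *
        ENNReal.ofReal (w (x + s.1) * u (ξ + s.2)) := by
    intro s
    rw [hk, ← ENNReal.ofReal_mul (by positivity), ← ENNReal.ofReal_mul (by positivity),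
      ← ENNReal.ofReal_mul (by positivity), ← ofReal_norm, ← ENNReal.ofReal_mul' (norm_nonneg _)]
    refine ENNReal.ofReal_le_ofReal ?_
    have hs := h s
    have hn := hνK s
    have hm := hmod x ξ s
    have hwu : 0 ≤ w (x + s.1) * u (ξ + s.2) := mul_nonneg (hw0 _) (hu0 _)
    rw [← hg] at hs
    rw [hg, conjS_gaussS, ← hg]
    calc w x * u ξ * ‖tfPair g g s‖
        ≤ C₀ * (K * Real.exp (A * (‖s.1‖ + ‖s.2‖))) * (w (x + s.1) * u (ξ + s.2)) *
          ‖tfPair g g s‖ :=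
          mul_le_mul_of_nonneg_right (hm.trans (mul_le_mul_of_nonneg_right
            (mul_le_mul_of_nonneg_left hn hC₀) hwu)) (norm_nonneg _)
      _ = C₀ * K * (‖tfPair g g s‖ * Real.exp (A * (‖s.1‖ + ‖s.2‖))) *
          (w (x + s.1) * u (ξ + s.2)) := by ring
      _ ≤ C₀ * K * (C * (Real.exp (-(c * ‖s.1‖ ^ 2)) * Real.exp (-(c * ‖s.2‖ ^ 2)))) *
          (w (x + s.1) * u (ξ + s.2)) := by gcongr
      _ = _ := by ring
  have hmG : Measurable fun s : V × V => ‖tfPair g (conjS g) s‖ₑ * ‖stft g f (x + s.1) (ξ + s.2)‖ₑ :=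
    (tfPair g (conjS g)).continuous.measurable.enorm.mul ((measurable_enorm_stft g f).comp
      (f := fun s : V × V => (x + s.1, ξ + s.2)) (by fun_prop))
  have hmF : Measurable fun s : V × V => F (x + s.1) (ξ + s.2) :=
    hFm.comp (f := fun s : V × V => (x + s.1, ξ + s.2)) (by fun_prop)
  have hmk : Measurable fun s : V × V => F (x + s.1) (ξ + s.2) * k s.2 :=
    hmF.mul (hkm.comp measurable_snd)
  have step1 : c₀ * (ENNReal.ofReal (w x * u ξ) * ‖stft g f x ξ‖ₑ) ≤
      ∫⁻ s : V × V, ENNReal.ofReal (C₀ * K * C) *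
        ((F (x + s.1) (ξ + s.2) * k s.2) * k s.1) := by
    calc c₀ * (ENNReal.ofReal (w x * u ξ) * ‖stft g f x ξ‖ₑ)
        = ENNReal.ofReal (w x * u ξ) * (c₀ * ‖stft g f x ξ‖ₑ) := by ring
      _ ≤ ENNReal.ofReal (w x * u ξ) * ∫⁻ s : V × V,
          ‖tfPair g (conjS g) s‖ₑ * ‖stft g f (x + s.1) (ξ + s.2)‖ₑ := by
          gcongr
          exact enorm_stft_le_lintegral f g g g x ξ
      _ = ∫⁻ s : V × V, ENNReal.ofReal (w x * u ξ) *
          (‖tfPair g (conjS g) s‖ₑ * ‖stft g f (x + s.1) (ξ + s.2)‖ₑ) :=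
          (lintegral_const_mul _ hmG).symm
      _ ≤ _ := by
          refine lintegral_mono fun s => ?_
          dsimp only
          rw [← mul_assoc]
          refine (mul_le_mul_left (hpt s) _).trans (le_of_eq ?_)
          simp only [hF]
          ring
  -- Because the kernel bound is a product, the $L^p$ norm is used in frequency first and the $L^q$
  -- norm in time afterwards, both invariant under translation.
  have step2 : ∫⁻ s : V × V, (F (x + s.1) (ξ + s.2) * k s.2) * k s.1 ≤
      Cp * Cq * mixedNorm p q volume volume F := by
    rw [Measure.volume_eq_prod, lintegral_prod (fun s : V × V => F (x + s.1) (ξ + s.2) * k s.2 * k s.1)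
      (hmk.mul (hkm.comp measurable_fst)).aemeasurable]
    have tr : ∀ y, ∫⁻ η, F y (ξ + η) * k η ≤ Cp * eLpNorm (F y) p volume := by
      intro y
      refine (Hp (fun η => F y (ξ + η)) (hFm.of_uncurry_left.comp (by fun_prop))).trans ?_
      gcongr
      exact (eLpNorm_comp_measurePreserving (f := fun η => ξ + η) (g := F y)
        hFm.of_uncurry_left.aestronglyMeasurable (measurePreserving_add_left volume ξ)).le
    have hme := measurable_eLpNorm_of_uncurry (ν := volume) hFm p
    calc ∫⁻ y, ∫⁻ η, (F (x + y) (ξ + η) * k η) * k y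
        ≤ ∫⁻ y, (Cp * eLpNorm (F (x + y)) p volume) * k y := by
          refine lintegral_mono fun y => ?_
          dsimp only
          have hmy : Measurable fun η => F (x + y) (ξ + η) * k η :=
            (hFm.of_uncurry_left.comp (measurable_const_add ξ)).mul hkm
          rw [lintegral_mul_const _ hmy]
          exact mul_le_mul_left (tr (x + y)) _
      _ = Cp * ∫⁻ y, eLpNorm (F (x + y)) p volume * k y := by
          simp only [mul_assoc]
          exact lintegral_const_mul _ ((hme.comp (by fun_prop)).mul hkm)
      _ ≤ Cp * (Cq * eLpNorm (fun y => eLpNorm (F (x + y)) p volume) q volume) := by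
          gcongr
          exact Hq _ (hme.comp (by fun_prop))
      _ = Cp * (Cq * mixedNorm p q volume volume F) := by
          congr 2
          exact eLpNorm_comp_measurePreserving (f := fun y => x + y)
            (g := fun y => eLpNorm (F y) p volume) hme.aestronglyMeasurable
            (measurePreserving_add_left volume x)
      _ = _ := by rw [mul_assoc]
  calc ENNReal.ofReal (w x * u ξ) * ‖stft g f x ξ‖ₑ
      = c₀⁻¹ * (c₀ * (ENNReal.ofReal (w x * u ξ) * ‖stft g f x ξ‖ₑ)) := by
        rw [← mul_assoc, ENNReal.inv_mul_cancel hc0 hct, one_mul]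
    _ ≤ c₀⁻¹ * (ENNReal.ofReal (C₀ * K * C) * (Cp * Cq * mixedNorm p q volume volume F)) := by
        refine mul_le_mul' le_rfl (step1.trans ?_)
        have e : ∫⁻ s : V × V, ENNReal.ofReal (C₀ * K * C) *
            ((F (x + s.1) (ξ + s.2) * k s.2) * k s.1) = ENNReal.ofReal (C₀ * K * C) *
            ∫⁻ s : V × V, (F (x + s.1) (ξ + s.2) * k s.2) * k s.1 :=
          lintegral_const_mul _ (hmk.mul (hkm.comp measurable_fst))
        rw [e]
        exact mul_le_mul' le_rfl step2
    _ = _ := by rw [hN]; ring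

end WeightedAmalgam

/-! ### Integral operators on functions bounded by $1/m$ -/

section DominatedKernels

variable {E : Type} [NormedAddCommGroup E] [NormedSpace ℝ E] [FiniteDimensional ℝ E]
  [MeasureSpace E] [BorelSpace E] [(volume : Measure E).IsAddHaarMeasure]

/-- A seminorm of order $N$ plus the integrable power pays for the factor $(1+\|z\|)^N$ and still
leaves integrable decay, linearly in a seminorm of $F$. -/
theorem exists_one_add_pow_mul_norm_le (N : ℕ) : ∃ (s : Finset (ℕ × ℕ)) (C : ℝ), 0 ≤ C ∧
    ∀ (F : 𝓢(E, ℂ)) (z : E), (1 + ‖z‖) ^ N * ‖F z‖ ≤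
      C * s.sup (schwartzSeminormFamily ℂ E ℂ) F *
        (1 + ‖z‖) ^ (-(Measure.integrablePower (volume : Measure E) : ℝ)) := by
  set m := Measure.integrablePower (volume : Measure E) with hm
  refine ⟨Finset.Iic (N + m, 0), 2 ^ (N + m), by positivity, fun F z => ?_⟩
  have h := SchwartzMap.one_add_le_sup_seminorm_apply (𝕜 := ℂ) (m := (N + m, 0)) (k := N + m)
    (n := 0) le_rfl le_rfl F z
  rw [norm_iteratedFDeriv_zero] at h
  rw [Real.rpow_neg (by positivity), Real.rpow_natCast, ← div_eq_mul_inv,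
    le_div_iff₀ (by positivity)]
  refine le_trans (le_of_eq ?_) h
  rw [pow_add]
  ring

theorem integrable_one_add_pow_mul_norm (N : ℕ) (F : 𝓢(E, ℂ)) :
    Integrable (fun z => (1 + ‖z‖) ^ N * ‖F z‖) := by
  obtain ⟨s, C, -, h⟩ := exists_one_add_pow_mul_norm_le (E := E) N
  refine ((Measure.integrable_pow_neg_integrablePower (volume : Measure E)).const_mul
    (C * s.sup (schwartzSeminormFamily ℂ E ℂ) F)).mono'
    (Continuous.aestronglyMeasurable (by fun_prop)) (Eventually.of_forall fun z => ?_)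
  rw [Real.norm_of_nonneg (by positivity)]
  exact h F z

theorem integrable_mul_schwartz {R : E → ℂ} (hR : AEStronglyMeasurable R) {C : ℝ} {N : ℕ}
    (hb : ∀ z, ‖R z‖ ≤ C * (1 + ‖z‖) ^ N) (F : 𝓢(E, ℂ)) :
    Integrable (fun z => R z * F z) := by
  refine ((integrable_one_add_pow_mul_norm N F).const_mul C).mono'
    (hR.mul F.continuous.aestronglyMeasurable) (Eventually.of_forall fun z => ?_)
  rw [norm_mul, ← mul_assoc]
  exact mul_le_mul_of_nonneg_right (hb z) (norm_nonneg _)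

/-- A measurable function of polynomial growth is a tempered distribution; this turns the
coefficients produced by a dominated kernel into distributions. -/
theorem exists_clm_eq_integral_mul {R : E → ℂ} (hR : AEStronglyMeasurable R) {C : ℝ} {N : ℕ}
    (hb : ∀ z, ‖R z‖ ≤ C * (1 + ‖z‖) ^ N) :
    ∃ L : 𝓢(E, ℂ) →L[ℂ] ℂ, ∀ F, L F = ∫ z, R z * F z := by
  obtain ⟨s, C', hC', h⟩ := exists_one_add_pow_mul_norm_le (E := E) N
  have hC : 0 ≤ C := by
    have := (norm_nonneg _).trans (hb 0)
    simpa using this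
  have hI := Measure.integrable_pow_neg_integrablePower (volume : Measure E)
  refine ⟨SchwartzMap.mkCLMtoNormedSpace (𝕜 := ℂ) (σ := RingHom.id ℂ)
    (fun F : 𝓢(E, ℂ) => ∫ z, R z * F z) (fun F G => ?_) (fun a F => ?_)
    ⟨s, C * C' * ∫ z : E, (1 + ‖z‖) ^ (-(Measure.integrablePower (volume : Measure E) : ℝ)),
      by positivity, fun F => ?_⟩, fun F => rfl⟩
  · simp only [_root_.add_apply, mul_add]
    exact integral_add (integrable_mul_schwartz hR hb F) (integrable_mul_schwartz hR hb G)
  · simp only [_root_.smul_apply, RingHom.id_apply, smul_eq_mul]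
    rw [← integral_const_mul]
    congr 1
    ext z
    ring
  · have hp : ∀ z, ‖R z * F z‖ ≤ C * C' * s.sup (schwartzSeminormFamily ℂ E ℂ) F *
        (1 + ‖z‖) ^ (-(Measure.integrablePower (volume : Measure E) : ℝ)) := by
      intro z
      rw [norm_mul]
      calc ‖R z‖ * ‖F z‖ ≤ C * (1 + ‖z‖) ^ N * ‖F z‖ :=
            mul_le_mul_of_nonneg_right (hb z) (norm_nonneg _)
        _ = C * ((1 + ‖z‖) ^ N * ‖F z‖) := by ring
        _ ≤ _ := mul_le_mul_of_nonneg_left (h F z) hC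
        _ = _ := by ring
    refine (norm_integral_le_of_norm_le (hI.const_mul _) (Eventually.of_forall hp)).trans
      (le_of_eq ?_)
    rw [integral_const_mul]
    ring

/-- A measurable kernel `M` that maps functions bounded by `1 / m` to functions bounded by
`Q * (1 + ‖·‖) ^ N`. -/
structure IsDominatedKernel (m : E → ℝ) (M : E → E → ℂ) (Q : ℝ) (N : ℕ) : Prop where
  pos : ∀ z, 0 < m z
  measurable_weight : Measurable m
  measurable : StronglyMeasurable (Function.uncurry M)
  nonneg : 0 ≤ Q
  lintegral_le : ∀ w, ∫⁻ z, ‖(m z)⁻¹ * ‖M w z‖‖ₑ ≤ ENNReal.ofReal (Q * (1 + ‖w‖) ^ N)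

/-- The integral operator with kernel `M`. -/
def kerApply (M : E → E → ℂ) (G : E → ℂ) (w : E) : ℂ := ∫ z, G z * M w z

namespace IsDominatedKernel

variable {m : E → ℝ} {M : E → E → ℂ} {Q : ℝ} {N : ℕ} (hM : IsDominatedKernel m M Q N)
include hM

theorem integrable_bound (w : E) : Integrable fun z => (m z)⁻¹ * ‖M w z‖ :=
  ⟨(hM.measurable_weight.inv.mul
    (hM.measurable.comp_measurable measurable_prodMk_left).norm.measurable).aestronglyMeasurable,
    (hM.lintegral_le w).trans_lt ENNReal.ofReal_lt_top⟩

theorem norm_mul_le {G : E → ℂ} {B : ℝ} (hGB : ∀ z, ‖G z‖ ≤ B * (m z)⁻¹) (w z : E) :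
    ‖G z * M w z‖ ≤ B * ((m z)⁻¹ * ‖M w z‖) := by
  rw [norm_mul, ← mul_assoc]
  exact mul_le_mul_of_nonneg_right (hGB z) (norm_nonneg _)

theorem integrable {G : E → ℂ} (hG : Continuous G) {B : ℝ} (hGB : ∀ z, ‖G z‖ ≤ B * (m z)⁻¹)
    (w : E) : Integrable fun z => G z * M w z :=
  ((hM.integrable_bound w).const_mul B).mono' (hG.aestronglyMeasurable.mul
    (hM.measurable.comp_measurable measurable_prodMk_left).aestronglyMeasurable)
    (Eventually.of_forall (hM.norm_mul_le hGB w))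

theorem integral_bound_le (w : E) : ∫ z, (m z)⁻¹ * ‖M w z‖ ≤ Q * (1 + ‖w‖) ^ N := by
  have hQ := hM.nonneg
  rw [← ENNReal.ofReal_le_ofReal_iff (by positivity)]
  refine le_trans ?_ (hM.lintegral_le w)
  rw [ofReal_integral_eq_lintegral_ofReal (hM.integrable_bound w)
    (Eventually.of_forall fun z => mul_nonneg (inv_nonneg.2 (hM.pos z).le) (norm_nonneg _))]
  exact lintegral_mono fun z => Real.ofReal_le_enorm _

theorem nonneg_of_bound {G : E → ℂ} {B : ℝ} (hGB : ∀ z, ‖G z‖ ≤ B * (m z)⁻¹) : 0 ≤ B := by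
  have := (norm_nonneg _).trans (hGB 0)
  exact nonneg_of_mul_nonneg_left this (inv_pos.2 (hM.pos 0))

theorem norm_kerApply_le {G : E → ℂ} {B : ℝ} (hGB : ∀ z, ‖G z‖ ≤ B * (m z)⁻¹) (w : E) :
    ‖kerApply M G w‖ ≤ B * Q * (1 + ‖w‖) ^ N := by
  refine (norm_integral_le_of_norm_le ((hM.integrable_bound w).const_mul B)
    (Eventually.of_forall (hM.norm_mul_le hGB w))).trans ?_
  rw [integral_const_mul, mul_assoc]
  exact mul_le_mul_of_nonneg_left (hM.integral_bound_le w) (hM.nonneg_of_bound hGB)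

theorem stronglyMeasurable_kerApply {G : E → ℂ} (hG : Continuous G) :
    StronglyMeasurable (kerApply M G) :=
  StronglyMeasurable.integral_prod_right
    ((hG.stronglyMeasurable.comp_measurable measurable_snd).mul hM.measurable)

theorem kerApply_smul_add {G₁ G₂ : E → ℂ} (h₁ : Continuous G₁) (h₂ : Continuous G₂) {B₁ B₂ : ℝ}
    (hB₁ : ∀ z, ‖G₁ z‖ ≤ B₁ * (m z)⁻¹) (hB₂ : ∀ z, ‖G₂ z‖ ≤ B₂ * (m z)⁻¹) (c : ℂ) (w : E) :
    kerApply M (fun z => c * G₁ z + G₂ z) w = c * kerApply M G₁ w + kerApply M G₂ w := by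
  simp only [kerApply]
  rw [← integral_const_mul, ← integral_add ((hM.integrable h₁ hB₁ w).const_mul c)
    (hM.integrable h₂ hB₂ w)]
  congr 1
  ext z
  ring

theorem integrable_kerApply_mul {G : E → ℂ} (hG : Continuous G) {B : ℝ}
    (hGB : ∀ z, ‖G z‖ ≤ B * (m z)⁻¹) (F : 𝓢(E, ℂ)) :
    Integrable fun w => kerApply M G w * F w :=
  integrable_mul_schwartz (hM.stronglyMeasurable_kerApply hG).aestronglyMeasurable
    (hM.norm_kerApply_le hGB) F

theorem tendsto_kerApply {G : ℕ → E → ℂ} {G₀ : E → ℂ} (hG : ∀ n, Continuous (G n)) {B : ℝ}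
    (hGB : ∀ n z, ‖G n z‖ ≤ B * (m z)⁻¹) (hlim : ∀ z, Tendsto (fun n => G n z) atTop (𝓝 (G₀ z)))
    (w : E) : Tendsto (fun n => kerApply M (G n) w) atTop (𝓝 (kerApply M G₀ w)) := by
  refine tendsto_integral_of_dominated_convergence (fun z => B * ((m z)⁻¹ * ‖M w z‖))
    (fun n => (hM.integrable (hG n) (hGB n) w).aestronglyMeasurable)
    ((hM.integrable_bound w).const_mul B)
    (fun n => Eventually.of_forall (hM.norm_mul_le (hGB n) w))
    (Eventually.of_forall fun z => (hlim z).mul_const _)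

/-- Dominated convergence twice: in $z$ with majorant $B|M|/m$, in $w$ with a polynomial times
$|F|$. Only pointwise convergence and a common $B$ are required, which is what weak convergence of a
norm-bounded sequence supplies. -/
theorem tendsto_integral_kerApply_mul {G : ℕ → E → ℂ} {G₀ : E → ℂ} (hG : ∀ n, Continuous (G n))
    {B : ℝ} (hGB : ∀ n z, ‖G n z‖ ≤ B * (m z)⁻¹)
    (hlim : ∀ z, Tendsto (fun n => G n z) atTop (𝓝 (G₀ z))) (F : 𝓢(E, ℂ)) :
    Tendsto (fun n => ∫ w, kerApply M (G n) w * F w) atTop (𝓝 (∫ w, kerApply M G₀ w * F w)) := by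
  refine tendsto_integral_of_dominated_convergence
    (fun w => B * Q * ((1 + ‖w‖) ^ N * ‖F w‖))
    (fun n => (hM.integrable_kerApply_mul (hG n) (hGB n) F).aestronglyMeasurable)
    ((integrable_one_add_pow_mul_norm N F).const_mul _)
    (fun n => Eventually.of_forall fun w => ?_)
    (Eventually.of_forall fun w => (hM.tendsto_kerApply hG hGB hlim w).mul_const _)
  rw [norm_mul, ← mul_assoc]
  exact mul_le_mul_of_nonneg_right (hM.norm_kerApply_le (hGB n) w) (norm_nonneg _)

end IsDominatedKernel

/-- A kernel dominated by a translated `ν`-integrable function is dominated with respect to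
`ν`-moderate weights. -/
theorem isDominatedKernel_of_le {m : E → ℝ} (hm0 : ∀ z, 0 < m z) (hm : Measurable m)
    {M : E → E → ℂ} (hM : StronglyMeasurable (Function.uncurry M)) {ν : E → ℝ}
    (hν : Measurable ν) {C₀ : ℝ} (hC₀ : 0 ≤ C₀)
    (hmod : ∀ z s, m z ≤ C₀ * ν s * m (z + s)) {k : E → ℝ≥0∞} (hk : Measurable k)
    (hki : ∫⁻ s, k s * ENNReal.ofReal (ν s) ≠ ⊤) {D : E → E}
    (hMk : ∀ w z, ‖M w z‖ₑ ≤ k (z - D w)) {P : ℝ} {N : ℕ} (hP : 0 ≤ P)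
    (hlow : ∀ w, (m (D w))⁻¹ ≤ P * (1 + ‖w‖) ^ N) :
    IsDominatedKernel m M (C₀ * P * (∫⁻ s, k s * ENNReal.ofReal (ν s)).toReal) N := by
  refine ⟨hm0, hm, hM, by positivity, fun w => ?_⟩
  have hkν : Measurable fun s => k s * ENNReal.ofReal (ν s) :=
    hk.mul (ENNReal.measurable_ofReal.comp hν)
  -- Moderateness read for reciprocals: $1/m(Dw+s)\le C_0\,\nu(s)/m(Dw)$. The factor $1/m(Dw)$ is
  -- then bounded by `hlow`.
  have hpt : ∀ s, ENNReal.ofReal (m (s + D w))⁻¹ ≤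
      ENNReal.ofReal (C₀ * (m (D w))⁻¹) * ENNReal.ofReal (ν s) := by
    intro s
    rw [← ENNReal.ofReal_mul (mul_nonneg hC₀ (inv_nonneg.2 (hm0 _).le))]
    refine ENNReal.ofReal_le_ofReal ?_
    have h := hmod (D w) s
    have h1 := hm0 (D w)
    have h2 := hm0 (D w + s)
    rw [add_comm s, inv_le_iff_one_le_mul₀ h2]
    calc (1 : ℝ) = (m (D w))⁻¹ * m (D w) := (inv_mul_cancel₀ h1.ne').symm
      _ ≤ (m (D w))⁻¹ * (C₀ * ν s * m (D w + s)) :=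
        mul_le_mul_of_nonneg_left h (inv_nonneg.2 h1.le)
      _ = _ := by ring
  calc ∫⁻ z, ‖(m z)⁻¹ * ‖M w z‖‖ₑ
      ≤ ∫⁻ z, ENNReal.ofReal (m z)⁻¹ * k (z - D w) := by
        refine lintegral_mono fun z => ?_
        dsimp only
        rw [enorm_mul, enorm_norm, Real.enorm_of_nonneg (inv_nonneg.2 (hm0 z).le)]
        exact mul_le_mul' le_rfl (hMk w z)
    _ = ∫⁻ s, ENNReal.ofReal (m (s + D w))⁻¹ * k s := by
        rw [← lintegral_add_right_eq_self _ (D w)]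
        simp only [add_sub_cancel_right]
    _ ≤ ∫⁻ s, ENNReal.ofReal (C₀ * (m (D w))⁻¹) * (k s * ENNReal.ofReal (ν s)) := by
        refine lintegral_mono fun s => ?_
        dsimp only
        refine (mul_le_mul' (hpt s) le_rfl).trans (le_of_eq ?_)
        ring
    _ = ENNReal.ofReal (C₀ * (m (D w))⁻¹) * ∫⁻ s, k s * ENNReal.ofReal (ν s) :=
        lintegral_const_mul _ hkν
    _ ≤ _ := by
        conv_lhs => rw [← ENNReal.ofReal_toReal hki, ← ENNReal.ofReal_mul
          (mul_nonneg hC₀ (inv_nonneg.2 (hm0 _).le))]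
        refine ENNReal.ofReal_le_ofReal ?_
        calc C₀ * (m (D w))⁻¹ * (∫⁻ s, k s * ENNReal.ofReal (ν s)).toReal
            ≤ C₀ * (P * (1 + ‖w‖) ^ N) * (∫⁻ s, k s * ENNReal.ofReal (ν s)).toReal :=
              mul_le_mul_of_nonneg_right (mul_le_mul_of_nonneg_left (hlow w) hC₀)
                ENNReal.toReal_nonneg
          _ = _ := by ring

end DominatedKernels

/-! ### Extension of an operator from its Gabor-type matrix -/

section Extension

variable {V : Type} [NormedAddCommGroup V] [InnerProductSpace ℝ V] [FiniteDimensional ℝ V]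
  [MeasurableSpace V] [BorelSpace V]

theorem tendsto_stft (g : 𝓢(V, ℂ)) {f : ℕ → 𝓢'(V, ℂ)} {f₀ : 𝓢'(V, ℂ)}
    (h : Tendsto f atTop (𝓝 f₀)) (x ξ : V) :
    Tendsto (fun n => stft g (f n) x ξ) atTop (𝓝 (stft g f₀ x ξ)) :=
  (PointwiseConvergenceCLM.tendsto_iff_forall_tendsto.1 h) _

/-- The function `z ↦ V_g f (z.1, z.2)` on phase space. -/
def stftFun (g : 𝓢(V, ℂ)) (f : 𝓢'(V, ℂ)) (z : V × V) : ℂ := stft g f z.1 z.2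

theorem continuous_stftFun (g : 𝓢(V, ℂ)) (f : 𝓢'(V, ℂ)) : Continuous (stftFun g f) :=
  continuous_stft g f

open Classical in
/-- The operator on tempered distributions obtained by applying the integral operator with kernel
`M` to the short-time Fourier transform with window `φ` and synthesizing with `γ`. -/
def extendOp (M : V × V → V × V → ℂ) (c : ℂ) (φ γ : 𝓢(V, ℂ)) (f : 𝓢'(V, ℂ)) : 𝓢'(V, ℂ) :=
  -- For a general distribution the formula need not be continuous in $\chi$; the default value $0$
  -- is then irrelevant, as the formula is valid whenever $|V_\varphi f|\le B/m$.
  if h : ∃ U : 𝓢'(V, ℂ), ∀ χ, U χ = c⁻¹ * ∫ w, kerApply M (stftFun φ f) w * tfPair γ χ w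
  then h.choose else 0

variable {m : V × V → ℝ} {M : V × V → V × V → ℂ} {Q : ℝ} {N : ℕ}

/-- The bound $B/m$ makes the kernel integral polynomially bounded, so the pairing with `tfPair γ χ`
is continuous in $\chi$ and the existence test succeeds. -/
theorem extendOp_apply (hM : IsDominatedKernel m M Q N) (c : ℂ) (φ γ : 𝓢(V, ℂ)) (f : 𝓢'(V, ℂ))
    {B : ℝ} (hB : ∀ z, ‖stftFun φ f z‖ ≤ B * (m z)⁻¹) (χ : 𝓢(V, ℂ)) :
    extendOp M c φ γ f χ = c⁻¹ * ∫ w, kerApply M (stftFun φ f) w * tfPair γ χ w := by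
  obtain ⟨L, hL⟩ := exists_clm_eq_integral_mul
    (hM.stronglyMeasurable_kerApply (continuous_stftFun φ f)).aestronglyMeasurable
    (hM.norm_kerApply_le hB)
  have h : ∃ U : 𝓢'(V, ℂ), ∀ χ, U χ =
      c⁻¹ * ∫ w, kerApply M (stftFun φ f) w * tfPair γ χ w :=
    ⟨ContinuousLinearMap.toPointwiseConvergenceCLM ℂ (RingHom.id ℂ) _ _
      (c⁻¹ • (L ∘L tfPair γ)), fun χ => by
        rw [← hL]
        rfl⟩
  rw [extendOp, dif_pos h]
  exact h.choose_spec χ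

/-- Testing the synthesis formula with a shifted window turns `tfPair` into a translate of one fixed
function, so the target window enters through a convolution. -/
theorem enorm_stft_extendOp_le (hM : IsDominatedKernel m M Q N) (c : ℂ) (φ γ h : 𝓢(V, ℂ))
    (f : 𝓢'(V, ℂ)) {B : ℝ} (hB : ∀ z, ‖stftFun φ f z‖ ≤ B * (m z)⁻¹) (x ξ : V) :
    ‖stft h (extendOp M c φ γ f) x ξ‖ₑ ≤ ‖c⁻¹‖ₑ * ∫⁻ s : V × V,
      ‖tfPair γ (conjS h) s‖ₑ * ‖kerApply M (stftFun φ f) (x + s.1, ξ + s.2)‖ₑ := by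
  change ‖extendOp M c φ γ f (conjS (tfShift x ξ h))‖ₑ ≤ _
  rw [extendOp_apply hM c φ γ f hB, enorm_mul]
  refine mul_le_mul' le_rfl ((enorm_integral_le_lintegral_enorm _).trans (le_of_eq ?_))
  rw [← lintegral_add_left_eq_self _ (x, ξ)]
  refine lintegral_congr fun s => ?_
  have e := norm_tfPair_tfShift γ h (x, ξ) ((x, ξ) + s)
  rw [add_sub_cancel_left] at e
  rw [enorm_mul, mul_comm, ← ofReal_norm (tfPair γ _ _), e, ofReal_norm]
  rfl

/-- Reconstruction is used twice. Expanding $f$ in shifts of $\varphi$ under the functional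
$f\mapsto\langle Af,\pi(w)\psi\rangle$ shows that the kernel integral is
$\langle\varphi,\varphi\rangle V_\psi(Af)(w)$; synthesis with $\gamma$ then returns $Af$ times
$\langle\gamma,\psi\rangle$. The normalization is the product of the two constants. -/
theorem extendOp_coe (hM : IsDominatedKernel m M Q N) {A : 𝓢(V, ℂ) → 𝓢'(V, ℂ)}
    (hA : ∀ χ, ∃ Λ : 𝓢(V, ℂ) →L[ℂ] ℂ, ∀ f, Λ f = A f χ) {φ ψ γ : 𝓢(V, ℂ)}
    (hMA : ∀ w z, M w z = A (tfShift z.1 z.2 φ) (conjS (tfShift w.1 w.2 ψ)))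
    (hφ : ∫ t, conjS φ t * φ t ≠ 0) (hγ : ∫ t, γ t * conjS ψ t ≠ 0) (f : 𝓢(V, ℂ))
    {B : ℝ} (hB : ∀ z, ‖stftFun φ (f : 𝓢'(V, ℂ)) z‖ ≤ B * (m z)⁻¹) :
    extendOp M ((∫ t, conjS φ t * φ t) * ∫ t, γ t * conjS ψ t) φ γ (f : 𝓢'(V, ℂ)) = A f := by
  ext χ
  rw [extendOp_apply hM _ φ γ _ hB]
  have h1 : ∀ w, kerApply M (stftFun φ (f : 𝓢'(V, ℂ))) w =
      (∫ t, conjS φ t * φ t) * stft ψ (A f) w.1 w.2 := by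
    intro w
    obtain ⟨Λ, hΛ⟩ := hA (conjS (tfShift w.1 w.2 ψ))
    have := integral_stft_mul_apply Λ φ f φ
    simp only [hΛ, ← hMA] at this
    exact this
  have h2 : ∫ w, kerApply M (stftFun φ (f : 𝓢'(V, ℂ))) w * tfPair γ χ w =
      (∫ t, conjS φ t * φ t) * ∫ w, tfPair γ χ w * stft ψ (A f) w.1 w.2 := by
    rw [← integral_const_mul]
    congr 1
    ext w
    rw [h1]
    ring
  rw [h2, integral_tfPair_mul_stft, ← mul_assoc (∫ t, conjS φ t * φ t),
    inv_mul_cancel_left₀ (mul_ne_zero hφ hγ)]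

/-- Boundedness on Wiener amalgam spaces of operators whose matrix with respect to time-frequency
shifted windows is dominated by a convolution kernel composed with a dilation. -/
theorem boundedBetween_of_kernel {a b : ℝ} (ha : a ≠ 0) (hb : b ≠ 0) {p q : ℝ≥0∞} (hp : 1 ≤ p)
    (hq : 1 ≤ q) {u w : V → ℝ} (hu : Measurable u) (hw : Measurable w) (hu0 : ∀ ξ, 0 < u ξ)
    (hw0 : ∀ x, 0 < w x) {ν : V × V → ℝ} (hν : Measurable ν) (hν0 : ∀ s, 0 ≤ ν s) {C₀ : ℝ}
    (hC₀ : 0 ≤ C₀) (hmod : ∀ x ξ s, w x * u ξ ≤ C₀ * ν s * (w (x + s.1) * u (ξ + s.2)))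
    {K A₀ : ℝ} (hK : 0 ≤ K) (hA₀ : 0 ≤ A₀)
    (hνK : ∀ s, ν s ≤ K * Real.exp (A₀ * (‖s.1‖ + ‖s.2‖)))
    {P : ℝ} {N : ℕ} (hP : 0 ≤ P)
    (hlow : ∀ x ξ, (w (a • x) * u (b • ξ))⁻¹ ≤ P * (1 + ‖(x, ξ)‖) ^ N)
    {A : 𝓢(V, ℂ) → 𝓢'(V, ℂ)} (hA : ∀ χ, ∃ Λ : 𝓢(V, ℂ) →L[ℂ] ℂ, ∀ f, Λ f = A f χ)
    {α β : ℝ} (hα : 0 < α) (hβ : 0 < β)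
    (hAc : StronglyMeasurable (Function.uncurry fun w z : V × V =>
      A (tfShift z.1 z.2 (gaussS V β hβ)) (conjS (tfShift w.1 w.2 (gaussS V α hα)))))
    {k : V × V → ℝ≥0∞} (hk : Measurable k) (hki : ∫⁻ s, k s * ENNReal.ofReal (ν s) ≠ ⊤)
    (hAk : ∀ w z : V × V,
      ‖A (tfShift z.1 z.2 (gaussS V β hβ)) (conjS (tfShift w.1 w.2 (gaussS V α hα)))‖ₑ ≤
        k (z.1 - a • w.1, z.2 - b • w.2))
    {g : 𝓢(V, ℂ)} (hg : g ≠ 0) {h : 𝓢(V, ℂ)} {ν' : V × V → ℝ} (hν' : Measurable ν')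
    (hν'0 : ∀ s, 0 ≤ ν' s)
    (hmod' : ∀ x ξ s, w (a • x) * u (b • ξ) ≤
      C₀ * ν' s * (w (a • (x + s.1)) * u (b • (ξ + s.2))))
    (hh : ∫⁻ s : V × V, ‖tfPair (gaussS V 1 one_pos) (conjS h) s‖ₑ * ENNReal.ofReal (ν' s) ≠ ⊤) :
    BoundedBetween A (amalgamNorm p q u w g)
      (amalgamNorm p q (fun ξ => u (b • ξ)) (fun x => w (a • x)) h) := by
  set φ := gaussS V β hβ with hφ
  set ψ := gaussS V α hα with hψ
  set γ := gaussS V 1 one_pos with hγ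
  set m : V × V → ℝ := fun z => w z.1 * u z.2 with hm
  set M : V × V → V × V → ℂ := fun w z =>
    A (tfShift z.1 z.2 φ) (conjS (tfShift w.1 w.2 ψ)) with hM
  have hu0' := fun ξ => (hu0 ξ).le
  have hw0' := fun ξ => (hw0 ξ).le
  have hdom := isDominatedKernel_of_le (m := m) (M := M) (D := fun z => (a • z.1, b • z.2))
    (fun z => mul_pos (hw0 _) (hu0 _))
    ((hw.comp measurable_fst).mul (hu.comp measurable_snd)) hAc hν hC₀
    (fun z s => hmod z.1 z.2 s) hk hki (fun w z => hAk w z) hP (fun w => hlow w.1 w.2)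
  -- The four estimates: $C_1$ passes from $g$ to the Gaussian $\varphi$, $C_2$ gives the pointwise
  -- bound on $V_\varphi f$, $C_3$ is the kernel followed by the dilation, and $C_4$ is synthesis
  -- with $\gamma$ and analysis with $h$, in the dilated weights.
  obtain ⟨C₁, hC₁, H₁⟩ := exists_amalgamNorm_gaussS_le hp hq hu hw hu0' hw0' hν hν0 hC₀ hmod hK
    hA₀ hνK hg β hβ
  obtain ⟨C₂, hC₂, H₂⟩ := exists_weight_mul_stft_le_amalgamNorm hp hq hu hw hu0' hw0' hC₀ hmod hK
    hνK β hβ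
  obtain ⟨C₃, hC₃, H₃⟩ := weightedNorm_young (u' := fun ξ => u (b • ξ)) (w' := fun x => w (a • x))
    ha hb hp hq hu hw hν hν0 hC₀ (fun x ξ s => hmod _ _ s) hk hki
  have hub : Measurable fun ξ => u (b • ξ) := hu.comp (measurable_const_smul b)
  have hwa : Measurable fun x => w (a • x) := hw.comp (measurable_const_smul a)
  obtain ⟨C₄, hC₄, H₄⟩ := weightedNorm_young (u' := fun ξ => u (b • ξ)) (w' := fun x => w (a • x))
    one_ne_zero one_ne_zero hp hq hub hwa hν' hν'0 hC₀
    (fun x ξ s => by simpa only [one_smul] using hmod' x ξ s)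
    (tfPair γ (conjS h)).continuous.measurable.enorm hh
  -- The bound $B$ depends on the norm bound $R$ only; this uniformity is the majorant for
  -- sequential continuity on bounded sets.
  have hbd : ∀ (R : ℝ≥0∞), R ≠ ⊤ → ∃ B : ℝ, ∀ f, amalgamNorm p q u w g f ≤ R →
      ∀ z, ‖stftFun φ f z‖ ≤ B * (m z)⁻¹ := by
    intro R hR
    refine ⟨(C₂ * (C₁ * R)).toReal, fun f hf z => ?_⟩
    have hmz : 0 < m z := hdom.pos z
    have h1 : ENNReal.ofReal (m z) * ‖stft φ f z.1 z.2‖ₑ ≤ C₂ * (C₁ * R) :=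
      (H₂ f z.1 z.2).trans (mul_le_mul' le_rfl ((H₁ f).trans (mul_le_mul' le_rfl hf)))
    rw [← div_eq_mul_inv, le_div_iff₀ hmz]
    have h2 := ENNReal.toReal_mono (ENNReal.mul_ne_top hC₂ (ENNReal.mul_ne_top hC₁ hR)) h1
    rw [ENNReal.toReal_mul, ENNReal.toReal_ofReal hmz.le, toReal_enorm] at h2
    rw [mul_comm]
    exact h2
  have hbd' : ∀ f, amalgamNorm p q u w g f < ⊤ → ∃ B : ℝ, ∀ z, ‖stftFun φ f z‖ ≤ B * (m z)⁻¹ := by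
    intro f hf
    obtain ⟨B, hB⟩ := hbd _ hf.ne
    exact ⟨B, hB f le_rfl⟩
  have hcφ : ∫ t, conjS φ t * φ t ≠ 0 := by
    have := integral_gaussS_mul_gaussS_ne_zero (V := V) β β hβ hβ
    simpa only [mul_comm, conjS_apply] using this
  have hcγ : ∫ t, γ t * conjS ψ t ≠ 0 := integral_gaussS_mul_gaussS_ne_zero 1 α one_pos hα
  set c := (∫ t, conjS φ t * φ t) * ∫ t, γ t * conjS ψ t with hc
  refine ⟨extendOp M c φ γ, fun f hf => ?_, fun d f₁ f₂ hf₁ hf₂ => ?_, ?_, fun R f f₀ hf hf₀ hlim => ?_⟩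
  · obtain ⟨B, hB⟩ := hbd' _ hf
    exact extendOp_coe hdom hA (fun _ _ => rfl) hcφ hcγ f hB
  · obtain ⟨B₁, hB₁⟩ := hbd' _ hf₁
    obtain ⟨B₂, hB₂⟩ := hbd' _ hf₂
    have hB : ∀ z, ‖stftFun φ (d • f₁ + f₂) z‖ ≤ (‖d‖ * B₁ + B₂) * (m z)⁻¹ := by
      intro z
      refine (norm_add_le (d * stftFun φ f₁ z) (stftFun φ f₂ z)).trans ?_
      rw [norm_mul, add_mul, mul_assoc]
      exact add_le_add (mul_le_mul_of_nonneg_left (hB₁ z) (norm_nonneg _)) (hB₂ z)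
    ext χ
    change _ = d * extendOp M c φ γ f₁ χ + extendOp M c φ γ f₂ χ
    rw [extendOp_apply hdom c φ γ _ hB, extendOp_apply hdom c φ γ _ hB₁,
      extendOp_apply hdom c φ γ _ hB₂]
    have e : ∀ w', kerApply M (stftFun φ (d • f₁ + f₂)) w' * tfPair γ χ w' =
        d * (kerApply M (stftFun φ f₁) w' * tfPair γ χ w') +
          kerApply M (stftFun φ f₂) w' * tfPair γ χ w' := by
      intro w'
      have := hdom.kerApply_smul_add (continuous_stftFun φ f₁) (continuous_stftFun φ f₂) hB₁ hB₂ d w'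
      calc kerApply M (stftFun φ (d • f₁ + f₂)) w' * tfPair γ χ w'
          = (d * kerApply M (stftFun φ f₁) w' + kerApply M (stftFun φ f₂) w') * tfPair γ χ w' :=
            congrArg (· * tfPair γ χ w') this
        _ = _ := by ring
    simp only [e]
    rw [integral_add ((hdom.integrable_kerApply_mul (continuous_stftFun φ f₁) hB₁ _).const_mul d)
      (hdom.integrable_kerApply_mul (continuous_stftFun φ f₂) hB₂ _), integral_const_mul]
    ring
  · refine ⟨(‖c⁻¹‖ₑ * (C₄ * (C₃ * C₁))).toNNReal, fun f hf => ?_⟩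
    obtain ⟨B, hB⟩ := hbd' _ hf
    rw [ENNReal.coe_toNNReal (ENNReal.mul_ne_top (by simp)
      (ENNReal.mul_ne_top hC₄ (ENNReal.mul_ne_top hC₃ hC₁)))]
    set R : V → V → ℝ≥0∞ := fun x ξ => ‖kerApply M (stftFun φ f) (x, ξ)‖ₑ with hR
    have hRm : Measurable (Function.uncurry R) :=
      (hdom.stronglyMeasurable_kerApply (continuous_stftFun φ f)).measurable.enorm
    -- The substitution $z=Dw+s$ turns the matrix bound into a convolution evaluated at the dilated
    -- point.
    have hRle : ∀ x ξ, R x ξ ≤ ∫⁻ s : V × V, k s * ‖stft φ f (a • x + s.1) (b • ξ + s.2)‖ₑ := by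
      intro x ξ
      refine (enorm_integral_le_lintegral_enorm _).trans ?_
      rw [← lintegral_add_left_eq_self _ (a • x, b • ξ)]
      refine lintegral_mono fun s => ?_
      dsimp only
      rw [enorm_mul, mul_comm]
      refine mul_le_mul' ((hAk (x, ξ) ((a • x, b • ξ) + s)).trans (le_of_eq ?_)) le_rfl
      simp
    have s1 := H₃ (fun x ξ => ‖stft φ f x ξ‖ₑ) R (measurable_enorm_stft φ f) hRle
    rw [← amalgamNorm_eq_weightedNorm p q hu hu0' hw0' φ f] at s1
    set S : V → V → ℝ≥0∞ := fun x ξ => ∫⁻ s : V × V,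
      ‖tfPair γ (conjS h) s‖ₑ * R (x + s.1) (ξ + s.2) with hS
    have s2 := H₄ R S hRm (fun x ξ => by simp only [hS, one_smul]; exact le_rfl)
    have hSm : Measurable (Function.uncurry S) := by
      refine Measurable.lintegral_prod_right (f := fun (z : V × V) (s : V × V) =>
        ‖tfPair γ (conjS h) s‖ₑ * R (z.1 + s.1) (z.2 + s.2)) ?_
      exact ((tfPair γ (conjS h)).continuous.measurable.enorm.comp measurable_snd).mul
        (hRm.comp (f := fun t : (V × V) × (V × V) => (t.1.1 + t.2.1, t.1.2 + t.2.2))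
          (by fun_prop))
    rw [amalgamNorm_eq_weightedNorm p q hub (fun _ => hu0' _) (fun _ => hw0' _)]
    calc weightedNorm p q (fun ξ => u (b • ξ)) (fun x => w (a • x))
          (fun x ξ => ‖stft h (extendOp M c φ γ f) x ξ‖ₑ)
        ≤ mixedNorm p q volume volume (fun x ξ => ‖c⁻¹‖ₑ *
          (ENNReal.ofReal (w (a • x) * u (b • ξ)) * S x ξ)) := by
          refine mixedNorm_mono fun x ξ => ?_
          refine (mul_le_mul' le_rfl (enorm_stft_extendOp_le hdom c φ γ h f hB x ξ)).trans
            (le_of_eq ?_)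
          simp only [hS, hR]
          ring
      _ = ‖c⁻¹‖ₑ * weightedNorm p q (fun ξ => u (b • ξ)) (fun x => w (a • x)) S :=
          mixedNorm_const_mul (measurable_weight_mul hub hwa hSm) _
      _ ≤ ‖c⁻¹‖ₑ * (C₄ * (C₃ * (C₁ * amalgamNorm p q u w g f))) :=
          mul_le_mul' le_rfl (s2.trans (mul_le_mul' le_rfl (s1.trans
            (mul_le_mul' le_rfl (H₁ f)))))
      _ = _ := by ring
  · rw [PointwiseConvergenceCLM.tendsto_iff_forall_tendsto]
    intro χ
    obtain ⟨B, hB⟩ := hbd R ENNReal.coe_ne_top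
    obtain ⟨B₀, hB₀⟩ := hbd' _ hf₀
    rw [extendOp_apply hdom c φ γ f₀ hB₀]
    have e : ∀ n, extendOp M c φ γ (f n) χ =
        c⁻¹ * ∫ w, kerApply M (stftFun φ (f n)) w * tfPair γ χ w := fun n =>
      extendOp_apply hdom c φ γ (f n) (hB _ (hf n)) χ
    simp only [e]
    exact (hdom.tendsto_integral_kerApply_mul (fun n => continuous_stftFun φ (f n))
      (fun n z => hB _ (hf n) z) (fun z => tendsto_stft φ hlim z.1 z.2) _).const_mul _

end Extension

/-! ### Essential suprema of continuous functions -/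

section Pointwise

/-- The set where the bound holds is closed by continuity and dense because its complement is null,
so it is everything. It allows the $\mathcal FL^\infty$ norm of $\sigma$ to be used at the
individual frequencies met by the matrix. -/
theorem enorm_le_eLpNorm_top {α : Type*} [TopologicalSpace α] [MeasurableSpace α] {μ : Measure α}
    [μ.IsOpenPosMeasure] {f : α → ℂ} (hf : Continuous f) (x : α) : ‖f x‖ₑ ≤ eLpNorm f ⊤ μ := by
  have hae : ∀ᵐ y ∂μ, ‖f y‖ₑ ≤ eLpNorm f ⊤ μ := by
    rw [eLpNorm_exponent_top]
    exact enorm_ae_le_eLpNormEssSup f μ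
  have hcl : IsClosed {y | ‖f y‖ₑ ≤ eLpNorm f ⊤ μ} := isClosed_le hf.enorm continuous_const
  have := hcl.closure_eq ▸ (Measure.dense_of_ae hae).closure_eq
  exact (this ▸ Set.mem_univ x : x ∈ {y | ‖f y‖ₑ ≤ eLpNorm f ⊤ μ})

end Pointwise

/-! ### Covariance of the $\tau$-Wigner distribution and its Gaussian case -/

section PhaseSpace

variable {d : ℕ}

theorem real_inner_toLp (x₁ x₂ y₁ y₂ : Euc d) :
    ⟪(WithLp.toLp 2 (x₁, x₂) : Phase d), WithLp.toLp 2 (y₁, y₂)⟫_ℝ =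
      ⟪x₁, y₁⟫_ℝ + ⟪x₂, y₂⟫_ℝ := by
  simp [WithLp.prod_inner_apply]

/-- Covariance of the `τ`-Wigner distribution. -/
theorem tauWigner_tfShift (τ : ℝ) (f g : 𝓢(Euc d, ℂ)) (w z : Euc d × Euc d) :
    tauWigner τ (tfShift w.1 w.2 f) (tfShift z.1 z.2 g) =
      (Real.fourierChar ⟪w.1 - z.1, τ • w.2 + (1 - τ) • z.2⟫_ℝ : ℂ) •
        tfShift (WithLp.toLp 2 ((1 - τ) • w.1 + τ • z.1, τ • w.2 + (1 - τ) • z.2) : Phase d)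
          (WithLp.toLp 2 (w.2 - z.2, -(w.1 - z.1))) (tauWigner τ f g) := by
  ext X
  obtain ⟨⟨x, η⟩, rfl⟩ : ∃ x : Euc d × Euc d, X = WithLp.toLp 2 x := ⟨WithLp.ofLp X, rfl⟩
  rw [_root_.smul_apply, tfShift_apply, tauWigner_apply, tauWigner_apply, smul_eq_mul,
    Real.fourierChar_apply, ← integral_const_mul, ← integral_const_mul,
    ← integral_add_right_eq_self _ (w.1 - z.1)]
  refine integral_congr_ae (Eventually.of_forall fun y => ?_)
  -- After the substitution $y\mapsto y+(w_1-z_1)$ both factors are evaluated relative to the same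
  -- centre $(1-\tau)w_1+\tau z_1$; what remains is to compare phases.
  have e1 : x + τ • (y + (w.1 - z.1)) - w.1 = x - ((1 - τ) • w.1 + τ • z.1) + τ • y := by
    module
  have e2 : x - (1 - τ) • (y + (w.1 - z.1)) - z.1 =
      x - ((1 - τ) • w.1 + τ • z.1) - (1 - τ) • y := by
    module
  simp only [tfShift_apply, e1, e2, map_mul, WithLp.toLp_fst, WithLp.toLp_snd, WithLp.sub_fst,
    WithLp.sub_snd, real_inner_toLp, ← Complex.exp_conj, Complex.conj_ofReal, Complex.conj_I,
    map_ofNat]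
  rw [show ∀ a b c e g' : ℂ, a * (b * c) * (e * g') = (a * b * e) * (c * g') by intros; ring,
    show ∀ a b c e g' : ℂ, a * (b * (c * e * g')) = (a * b * c) * (e * g') by intros; ring,
    ← Complex.exp_add, ← Complex.exp_add, ← Complex.exp_add, ← Complex.exp_add]
  congr 2
  simp only [inner_add_left, inner_add_right, inner_sub_left, inner_sub_right, inner_smul_left,
    inner_smul_right, inner_neg_right, RCLike.conj_to_real]
  rw [real_inner_comm w.1 η, real_inner_comm z.1 η]
  push_cast
  ring

/-- The widths $(1-\tau)\alpha$ and $\tau\alpha$ cancel the cross terms in $(1-\tau)\alpha|x+\tau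
y|^2+\tau\alpha|x-(1-\tau)y|^2=\alpha|x|^2+\alpha\tau(1-\tau)|y|^2$. The condition on $\alpha$ makes
the last coefficient $1/\alpha$, so the Fourier transform in $y$ has width $\alpha$ as well and the
result is an isotropic Gaussian on phase space. -/
theorem tauWigner_gaussS {τ α : ℝ} (hα : 0 < α) (hτ₀ : 0 < τ) (hτ₁ : 0 < 1 - τ)
    (h : α ^ 2 * (τ * (1 - τ)) = 1) : ∃ C : ℂ,
      tauWigner τ (gaussS (Euc d) ((1 - τ) * α) (mul_pos hτ₁ hα))
        (gaussS (Euc d) (τ * α) (mul_pos hτ₀ hα)) = C • gaussS (Phase d) α hα := by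
  have hb : 0 < ((Real.pi / α : ℝ) : ℂ).re := by
    rw [Complex.ofReal_re]
    positivity
  refine ⟨((Real.pi : ℂ) / ((Real.pi / α : ℝ) : ℂ)) ^ (Module.finrank ℝ (Euc d) / 2 : ℂ), ?_⟩
  ext X
  rw [tauWigner_apply, _root_.smul_apply]
  have hF := fourier_gaussian_innerProductSpace hb X.snd
  rw [Real.fourier_eq'] at hF
  have e : ∀ y : Euc d, Complex.exp (-2 * Real.pi * Complex.I * ⟪y, X.snd⟫_ℝ) *
      gaussS (Euc d) ((1 - τ) * α) (mul_pos hτ₁ hα) (X.fst + τ • y) *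
      starRingEnd ℂ (gaussS (Euc d) (τ * α) (mul_pos hτ₀ hα) (X.fst - (1 - τ) • y)) =
      Complex.exp (-(Real.pi * α * ‖X.fst‖ ^ 2)) *
      (Complex.exp (↑(-2 * Real.pi * ⟪y, X.snd⟫_ℝ) * Complex.I) •
        Complex.exp (-((Real.pi / α : ℝ) : ℂ) * ‖y‖ ^ 2)) := by
    intro y
    have h1 : (1 - τ) * α * ‖X.fst + τ • y‖ ^ 2 + τ * α * ‖X.fst - (1 - τ) • y‖ ^ 2 =
        α * ‖X.fst‖ ^ 2 + ‖y‖ ^ 2 / α := by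
      rw [norm_add_sq_real, norm_sub_sq_real, inner_smul_right, inner_smul_right, norm_smul,
        norm_smul, mul_pow, mul_pow, Real.norm_eq_abs, Real.norm_eq_abs, sq_abs, sq_abs]
      field_simp
      linear_combination ‖y‖ ^ 2 * h
    have h2 : -(Real.pi * ((1 - τ) * α) * ‖X.fst + τ • y‖ ^ 2) +
        -(Real.pi * (τ * α) * ‖X.fst - (1 - τ) • y‖ ^ 2) =
        -(Real.pi * α * ‖X.fst‖ ^ 2) + -(Real.pi / α) * ‖y‖ ^ 2 := by
      linear_combination (-Real.pi) * h1
    have h3 := congrArg (fun t : ℝ => (t : ℂ)) h2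
    push_cast at h3
    rw [gaussS_apply, gaussS_apply, Complex.conj_ofReal, mul_assoc, Complex.ofReal_exp,
      Complex.ofReal_exp, ← Complex.exp_add, smul_eq_mul, ← Complex.exp_add, ← Complex.exp_add,
      ← Complex.exp_add]
    congr 1
    push_cast
    rw [h3]
    ring
  simp only [e]
  rw [integral_const_mul, hF, gaussS_apply, WithLp.prod_norm_sq_eq_of_L2, smul_eq_mul,
    Complex.ofReal_exp, mul_left_comm, ← Complex.exp_add]
  congr 2
  have : (α : ℂ) ≠ 0 := by exact_mod_cast hα.ne'
  have hpi : (Real.pi : ℂ) ≠ 0 := by exact_mod_cast Real.pi_ne_zero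
  push_cast
  field_simp
  ring

end PhaseSpace

/-! ### Supremum of the short-time Fourier transform over frequencies -/

section StftSup

variable {V : Type} [NormedAddCommGroup V] [InnerProductSpace ℝ V] [FiniteDimensional ℝ V]
  [MeasurableSpace V] [BorelSpace V]

theorem continuous_stft_comp {Z : Type*} [TopologicalSpace Z] (g : 𝓢(V, ℂ)) (u : 𝓢'(V, ℂ))
    {X Ξ : Z → V} (hX : Continuous X) (hΞ : Continuous Ξ) :
    Continuous fun y => stft g u (X y) (Ξ y) :=
  Continuous.comp (g := fun z : V × V => stft g u z.1 z.2) (f := fun y => (X y, Ξ y))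
    (continuous_stft g u) (hX.prodMk hΞ)

/-- The supremum over all frequencies of the short-time Fourier transform. -/
def stftSup (g : 𝓢(V, ℂ)) (u : 𝓢'(V, ℂ)) (x : V) : ℝ≥0∞ :=
  eLpNorm (fun ξ => stft g u x ξ) ⊤ volume

theorem measurable_stftSup (g : 𝓢(V, ℂ)) (u : 𝓢'(V, ℂ)) : Measurable (stftSup g u) := by
  have := measurable_eLpNorm_of_uncurry (ν := volume) (measurable_enorm_stft g u) ⊤
  simp only [eLpNorm_enorm] at this
  exact this

theorem enorm_stft_le_stftSup (g : 𝓢(V, ℂ)) (u : 𝓢'(V, ℂ)) (x ξ : V) :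
    ‖stft g u x ξ‖ₑ ≤ stftSup g u x :=
  enorm_le_eLpNorm_top (f := fun ξ => stft g u x ξ)
    (continuous_stft_comp g u continuous_const continuous_id) ξ

end StftSup

/-! ### The matrix of $\mathrm{Op}_\tau(\sigma)$ and the symbol class -/

section TauPseudodifferential

variable {d : ℕ}

/-- For a fixed test function, continuity in $f$ follows by exchanging the two factors of the tensor
product: $\chi\otimes f$ is $f\otimes\chi$ with the coordinates swapped. -/
theorem exists_clm_Op_apply (τ : ℝ) (σ : 𝓢'(Phase d, ℂ)) (χ : 𝓢(Euc d, ℂ)) :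
    ∃ Λ : 𝓢(Euc d, ℂ) →L[ℂ] ℂ, ∀ f, Λ f = Op τ σ f χ := by
  refine ⟨toCLM σ ∘L (SchwartzMap.compCLMOfContinuousLinearEquiv ℂ
      (WithLp.prodContinuousLinearEquiv 2 ℝ (Euc d) (Euc d))) ∘L
    partialFourierInv ∘L (SchwartzMap.compCLMOfContinuousLinearEquiv ℂ (shear τ)) ∘L
    (SchwartzMap.compCLMOfContinuousLinearEquiv ℂ
      (ContinuousLinearEquiv.prodComm ℝ (Euc d) (Euc d))) ∘L tensorRight χ, fun f => ?_⟩
  change σ _ = σ (wignerDual τ f χ)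
  congr 1
  have e : (SchwartzMap.compCLMOfContinuousLinearEquiv ℂ
      (ContinuousLinearEquiv.prodComm ℝ (Euc d) (Euc d))) (tensorRight χ f) = tensorRight f χ := by
    ext z
    exact mul_comm _ _
  rw [wignerDual, ContinuousLinearMap.comp_apply, ContinuousLinearMap.comp_apply,
    ContinuousLinearMap.comp_apply, ← e]
  rfl

/-- The center of the time-frequency shift of the `τ`-Wigner distribution of two shifted
functions. -/
def wignerTime (τ : ℝ) (w z : Euc d × Euc d) : Phase d :=
  WithLp.toLp 2 ((1 - τ) • w.1 + τ • z.1, τ • w.2 + (1 - τ) • z.2)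

/-- The modulation of the `τ`-Wigner distribution of two shifted functions. -/
def wignerFreq (w z : Euc d × Euc d) : Phase d :=
  WithLp.toLp 2 (w.2 - z.2, -(w.1 - z.1))

/-- Covariance of $W_\tau$ moves both shifts onto the symbol: matrix entries of the operator are, up
to a phase, samples of a short-time Fourier transform of $\sigma$. -/
theorem Op_tfShift (τ : ℝ) (σ : 𝓢'(Phase d, ℂ)) (f g : 𝓢(Euc d, ℂ)) (w z : Euc d × Euc d) :
    Op τ σ (tfShift z.1 z.2 g) (conjS (tfShift w.1 w.2 f)) =
      starRingEnd ℂ (Real.fourierChar ⟪w.1 - z.1, τ • w.2 + (1 - τ) • z.2⟫_ℝ : ℂ) *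
        stft (tauWigner τ f g) σ (wignerTime τ w z) (wignerFreq w z) := by
  change bracket (Op τ σ (tfShift z.1 z.2 g)) (tfShift w.1 w.2 f) = _
  rw [bracket_Op, tauWigner_tfShift]
  have e : ∀ (c : ℂ) (G : 𝓢(Phase d, ℂ)), conjS (c • G) = starRingEnd ℂ c • conjS G := by
    intro c G
    ext t
    simp [conjS_apply]
  rw [bracket, e, map_smul]
  rfl

theorem continuous_Op_tfShift (τ : ℝ) (σ : 𝓢'(Phase d, ℂ)) (f g : 𝓢(Euc d, ℂ)) :
    Continuous (Function.uncurry fun w z : Euc d × Euc d =>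
      Op τ σ (tfShift z.1 z.2 g) (conjS (tfShift w.1 w.2 f))) := by
  simp only [Op_tfShift]
  have h1 : Continuous fun y : (Euc d × Euc d) × (Euc d × Euc d) => wignerTime τ y.1 y.2 :=
    (WithLp.prodContinuousLinearEquiv 2 ℝ (Euc d) (Euc d)).symm.continuous.comp
      (f := fun y : (Euc d × Euc d) × (Euc d × Euc d) =>
        ((1 - τ) • y.1.1 + τ • y.2.1, τ • y.1.2 + (1 - τ) • y.2.2)) (by fun_prop)
  have h2 : Continuous fun y : (Euc d × Euc d) × (Euc d × Euc d) => wignerFreq y.1 y.2 :=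
    (WithLp.prodContinuousLinearEquiv 2 ℝ (Euc d) (Euc d)).symm.continuous.comp
      (f := fun y : (Euc d × Euc d) × (Euc d × Euc d) =>
        (y.1.2 - y.2.2, -(y.1.1 - y.2.1))) (by fun_prop)
  have h3 : Continuous fun y : (Euc d × Euc d) × (Euc d × Euc d) =>
      (Real.fourierChar ⟪y.1.1 - y.2.1, τ • y.1.2 + (1 - τ) • y.2.2⟫_ℝ : ℂ) :=
    continuous_subtype_val.comp (Real.continuous_fourierChar.comp (by fun_prop))
  exact (Complex.continuous_conj.comp h3).mul
    (continuous_stft_comp (tauWigner τ f g) σ h1 h2)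

/-- The linear equivalence `(x, ξ) ↦ (a x, b ξ)` between the product and the Euclidean phase
space. -/
def phaseScale {a b : ℝ} (ha : a ≠ 0) (hb : b ≠ 0) : (Euc d × Euc d) ≃L[ℝ] Phase d :=
  ((ContinuousLinearEquiv.smulLeft (Units.mk0 a ha)).prodCongr
    (ContinuousLinearEquiv.smulLeft (Units.mk0 b hb))).trans
    (WithLp.prodContinuousLinearEquiv 2 ℝ (Euc d) (Euc d)).symm

theorem phaseScale_apply {a b : ℝ} (ha : a ≠ 0) (hb : b ≠ 0) (s : Euc d × Euc d) :
    phaseScale ha hb s = WithLp.toLp 2 (a • s.1, b • s.2) := rfl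

theorem lintegral_comp_continuousLinearEquiv_ne_top {E F : Type*} [NormedAddCommGroup E]
    [NormedSpace ℝ E] [MeasureSpace E] [BorelSpace E] [(volume : Measure E).IsAddHaarMeasure]
    [NormedAddCommGroup F] [NormedSpace ℝ F] [FiniteDimensional ℝ F] [MeasureSpace F] [BorelSpace F]
    [(volume : Measure F).IsAddHaarMeasure] (L : E ≃L[ℝ] F) {G : F → ℝ≥0∞}
    (hG : Measurable G) (h : ∫⁻ y, G y ≠ ⊤) : ∫⁻ x, G (L x) ≠ ⊤ := by
  have : ProperSpace F := FiniteDimensional.proper ℝ F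
  have e : ∫⁻ x, G (L x) = ∫⁻ y, G y ∂(Measure.map L volume) :=
    (lintegral_map hG L.continuous.measurable).symm
  rw [e, Measure.isAddLeftInvariant_eq_smul (Measure.map L volume) volume, lintegral_smul_measure]
  exact ENNReal.mul_ne_top ENNReal.coe_ne_top h

/-- Evaluation of `W(ℱL^∞, L^1_θ)`-norms with a Gaussian window. -/
theorem lintegral_stftSup_gaussS_ne_top {θ : Phase d → ℝ} (hθ0 : ∀ X, 0 ≤ θ X)
    (hθc : Continuous θ) (hθ1 : θ 0 = 1) (hθm : ∀ X Y, θ (X + Y) ≤ θ X * θ Y)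
    (hθe : ∀ X, θ (-X) = θ X) {G : 𝓢(Phase d, ℂ)} (hG : G ≠ 0) {σ : 𝓢'(Phase d, ℂ)}
    (hσ : amalgamNorm ⊤ 1 (fun _ => 1) θ G σ < ⊤) {α : ℝ} (hα : 0 < α) :
    ∫⁻ X, ENNReal.ofReal (θ X) * stftSup (gaussS (Phase d) α hα) σ X ≠ ⊤ := by
  obtain ⟨K, A, hK, hA, hKA⟩ := exists_le_exp_of_submultiplicative hθ0 hθc hθ1 hθm
  -- The weight is moderate with respect to itself with constant $1$:
  -- $\theta(x)\le\theta(-s)\theta(x+s)=\theta(s)\theta(x+s)$ by evenness.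
  obtain ⟨C, hC, H⟩ := exists_amalgamNorm_gaussS_le (p := ⊤) (q := 1) (u := fun _ => 1) (w := θ)
    (ν := fun s => θ s.1) (C₀ := 1) le_top le_rfl measurable_const hθc.measurable
    (fun _ => zero_le_one) hθ0 (hθc.measurable.comp measurable_fst) (fun s => hθ0 _) zero_le_one
    (fun x ξ s => by
      have := hθm (-s.1) (x + s.1)
      rw [hθe, neg_add_cancel_comm_assoc] at this
      simpa using this) hK hA
    (fun s => (hKA s.1).trans (mul_le_mul_of_nonneg_left (Real.exp_le_exp.2
      (mul_le_mul_of_nonneg_left (le_add_of_nonneg_right (norm_nonneg _)) hA)) hK)) hG α hα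
  have h := (H σ).trans_lt (ENNReal.mul_lt_top hC.lt_top hσ)
  simp only [amalgamNorm, eLpNorm_one_eq_lintegral_enorm, enorm_eq_self, Complex.ofReal_one,
    one_mul] at h
  exact h.ne

end TauPseudodifferential

/-! ### Weights under the linear changes of variables -/

section MainTheorem

variable {d : ℕ}

theorem dil₁_eq_smul (τ : ℝ) (x : Euc d) : dil₁ τ x = (-(τ / (1 - τ))) • x :=
  (neg_smul _ _).symm

theorem dil₂_eq_smul (τ : ℝ) (x : Euc d) : dil₂ τ x = (-((1 - τ) / τ)) • x :=
  (neg_smul _ _).symm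

theorem IsAdmissibleWeight.neg {v : Phase d → ℝ} (hv : IsAdmissibleWeight v) (z : Phase d) :
    v (-z) = v z :=
  hv.even _ _ (fun i => by simp) (fun i => by simp)

/-- Moderateness for the decomposition $z=-s+(z+s)$, with $v$ even. The order of the arguments is
reversed because in the amalgam norm $m_1$ weighs frequencies and $m_2$ weighs times. -/
theorem IsModerate.tensorWeight_le {v : Phase d → ℝ} (hv : IsAdmissibleWeight v)
    {m₁ m₂ : Euc d → ℝ} {C₀ : ℝ} (hm : ∀ z₁ z₂, tensorWeight m₁ m₂ (z₁ + z₂) ≤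
      C₀ * v z₁ * tensorWeight m₁ m₂ z₂) (x ξ y η : Euc d) :
    m₂ x * m₁ ξ ≤ C₀ * v (WithLp.toLp 2 (η, y)) * (m₂ (x + y) * m₁ (ξ + η)) := by
  have h := hm (-WithLp.toLp 2 (η, y)) (WithLp.toLp 2 (ξ + η, x + y))
  rw [hv.neg] at h
  have e : -WithLp.toLp 2 (η, y) + WithLp.toLp 2 (ξ + η, x + y) =
      (WithLp.toLp 2 (ξ, x) : Phase d) := by
    rw [← WithLp.toLp_neg, ← WithLp.toLp_add]
    congr 1
    ext i <;> simp
  rw [e] at h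
  simp only [tensorWeight] at h
  rw [mul_comm (m₂ x), mul_comm (m₂ (x + y))]
  exact h

/-- Both alternatives of temperedness give polynomial growth of $1/m$, which is the form needed to
pair the image with Schwartz functions. -/
theorem IsTemperedWeight.exists_inv_le {m : Phase d → ℝ} (hm : IsTemperedWeight m) :
    ∃ (N : ℕ) (P : ℝ), 0 ≤ P ∧ ∀ z, (m z)⁻¹ ≤ P * (1 + ‖z‖) ^ N := by
  rcases hm with h | ⟨N, c, hc, h⟩
  · exact ⟨0, 1, zero_le_one, fun z => by simpa using inv_le_one_of_one_le₀ (h z)⟩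
  · refine ⟨N, c⁻¹, by positivity, fun z => ?_⟩
    have h1 : 0 < Real.sqrt (1 + ‖z‖ ^ 2) := Real.sqrt_pos.2 (by positivity)
    have h2 : Real.sqrt (1 + ‖z‖ ^ 2) ≤ 1 + ‖z‖ :=
      Real.sqrt_le_iff.2 ⟨by positivity, by nlinarith [norm_nonneg z]⟩
    calc (m z)⁻¹ ≤ (c * (Real.sqrt (1 + ‖z‖ ^ 2) ^ N)⁻¹)⁻¹ := inv_anti₀ (by positivity) (h z)
      _ = c⁻¹ * Real.sqrt (1 + ‖z‖ ^ 2) ^ N := by rw [mul_inv, inv_inv]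
      _ ≤ _ := by gcongr

theorem IsTemperedWeight.exists_inv_comp_smul_le {m₁ m₂ : Euc d → ℝ}
    (hm : IsTemperedWeight (tensorWeight m₁ m₂)) (a b : ℝ) :
    ∃ (N : ℕ) (P : ℝ), 0 ≤ P ∧ ∀ x ξ,
      (m₂ (a • x) * m₁ (b • ξ))⁻¹ ≤ P * (1 + ‖(x, ξ)‖) ^ N := by
  obtain ⟨N, P, hP, h⟩ := hm.exists_inv_le
  refine ⟨N, P * (1 + (|a| + |b|)) ^ N, by positivity, fun x ξ => ?_⟩
  have hn : ‖(WithLp.toLp 2 (b • ξ, a • x) : Phase d)‖ ≤ (|a| + |b|) * ‖(x, ξ)‖ := by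
    have e : (WithLp.toLp 2 (b • ξ, a • x) : Phase d) =
        WithLp.toLp 2 (b • ξ, 0) + WithLp.toLp 2 (0, a • x) := by
      rw [← WithLp.toLp_add]
      simp
    rw [e]
    refine (norm_add_le _ _).trans ?_
    rw [WithLp.norm_toLp_fst, WithLp.norm_toLp_snd, norm_smul, norm_smul, Real.norm_eq_abs,
      Real.norm_eq_abs]
    have h1 : ‖x‖ ≤ ‖(x, ξ)‖ := norm_fst_le (x, ξ)
    have h2 : ‖ξ‖ ≤ ‖(x, ξ)‖ := norm_snd_le (x, ξ)
    nlinarith [abs_nonneg a, abs_nonneg b]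
  have h1 := h (WithLp.toLp 2 (b • ξ, a • x))
  simp only [tensorWeight] at h1
  rw [mul_comm (m₂ _)]
  refine h1.trans ?_
  rw [mul_assoc, ← mul_pow]
  gcongr
  nlinarith [abs_nonneg a, abs_nonneg b, norm_nonneg (x, ξ)]

theorem Bmat_Jinv_add (τ : ℝ) (X Y : Phase d) :
    Bmat τ (Jinv (X + Y)) = Bmat τ (Jinv X) + Bmat τ (Jinv Y) := by
  simp only [Bmat, Jinv, ← WithLp.toLp_add]
  congr 1
  ext i <;> simp
  ring

theorem continuous_Bmat_Jinv (τ : ℝ) :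
    Continuous fun X : Phase d => Bmat τ (Jinv X) :=
  (WithLp.prodContinuousLinearEquiv 2 ℝ (Euc d) (Euc d)).symm.continuous.comp
    (f := fun X : Phase d => ((1 / (1 - τ)) • -X.snd, (1 / τ) • X.fst)) (by fun_prop)

/-- The matrix $\mathcal B_\tau$ is built to undo the scaling of the time component of the matrix
entries, so that the symbol weight becomes $v$ itself, up to a swap and a sign. -/
theorem Bmat_Jinv_phaseScale {τ : ℝ} (hτ : τ ≠ 0) (hτ' : 1 - τ ≠ 0) (s : Euc d × Euc d) :
    Bmat τ (Jinv (phaseScale hτ hτ' s)) = WithLp.toLp 2 (-s.2, s.1) := by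
  rw [phaseScale_apply]
  simp only [Bmat, Jinv]
  congr 1
  ext i
  · simp [hτ']
  · simp [hτ]

/-- Factoring $\tau$ and $1-\tau$ out of the two components exhibits the dependence on $z-Dw$. This
is where the dilations of the target weights come from. -/
theorem wignerTime_eq_phaseScale {τ : ℝ} (hτ : τ ≠ 0) (hτ' : 1 - τ ≠ 0) (w z : Euc d × Euc d) :
    wignerTime τ w z = phaseScale hτ hτ' (z.1 - (-((1 - τ) / τ)) • w.1,
      z.2 - (-(τ / (1 - τ))) • w.2) := by
  rw [phaseScale_apply, wignerTime]
  dsimp only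
  congr 2
  · rw [neg_smul, sub_neg_eq_add, smul_add, smul_smul, mul_div_cancel₀ _ hτ, add_comm]
  · rw [neg_smul, sub_neg_eq_add, smul_add, smul_smul, mul_div_cancel₀ _ hτ', add_comm]

theorem stft_smul_window {V : Type} [NormedAddCommGroup V] [InnerProductSpace ℝ V]
    [FiniteDimensional ℝ V] [MeasurableSpace V] [BorelSpace V] (c : ℂ) (g : 𝓢(V, ℂ))
    (u : 𝓢'(V, ℂ)) (x ξ : V) : stft (c • g) u x ξ = starRingEnd ℂ c * stft g u x ξ := by
  have e : conjS (c • g) = starRingEnd ℂ c • conjS g := by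
    ext t
    simp [conjS_apply]
  have e' : tfShift x (-ξ) (starRingEnd ℂ c • conjS g) =
      starRingEnd ℂ c • tfShift x (-ξ) (conjS g) := by
    simp [tfShift, map_smul]
  rw [stft_eq, stft_eq, e, e', map_smul]
  rfl

theorem exists_scale {τ : ℝ} (hτ₀ : 0 < τ) (hτ₁ : 0 < 1 - τ) :
    ∃ α : ℝ, 0 < α ∧ α ^ 2 * (τ * (1 - τ)) = 1 := by
  have h : 0 < τ * (1 - τ) := mul_pos hτ₀ hτ₁
  refine ⟨(Real.sqrt (τ * (1 - τ)))⁻¹, inv_pos.2 (Real.sqrt_pos.2 h), ?_⟩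
  rw [inv_pow, Real.sq_sqrt h.le, inv_mul_cancel₀ h.ne']

end MainTheorem

end TauPseudo

end

/-! ### Assembly of the theorem -/

theorem mainTheorem7 (d : ℕ)
    (v : TauPseudo.Phase d → ℝ) (hv : TauPseudo.IsAdmissibleWeight v)
    (m₁ m₂ : TauPseudo.Euc d → ℝ)
    (hm₁_meas : Measurable m₁) (hm₂_meas : Measurable m₂)
    (hm₁_pos : ∀ x, 0 < m₁ x) (hm₂_pos : ∀ x, 0 < m₂ x)
    (hm₁_even : ∀ x, m₁ (-x) = m₁ x) (hm₂_even : ∀ x, m₂ (-x) = m₂ x)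
    (hm_mod : TauPseudo.IsModerate v (TauPseudo.tensorWeight m₁ m₂))
    (hm_temp : TauPseudo.IsTemperedWeight (TauPseudo.tensorWeight m₁ m₂))
    (p q : ENNReal) (hp : 1 ≤ p) (hq : 1 ≤ q)
    (τ : ℝ) (hτ₀ : 0 < τ) (hτ₁ : τ < 1)
    -- the symbol: `σ ∈ W(ℱL^∞, L^1_{v ∘ 𝓑_τ ∘ J⁻¹})(ℝ^{2d})`, tested with any window `G`
    (G : SchwartzMap (TauPseudo.Phase d) ℂ)
    (hG : TauPseudo.IsWindow (fun _ X => v (TauPseudo.Bmat τ (TauPseudo.Jinv X))) G)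
    (σ : TemperedDistribution (TauPseudo.Phase d) ℂ)
    (hσ : TauPseudo.amalgamNorm ⊤ 1 (fun _ => 1)
      (fun X => v (TauPseudo.Bmat τ (TauPseudo.Jinv X))) G σ < ⊤)
    -- any windows `g`, `h` for the source and the target space
    (g : SchwartzMap (TauPseudo.Euc d) ℂ)
    (hg : TauPseudo.IsWindow (fun ξ x => v (WithLp.toLp 2 (ξ, x))) g)
    (h : SchwartzMap (TauPseudo.Euc d) ℂ)
    (hh : TauPseudo.IsWindow
      (fun ξ x => v (WithLp.toLp 2 (TauPseudo.dil₁ τ ξ, TauPseudo.dil₂ τ x))) h) :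
    TauPseudo.BoundedBetween (TauPseudo.Op τ σ)
      (TauPseudo.amalgamNorm p q m₁ m₂ g)
      (TauPseudo.amalgamNorm p q (fun ξ => m₁ (TauPseudo.dil₁ τ ξ))
        (fun x => m₂ (TauPseudo.dil₂ τ x)) h) := by
  open TauPseudo in
  have hτ₁' : 0 < 1 - τ := sub_pos.2 hτ₁
  obtain ⟨-, C₀, hC₀, hmod⟩ := hm_mod
  obtain ⟨α, hα, hατ⟩ := exists_scale hτ₀ hτ₁'
  obtain ⟨C, hC⟩ := tauWigner_gaussS (d := d) hα hτ₀ hτ₁' hατ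
  obtain ⟨N, P, hP, hlow⟩ := hm_temp.exists_inv_comp_smul_le (-((1 - τ) / τ))
    (-(τ / (1 - τ)))
  have hsw : Continuous fun s : Euc d × Euc d => (WithLp.toLp 2 (s.2, s.1) : Phase d) :=
    (WithLp.prodContinuousLinearEquiv 2 ℝ (Euc d) (Euc d)).symm.continuous.comp
      (f := fun s : Euc d × Euc d => (s.2, s.1)) (by fun_prop)
  -- The arguments are swapped: a point $s$ of the time-frequency plane is (time, frequency), while
  -- $v$ takes the frequency, weighed by $m_1$, first.
  have hνc : Continuous fun s : Euc d × Euc d => v (WithLp.toLp 2 (s.2, s.1)) :=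
    hv.continuous.comp hsw
  obtain ⟨K, A, hK, hA, hKA⟩ := exists_le_exp_of_submultiplicative (fun s => hv.nonneg _) hνc
    hv.map_zero' (fun s t => hv.submultiplicative (WithLp.toLp 2 (s.2, s.1))
      (WithLp.toLp 2 (t.2, t.1)))
  have hν'c : Continuous fun s : Euc d × Euc d =>
      v (WithLp.toLp 2 (dil₁ τ s.2, dil₂ τ s.1)) :=
    hνc.comp (f := fun s : Euc d × Euc d => (dil₂ τ s.1, dil₁ τ s.2))
      (by unfold dil₁ dil₂; fun_prop)
  have hwc := hv.continuous.comp (continuous_Bmat_Jinv (d := d) τ)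
  have hint := lintegral_stftSup_gaussS_ne_top (fun X => hv.nonneg (Bmat τ (Jinv X))) hwc
    (by
      rw [← hv.map_zero']
      congr 1
      simpa using Bmat_Jinv_add (d := d) τ 0 0)
    (fun X Y => by
      rw [Bmat_Jinv_add]
      exact hv.submultiplicative _ _)
    (fun X => by
      have : Bmat τ (Jinv (-X)) = -Bmat τ (Jinv X) := by
        have h0 : Bmat τ (Jinv (0 : Phase d)) = 0 := by simpa using Bmat_Jinv_add (d := d) τ 0 0
        rw [eq_neg_iff_add_eq_zero, ← Bmat_Jinv_add, neg_add_cancel, h0]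
      rw [this, hv.neg])
    hG.1 hσ hα
  have hmeas := measurable_stftSup (gaussS (Phase d) α hα) σ
  have hki := lintegral_comp_continuousLinearEquiv_ne_top (phaseScale hτ₀.ne' hτ₁'.ne')
    ((ENNReal.measurable_ofReal.comp hwc.measurable).mul hmeas) hint
  simp only [dil₁_eq_smul, dil₂_eq_smul] at hh hν'c ⊢
  -- The analyzing Gaussian $\psi$ has width $(1-\tau)\alpha$ and the source Gaussian $\varphi$ has
  -- width $\tau\alpha$, so that $W_\tau(\psi,\varphi)$ is $C$ times the Gaussian of width $\alpha$
  -- on phase space; hence the factor $|C|$ in the kernel.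
  refine boundedBetween_of_kernel
    (ν := fun s => v (WithLp.toLp 2 (s.2, s.1)))
    (ν' := fun s => v (WithLp.toLp 2 ((-(τ / (1 - τ))) • s.2, (-((1 - τ) / τ)) • s.1)))
    (k := fun s => ‖C‖ₑ * stftSup (gaussS (Phase d) α hα) σ (phaseScale hτ₀.ne' hτ₁'.ne' s))
    (neg_ne_zero.2 (div_ne_zero hτ₁'.ne' hτ₀.ne')) (neg_ne_zero.2 (div_ne_zero hτ₀.ne' hτ₁'.ne'))
    hp hq hm₁_meas hm₂_meas hm₁_pos hm₂_pos hνc.measurable (fun s => hv.nonneg _) hC₀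
    (fun x ξ s => IsModerate.tensorWeight_le hv hmod x ξ s.1 s.2) hK hA
    (fun s => (hKA s).trans ?_) hP hlow (exists_clm_Op_apply τ σ) (mul_pos hτ₁' hα)
    (mul_pos hτ₀ hα) (continuous_Op_tfShift τ σ _ _).stronglyMeasurable
    ((hmeas.comp (phaseScale hτ₀.ne' hτ₁'.ne').continuous.measurable).const_mul _) ?_
    (fun w z => ?_) hg.1 hν'c.measurable (fun s => hv.nonneg _) (fun x ξ s => ?_) ?_
  · refine mul_le_mul_of_nonneg_left (Real.exp_le_exp.2 (mul_le_mul_of_nonneg_left ?_ hA)) hK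
    exact max_le (le_add_of_nonneg_right (norm_nonneg _)) (le_add_of_nonneg_left (norm_nonneg _))
  -- Since $v$ is even in each coordinate, the sign left by $J^{-1}$ is harmless and the symbol
  -- weight agrees with the moderating weight.
  · have e : ∀ s : Euc d × Euc d, ‖C‖ₑ * stftSup (gaussS (Phase d) α hα) σ
        (phaseScale hτ₀.ne' hτ₁'.ne' s) * ENNReal.ofReal (v (WithLp.toLp 2 (s.2, s.1))) =
        ‖C‖ₑ * (ENNReal.ofReal (v (Bmat τ (Jinv (phaseScale hτ₀.ne' hτ₁'.ne' s)))) *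
          stftSup (gaussS (Phase d) α hα) σ (phaseScale hτ₀.ne' hτ₁'.ne' s)) := by
      intro s
      rw [Bmat_Jinv_phaseScale, hv.even (WithLp.toLp 2 (s.2, s.1)) (WithLp.toLp 2 (-s.2, s.1))
        (fun i => by simp) (fun i => rfl)]
      ring
    simp only [e]
    rw [lintegral_const_mul' _ _ (by simp)]
    exact ENNReal.mul_ne_top (by simp) hki
  · rw [Op_tfShift, hC, enorm_mul, stft_smul_window, enorm_mul,
      ← wignerTime_eq_phaseScale hτ₀.ne' hτ₁'.ne']
    have h1 : ∀ c : ℂ, ‖starRingEnd ℂ c‖ₑ = ‖c‖ₑ := fun c => by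
      rw [← ofReal_norm, RCLike.norm_conj, ofReal_norm]
    have h2 : ∀ c : Circle, ‖(c : ℂ)‖ₑ = 1 := fun c => by
      rw [← ofReal_norm, Circle.norm_coe, ENNReal.ofReal_one]
    rw [h1, h1, h2, one_mul]
    exact mul_le_mul' le_rfl (enorm_stft_le_stftSup _ _ _ _)
  · simp only [smul_add]
    exact IsModerate.tensorWeight_le hv hmod _ _ _ _
  -- The window condition on $h$ is finiteness of exactly this integral, once the Gaussian transform
  -- is rewritten through `tfPair`.
  · refine ne_of_eq_of_ne (lintegral_congr fun s => ?_) hh.2.2.ne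
    rw [enorm_mul, norm_gaussStft, enorm_norm, Real.enorm_of_nonneg (hv.nonneg _)]
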